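/- Fix an integer $d\ge 3$, a real number $t>0$, and $z\in\mathbb C$ with $\operatorname{Im} z>0$. **Finite model.** For each $N\ge d+1$ with $Nd$ even, let $\mathcal G_N$ be a uniformly random simple $d$-regular graph on $N$ labelled vertices with adjacency matrix $A_N$. Let $g_1,g_2,\dots$ be i.i.d. standard Gaussian random variables which, for every such $N$, are independent of $\mathcal G_N$. Put $$W_N=-tA_N+\operatorname{diag}(g_1,\dots,g_N),\qquad G_N(z)=(W_N-z)^{-1},\qquad m_N(z)=\frac1N\operatorname{Tr}G_N(z).$$ **Infinite model.** Let $\mathbb T_d$ be the $d$-regular rooted tree (the Bethe lattice) with root $0$, vertex set $\mathbb V$ and adjacency operator $A$ on $\ell^2(\mathbb V)$. Let $(g_v)_{v\in\mathbb V}$ be i.i.d. standard Gaussian random variables, let $V$ be the operator of multiplication by $(g_v)$ on the domain $\{\psi\in\ell^2(\mathbb V):(g_v\psi(v))_{v}\in\ell^2(\mathbb V)\}$, and let $H=-tA+V$, a self-adjoint operator on the domain of $V$. Let $\mu$ be the projection-valued measure with $H=\int\lambda\,d\mu(\lambda)$, and let $\mu_0(S)=\langle\delta_0,\mu(S)\delta_0\rangle$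 for Borel sets $S\subset\mathbb R$. Let $\nu(S)=\mathbb E[\mu_0(S)]$ be the density of states measure, with Stieltjes transform $$m_{\mathbb T}(z)=\int_{\mathbb R}\frac{1}{\lambda-z}\,d\nu(\lambda).$$ **Proposition.** $m_N(z)\to m_{\mathbb T}(z)$ in probability as $N\to\infty$ (along the integers $N\ge d+1$ with $Nd$ even); that is, for every $\varepsilon>0$, $\lim_{N\to\infty}\mathbb P\big(|m_N(z)-m_{\mathbb T}(z)|\ge\varepsilon\big)=0$. -/

import Mathlib

open MeasureTheory ProbabilityTheory Filter Topology

namespace BetheAnderson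

noncomputable section

/-! ### The Anderson model on a finite graph -/

/-- The numbers of vertices for which `d`-regular graphs are considered: `N ≥ d + 1` and `N d` even. -/
def admissibleSizes (d : ℕ) : Set ℕ := {N | d + 1 ≤ N ∧ Even (N * d)}

open Classical in
/-- The set of (simple, labelled) `d`-regular graphs on `N` vertices. -/
def regularGraphs (d N : ℕ) : Set (SimpleGraph (Fin N)) := {Γ | Γ.IsRegularOfDegree d}

open Classical in
/-- The symmetric matrix `W = -t A + diag(g)` of a graph `Γ` on `N` vertices and a potential `g`. -/
def andersonMatrix {N : ℕ} (t : ℝ) (Γ : SimpleGraph (Fin N)) (g : Fin N → ℝ) :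
    Matrix (Fin N) (Fin N) ℝ :=
  -t • Γ.adjMatrix ℝ + Matrix.diagonal g

/-- The resolvent `(W - z)⁻¹` of a real matrix `W`. -/
def matrixResolvent {N : ℕ} (W : Matrix (Fin N) (Fin N) ℝ) (z : ℂ) : Matrix (Fin N) (Fin N) ℂ :=
  (W.map (fun x : ℝ => (x : ℂ)) - z • (1 : Matrix (Fin N) (Fin N) ℂ))⁻¹

/-- The normalized trace `N⁻¹ Tr (W - z)⁻¹` of the resolvent. -/
def normalizedTrace {N : ℕ} (W : Matrix (Fin N) (Fin N) ℝ) (z : ℂ) : ℂ :=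
  (N : ℂ)⁻¹ * (matrixResolvent W z).trace

/-! ### Spectral measures of unbounded operators -/

section Spectral

variable {E : Type*} [NormedAddCommGroup E] [InnerProductSpace ℂ E] [CompleteSpace E]

/-- A projection-valued measure on the Borel sets of `ℝ`: orthogonal projections, countably
additive in the strong operator topology, with total mass the identity.  (The values at
non-Borel sets are irrelevant.) -/
structure ProjectionValuedMeasure (E : Type*) [NormedAddCommGroup E] [InnerProductSpace ℂ E]
    [CompleteSpace E] where
  proj : Set ℝ → E →L[ℂ] E
  isStarProjection : ∀ S, MeasurableSet S → IsStarProjection (proj S)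
  proj_univ : proj Set.univ = 1
  hasSum_iUnion : ∀ S : ℕ → Set ℝ, (∀ n, MeasurableSet (S n)) →
    Pairwise (Function.onFun Disjoint S) →
    ∀ ψ : E, HasSum (fun n => proj (S n) ψ) (proj (⋃ n, S n) ψ)

theorem ProjectionValuedMeasure.inner_eq (P : ProjectionValuedMeasure E) (ψ : E) {S : Set ℝ}
    (hS : MeasurableSet S) : inner ℂ ψ (P.proj S ψ) = ((‖P.proj S ψ‖ ^ 2 : ℝ) : ℂ) := by
  have h := P.isStarProjection S hS
  have h1 : P.proj S (P.proj S ψ) = P.proj S ψ := by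
    have := congrArg (fun T : E →L[ℂ] E => T ψ) h.isIdempotentElem
    simpa using this
  have h2 : inner ℂ (P.proj S ψ) (P.proj S ψ) = inner ℂ ψ (P.proj S (P.proj S ψ)) := by
    have := ContinuousLinearMap.adjoint_inner_left (P.proj S) (P.proj S ψ) ψ
    rw [← ContinuousLinearMap.star_eq_adjoint, h.isSelfAdjoint.star_eq] at this
    exact this
  rw [h1] at h2
  rw [← h2, inner_self_eq_norm_sq_to_K]
  norm_cast

/-- The scalar measure `S ↦ ⟨ψ, P(S) ψ⟩` of a projection-valued measure `P`. -/
def ProjectionValuedMeasure.measureAt (P : ProjectionValuedMeasure E) (ψ : E) : Measure ℝ :=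
  Measure.ofMeasurable (fun S _ => ENNReal.ofReal (inner ℂ ψ (P.proj S ψ)).re)
    (by
      have h := (P.hasSum_iUnion (fun _ => ∅) (fun _ => MeasurableSet.empty)
        (fun _ _ _ => disjoint_bot_left) ψ).summable
      have h0 : P.proj ∅ ψ = 0 := by simpa [summable_const_iff] using h
      simp [h0])
    (by
      intro S hS hd
      have h := (P.hasSum_iUnion S hS hd ψ).mapL (innerSL ℂ ψ)
      have h2 := h.mapL Complex.reCLM
      have hnn : ∀ n, 0 ≤ (inner ℂ ψ (P.proj (S n) ψ)).re := fun n => by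
        rw [P.inner_eq ψ (hS n), Complex.ofReal_re]; positivity
      simp only [innerSL_apply_apply, Complex.reCLM_apply] at h2
      rw [← h2.tsum_eq, ENNReal.ofReal_tsum_of_nonneg hnn h2.summable])

/-- `H = ∫ λ dP(λ)`: the domain of `H` consists of the vectors `ψ` with
`∫ λ² d⟨ψ, P(λ) ψ⟩ < ∞`, and `⟨ψ, H ψ⟩ = ∫ λ d⟨ψ, P(λ) ψ⟩` for all these `ψ`
(by polarization, this determines `H`). -/
def IsSpectralResolution (H : E →ₗ.[ℂ] E) (P : ProjectionValuedMeasure E) : Prop :=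
  (∀ ψ : E, ψ ∈ H.domain ↔ ∫⁻ x, ENNReal.ofReal (x ^ 2) ∂(P.measureAt ψ) < ⊤) ∧
    ∀ ψ : H.domain, inner ℂ (ψ : E) (H ψ) = ((∫ x, x ∂(P.measureAt (ψ : E)) : ℝ) : ℂ)

open Classical in
/-- The spectral measure `S ↦ ⟨ψ, P(S) ψ⟩` of the operator `H` at the vector `ψ`, where `P` is
the projection-valued measure with `H = ∫ λ dP(λ)` (which exists and is unique on Borel sets
for self-adjoint `H`; if there is none, the value is the zero measure). -/
def spectralMeasureAt (H : E →ₗ.[ℂ] E) (ψ : E) : Measure ℝ :=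
  if h : ∃ P : ProjectionValuedMeasure E, IsSpectralResolution H P then h.choose.measureAt ψ else 0

end Spectral

/-- The Stieltjes transform `z ↦ ∫ (x - z)⁻¹ dν(x)` of a measure on `ℝ`. -/
def stieltjesTransform (ν : Measure ℝ) (z : ℂ) : ℂ := ∫ x : ℝ, 1 / ((x : ℂ) - z) ∂ν

/-! ### Anderson operators on infinite graphs -/

section Operator

variable {V : Type*}

theorem memℓp_two_iff (f : V → ℂ) : Memℓp f 2 ↔ ∑' v, ENNReal.ofReal (‖f v‖ ^ 2) ≠ ⊤ := by
  rw [memℓp_gen_iff (by norm_num)]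
  simp only [ENNReal.toReal_ofNat, Real.rpow_ofNat]
  constructor
  · intro h
    exact h.tsum_ofReal_ne_top
  · intro h
    have := ENNReal.summable_toReal h
    refine this.congr fun v => ?_
    rw [ENNReal.toReal_ofReal (by positivity)]

theorem memℓp_adjacency (Γ : SimpleGraph V) [Γ.LocallyFinite] {d : ℕ} (h : ∀ v, Γ.degree v ≤ d)
    (ψ : lp (fun _ : V => ℂ) 2) :
    Memℓp (fun v => ∑ w ∈ Γ.neighborFinset v, ψ w) 2 := by
  classical
  have hψ := (memℓp_two_iff _).1 (lp.memℓp ψ)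
  rw [memℓp_two_iff]
  have key : ∀ v, ENNReal.ofReal (‖∑ w ∈ Γ.neighborFinset v, ψ w‖ ^ 2) ≤
      d * ∑' w, if Γ.Adj v w then ENNReal.ofReal (‖ψ w‖ ^ 2) else 0 := by
    intro v
    have e : (∑' w, if Γ.Adj v w then ENNReal.ofReal (‖ψ w‖ ^ 2) else 0) =
        ENNReal.ofReal (∑ w ∈ Γ.neighborFinset v, ‖ψ w‖ ^ 2) := by
      rw [tsum_eq_sum (s := Γ.neighborFinset v) (fun w hw => by
        rw [if_neg (by simpa using hw)]), ENNReal.ofReal_sum_of_nonneg (fun _ _ => by positivity)]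
      exact Finset.sum_congr rfl fun w hw => if_pos (by simpa using hw)
    rw [e, ← ENNReal.ofReal_natCast, ← ENNReal.ofReal_mul (by positivity)]
    apply ENNReal.ofReal_le_ofReal
    calc ‖∑ w ∈ Γ.neighborFinset v, ψ w‖ ^ 2 ≤ (∑ w ∈ Γ.neighborFinset v, ‖ψ w‖) ^ 2 := by
          gcongr; exact norm_sum_le _ _
      _ ≤ (Γ.neighborFinset v).card * ∑ w ∈ Γ.neighborFinset v, ‖ψ w‖ ^ 2 :=
          sq_sum_le_card_mul_sum_sq
      _ ≤ d * ∑ w ∈ Γ.neighborFinset v, ‖ψ w‖ ^ 2 := by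
          gcongr; exact h v
  refine ne_top_of_le_ne_top ?_ (ENNReal.tsum_le_tsum key)
  rw [ENNReal.tsum_mul_left, ENNReal.tsum_comm]
  refine ENNReal.mul_ne_top (by simp) ?_
  have key2 : ∀ w, (∑' v, if Γ.Adj v w then ENNReal.ofReal (‖ψ w‖ ^ 2) else 0) ≤
      d * ENNReal.ofReal (‖ψ w‖ ^ 2) := by
    intro w
    rw [tsum_eq_sum (s := Γ.neighborFinset w) (fun v hv => by
        rw [if_neg (by simpa [Γ.adj_comm] using hv)])]
    calc _ ≤ ∑ v ∈ Γ.neighborFinset w, ENNReal.ofReal (‖ψ w‖ ^ 2) :=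
          Finset.sum_le_sum fun v _ => by split_ifs <;> simp
      _ ≤ _ := by
          rw [Finset.sum_const, nsmul_eq_mul]
          gcongr
          exact h w
  refine ne_top_of_le_ne_top ?_ (ENNReal.tsum_le_tsum key2)
  rw [ENNReal.tsum_mul_left]
  exact ENNReal.mul_ne_top (by simp) hψ

/-- The adjacency operator `(A ψ)(v) = ∑_{w ~ v} ψ(w)` on `ℓ²(V)` of a graph of bounded degree. -/
def adjacencyOperator (Γ : SimpleGraph V) [Γ.LocallyFinite] {d : ℕ} (h : ∀ v, Γ.degree v ≤ d) :
    lp (fun _ : V => ℂ) 2 →ₗ[ℂ] lp (fun _ : V => ℂ) 2 where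
  toFun ψ := ⟨fun v => ∑ w ∈ Γ.neighborFinset v, ψ w, memℓp_adjacency Γ h ψ⟩
  map_add' ψ φ := by
    ext v
    exact (Finset.sum_congr rfl fun w _ => rfl).trans Finset.sum_add_distrib
  map_smul' c ψ := by
    ext v
    simp [Finset.mul_sum]

/-- Multiplication by a real potential `g`, as an unbounded operator on `ℓ²(V)` with its
natural domain `{ψ : g ψ ∈ ℓ²(V)}`. -/
def potentialOperator (g : V → ℝ) : lp (fun _ : V => ℂ) 2 →ₗ.[ℂ] lp (fun _ : V => ℂ) 2 where
  domain :=
    { carrier := {ψ | Memℓp (fun v => (g v : ℂ) * ψ v) 2}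
      add_mem' := by
        intro ψ φ hψ hφ
        have := Memℓp.add hψ hφ
        refine (congrArg (fun f => Memℓp f 2) ?_).mp this
        ext v
        simp [mul_add]
      zero_mem' := by
        have : Memℓp (0 : V → ℂ) 2 := zero_memℓp
        refine (congrArg (fun f => Memℓp f 2) ?_).mp this
        ext v
        simp
      smul_mem' := by
        intro c ψ hψ
        have := Memℓp.const_smul hψ c
        refine (congrArg (fun f => Memℓp f 2) ?_).mp this
        ext v
        simp [mul_left_comm] }
  toFun :=
    { toFun := fun ψ => ⟨fun v => (g v : ℂ) * (ψ : lp (fun _ : V => ℂ) 2) v, ψ.2⟩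
      map_add' := by
        intro ψ φ
        ext v
        exact mul_add _ _ _
      map_smul' := by
        intro c ψ
        ext v
        simp [mul_left_comm] }

/-- The Anderson operator `-t A + V` on `ℓ²(V)`, on the domain of the potential. -/
def andersonOperator (Γ : SimpleGraph V) [Γ.LocallyFinite] {d : ℕ} (h : ∀ v, Γ.degree v ≤ d)
    (t : ℝ) (g : V → ℝ) : lp (fun _ : V => ℂ) 2 →ₗ.[ℂ] lp (fun _ : V => ℂ) 2 :=
  (-(t : ℂ) • adjacencyOperator Γ h) +ᵥ potentialOperator g

end Operator

/-! ### The Bethe lattice -/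

/-- Vertices of the `d`-regular rooted tree: `none` is the root, which has the `d` children
`some (a, [])`; the vertex `some (a, l)` has the `d - 1` children `some (a, b :: l)`. -/
abbrev BetheVertex (d : ℕ) : Type := Option (Fin d × List (Fin (d - 1)))

/-- `IsChild x y` means that `y` is a child of `x`. -/
inductive IsChild {d : ℕ} : BetheVertex d → BetheVertex d → Prop
  | root (a : Fin d) : IsChild none (some (a, []))
  | step (a : Fin d) (b : Fin (d - 1)) (l : List (Fin (d - 1))) :
      IsChild (some (a, l)) (some (a, b :: l))

/-- The Bethe lattice: the `d`-regular rooted tree. -/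
def betheLattice (d : ℕ) : SimpleGraph (BetheVertex d) := SimpleGraph.fromRel IsChild

theorem IsChild.ne {d : ℕ} {x y : BetheVertex d} (h : IsChild x y) : x ≠ y := by
  cases h <;> simp

theorem IsChild.unique {d : ℕ} {x x' y : BetheVertex d} (h : IsChild x y) (h' : IsChild x' y) :
    x = x' := by
  cases h <;> cases h' <;> rfl

theorem betheLattice_adj {d : ℕ} {x y : BetheVertex d} :
    (betheLattice d).Adj x y ↔ IsChild x y ∨ IsChild y x := by
  simp only [betheLattice, SimpleGraph.fromRel_adj]
  exact ⟨fun h => h.2, fun h => ⟨h.elim IsChild.ne (fun h => h.ne.symm), h⟩⟩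

theorem neighborSet_root (d : ℕ) : (betheLattice d).neighborSet none =
    Set.range (fun a : Fin d => (some (a, []) : BetheVertex d)) := by
  ext y
  simp only [SimpleGraph.mem_neighborSet, betheLattice_adj, Set.mem_range]
  constructor
  · rintro (h | h)
    · cases h; exact ⟨_, rfl⟩
    · cases h
  · rintro ⟨a, rfl⟩
    exact Or.inl (.root a)

theorem exists_parent {d : ℕ} (a : Fin d) (l : List (Fin (d - 1))) :
    ∃ p : BetheVertex d, IsChild p (some (a, l)) := by
  cases l with
  | nil => exact ⟨_, .root a⟩
  | cons b l => exact ⟨_, .step a b l⟩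

theorem neighborSet_some {d : ℕ} (a : Fin d) (l : List (Fin (d - 1))) (p : BetheVertex d)
    (hp : IsChild p (some (a, l))) : (betheLattice d).neighborSet (some (a, l)) =
      insert p (Set.range (fun b : Fin (d - 1) => (some (a, b :: l) : BetheVertex d))) := by
  ext y
  simp only [SimpleGraph.mem_neighborSet, betheLattice_adj, Set.mem_insert_iff, Set.mem_range]
  constructor
  · rintro (h | h)
    · cases h; exact Or.inr ⟨_, rfl⟩
    · exact Or.inl (h.unique hp)
  · rintro (rfl | ⟨b, rfl⟩)
    · exact Or.inr hp
    · exact Or.inl (.step a b l)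

theorem finite_neighborSet {d : ℕ} (v : BetheVertex d) : ((betheLattice d).neighborSet v).Finite := by
  rcases v with _ | ⟨a, l⟩
  · rw [neighborSet_root]; exact Set.finite_range _
  · obtain ⟨p, hp⟩ := exists_parent a l
    rw [neighborSet_some a l p hp]; exact (Set.finite_range _).insert _

instance (d : ℕ) : (betheLattice d).LocallyFinite := fun v => (finite_neighborSet v).fintype

theorem betheLattice_isRegular (d : ℕ) : (betheLattice d).IsRegularOfDegree d := by
  intro v
  rw [← SimpleGraph.card_neighborSet_eq_degree, ← Nat.card_eq_fintype_card, Nat.card_coe_set_eq]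
  rcases v with _ | ⟨a, l⟩
  · rw [neighborSet_root, Set.ncard_range_of_injective (fun a b h => by simpa using h),
      Nat.card_eq_fintype_card, Fintype.card_fin]
  · obtain ⟨p, hp⟩ := exists_parent a l
    rw [neighborSet_some a l p hp, Set.ncard_insert_of_notMem _ (Set.finite_range _),
      Set.ncard_range_of_injective (fun a b h => by simpa using h),
      Nat.card_eq_fintype_card, Fintype.card_fin]
    · have := a.pos
      omega
    · rintro ⟨b, rfl⟩
      have : ∀ x y : BetheVertex d, IsChild x y → x = some (a, b :: l) → y ≠ some (a, l) := by
        rintro x y h h1 h2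
        cases h with
        | root a => simp at h1
        | step a' b' l' =>
          simp only [Option.some.injEq, Prod.mk.injEq] at h1 h2
          have e1 := congrArg List.length h1.2
          have e2 := congrArg List.length h2.2
          simp only [List.length_cons] at e1 e2
          omega
      exact this _ _ hp rfl rfl

/-- The Bethe lattice is indeed a tree. -/
theorem betheLattice_isTree (d : ℕ) : (betheLattice d).IsTree := by
  have hroot : ∀ v, (betheLattice d).Reachable none v := by
    rintro (_ | ⟨a, l⟩)
    · exact .refl _
    · induction l with
      | nil => exact (betheLattice_adj.2 (Or.inl (.root a))).reachable
      | cons b l ih => exact ih.trans (betheLattice_adj.2 (Or.inl (.step a b l))).reachable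
  refine ⟨⟨fun u v => (hroot u).symm.trans (hroot v)⟩, ?_⟩
  rw [SimpleGraph.isAcyclic_iff_forall_adj_isBridge]
  have main : ∀ x y, IsChild x y → (betheLattice d).IsBridge s(x, y) := by
    intro x y h
    rw [SimpleGraph.isBridge_iff]
    rintro ⟨p⟩
    -- the descendants of `y` are closed under adjacency once the edge `{x, y}` is removed
    obtain ⟨a, l, rfl⟩ : ∃ a l, y = some (a, l) := by
      cases h with
      | root a => exact ⟨_, _, rfl⟩
      | step a b l => exact ⟨_, _, rfl⟩
    have closed : ∀ u v : BetheVertex d,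
        ((betheLattice d).deleteEdges {s(x, some (a, l))}).Adj u v →
        (∃ m, v = some (a, m ++ l)) → ∃ m, u = some (a, m ++ l) := by
      rintro u v huv ⟨m, rfl⟩
      rw [SimpleGraph.deleteEdges_adj] at huv
      obtain ⟨hadj, hne⟩ := huv
      rcases betheLattice_adj.1 hadj with hc | hc
      · cases m with
        | nil =>
          exfalso
          rw [List.nil_append] at hc hne
          rw [hc.unique h] at hne
          exact hne rfl
        | cons b m =>
          exact ⟨m, hc.unique (.step a b (m ++ l))⟩
      · cases hc with
        | step _ b _ => exact ⟨b :: m, rfl⟩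
    have walk : ∀ (u v : BetheVertex d)
        (_ : ((betheLattice d).deleteEdges {s(x, some (a, l))}).Walk u v),
        (∃ m, v = some (a, m ++ l)) → ∃ m, u = some (a, m ++ l) := by
      intro u v q
      induction q with
      | nil => exact id
      | cons hadj _ ih => exact fun hv => closed _ _ hadj (ih hv)
    obtain ⟨m, hm⟩ := walk _ _ p ⟨[], rfl⟩
    cases h with
    | root a => simp at hm
    | step a b l =>
      simp only [Option.some.injEq, Prod.mk.injEq] at hm
      have := congrArg List.length hm.2
      simp only [List.length_append, List.length_cons] at this
      omega
  intro x y h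
  rcases betheLattice_adj.1 h with h | h
  · exact main _ _ h
  · rw [Sym2.eq_swap]; exact main _ _ h

/-- The Anderson operator `H = -t A + V` on the Bethe lattice, for the potential `g`. -/
def betheHamiltonian (d : ℕ) (t : ℝ) (g : BetheVertex d → ℝ) :
    lp (fun _ : BetheVertex d => ℂ) 2 →ₗ.[ℂ] lp (fun _ : BetheVertex d => ℂ) 2 :=
  andersonOperator (betheLattice d) (fun v => (betheLattice_isRegular d v).le) t g

/-- The law of a family of independent standard Gaussian variables indexed by the vertices of
the Bethe lattice. -/
def gaussianField (d : ℕ) : Measure (BetheVertex d → ℝ) :=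
  Measure.infinitePi (fun _ => gaussianReal 0 1)

/-- The density of states measure `ν(S) = 𝔼[μ₀(S)]`, where `μ₀` is the spectral measure of the
Anderson operator on the Bethe lattice with i.i.d. standard Gaussian potential at the unit vector
`δ₀` supported at the root. -/
def densityOfStates (d : ℕ) (t : ℝ) : Measure ℝ :=
  (gaussianField d).bind fun g => spectralMeasureAt (betheHamiltonian d t g) (lp.single 2 none 1)

end

end BetheAnderson

/-!
The normalized trace of the resolvent of a random regular graph is the mean over the vertices `v`
of the diagonal elements `G(v, v)`, and each of them is almost determined by the potential on a ball
around `v`, because resolvent elements depend on far away data only weakly. Around most vertices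
this ball looks like a ball of the Bethe lattice, so the diagonal element there is close to a local
functional of an i.i.d. field whose mean is close to the Stieltjes transform of the density of
states; a law of large numbers for these functionals, which are independent for vertices that are
far apart, gives the convergence.

Locality. A regular graph is covered by the Bethe lattice (`coveringMap_bijOn`). A solution of the
resolvent equation on a ball of radius `R`, cut off by a function of the distance to the root with
slope `1 / R`, solves the equation on the whole tree up to an error of order `1 / R` in `ℓ²`. Since
the resolvent is bounded by `1 / |Im z|`, this compares the resolvents of the graph and of the tree
at the root (`norm_sub_treeGreen_le`, `norm_greenColumn_sub_treeGreen_le`) wherever the covering map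
is injective on the ball.

Short cycles. Where the covering map is not injective on the ball of radius `R`, there is a short
cycle nearby (`exists_isShortCycleEdge_of_not_injOn`). The expected number of short cycles in a
random regular graph is bounded by a double count of switchings: an edge `uw` of a short cycle and a
far away edge `xy` can be replaced by `ux` and `wy`, and the original pair can be recovered from the
few places where a short path joins `u` to `w` (`sum_shortCycleCount_le`). Hence the expected number
of vertices with a bad neighbourhood is bounded, and their fraction tends to zero.

Density of states. The Anderson operator on the Bethe lattice is symmetric with surjective `H - z`
for nonreal `z` (`hasResolvents_andersonOperator`), and for such operators a projection-valued
measure is constructed from the continuous functional calculus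
(`HasResolvents.exists_isSpectralResolution`). For any projection-valued measure that resolves `H`,
the scalar measure at a vector has the resolvent matrix element as its Stieltjes transform
(`IsSpectralResolution.stieltjesTransform_measureAt`). Stieltjes inversion makes the spectral
measure at the root a measurable function of the potential
(`measurable_of_measurable_stieltjesTransform`), so the Stieltjes transform of the density of states
is the mean of the resolvent at the root (`stieltjesTransform_densityOfStates`).

Probability. Conditionally on the graph, the local functionals at different vertices are
uncorrelated except for boundedly many partners of each vertex, so their average has variance
`O(1 / N)`, uniformly in the graph (`measureReal_sum_localDeviation_le`). Together with the bound on
bad vertices this gives a rate `O(1 / N)` for the probability of a fixed deviation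
(`measureReal_normalizedTrace_sub_le`).
-/

namespace BetheAnderson

noncomputable section

open scoped InnerProductSpace ComplexConjugate ENNReal

/-! ### Vectors of a projection-valued measure -/

section Gram

/-- Two families of vectors with the same Gram matrix are related by a linear isometry, defined on
the closed span of the first family. -/
theorem exists_linearIsometry_of_gram {ι L E : Type*} [NormedAddCommGroup L]
    [InnerProductSpace ℂ L] [NormedAddCommGroup E] [InnerProductSpace ℂ E] [CompleteSpace E]
    (v : ι → L) (w : ι → E) (hgram : ∀ i j, ⟪v i, v j⟫_ℂ = ⟪w i, w j⟫_ℂ)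
    (hv : Dense (Submodule.span ℂ (Set.range v) : Set L)) :
    ∃ J : L →ₗᵢ[ℂ] E, ∀ i, J (v i) = w i := by
  set e := Finsupp.linearCombination ℂ v
  set f := Finsupp.linearCombination ℂ w
  have hinner : ∀ a, ⟪f a, f a⟫_ℂ = ⟪e a, e a⟫_ℂ := by
    intro a
    simp only [e, f, Finsupp.linearCombination_apply, Finsupp.sum_inner, Finsupp.inner_sum,
      inner_smul_left, inner_smul_right, hgram]
  have hnorm : ∀ a, ‖f a‖ = ‖e a‖ := by
    intro a
    have h := hinner a
    rw [inner_self_eq_norm_sq_to_K, inner_self_eq_norm_sq_to_K] at h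
    have h2 : ‖f a‖ ^ 2 = ‖e a‖ ^ 2 := by exact_mod_cast h
    exact (sq_eq_sq₀ (norm_nonneg _) (norm_nonneg _)).1 h2
  have hdense : DenseRange e := by
    rw [← Finsupp.range_linearCombination] at hv
    exact hv
  have hb : ∃ C, ∀ a, ‖f a‖ ≤ C * ‖e a‖ := ⟨1, fun a => by rw [hnorm, one_mul]⟩
  refine ⟨⟨(f.extendOfNorm e).toLinearMap, ?_⟩, ?_⟩
  · intro x
    refine hdense.induction_on (p := fun x => ‖f.extendOfNorm e x‖ = ‖x‖) x
      (isClosed_eq (by fun_prop) (by fun_prop)) fun a => ?_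
    rw [LinearMap.extendOfNorm_eq hdense hb, hnorm]
  · intro i
    have := LinearMap.extendOfNorm_eq hdense hb (Finsupp.single i 1)
    simpa [e, f] using this

/-- Indicators of measurable sets span a dense subspace of `L²`. -/
theorem dense_span_indicatorConstLp {X : Type*} [MeasurableSpace X] (μ : Measure X)
    [IsFiniteMeasure μ] :
    Dense (Submodule.span ℂ (Set.range fun S : {S : Set X // MeasurableSet S} =>
      indicatorConstLp 2 S.2 (measure_ne_top μ S.1) (1 : ℂ)) : Set (Lp ℂ 2 μ)) := by
  set M := Submodule.span ℂ (Set.range fun S : {S : Set X // MeasurableSet S} =>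
      indicatorConstLp 2 S.2 (measure_ne_top μ S.1) (1 : ℂ))
  intro f
  rw [← Submodule.topologicalClosure_coe]
  refine Lp.induction (p := 2) (by simp) (fun f => f ∈ (M.topologicalClosure : Set _)) ?_ ?_ ?_ f
  · intro c s hs hμs
    refine M.le_topologicalClosure ?_
    have : ((Lp.simpleFunc.indicatorConst 2 hs hμs.ne c : Lp.simpleFunc ℂ 2 μ) : Lp ℂ 2 μ) =
        c • indicatorConstLp 2 hs (measure_ne_top μ s) (1 : ℂ) := by
      rw [Lp.simpleFunc.coe_indicatorConst]
      unfold indicatorConstLp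
      rw [← MemLp.toLp_const_smul]
      congr 1
      ext x
      by_cases hx : x ∈ s <;> simp [hx]
    rw [this]
    exact M.smul_mem _ (Submodule.subset_span ⟨⟨s, hs⟩, rfl⟩)
  · intro f g hf hg _ h1 h2
    exact M.topologicalClosure.add_mem h1 h2
  · exact M.isClosed_topologicalClosure

end Gram

namespace ProjectionValuedMeasure

variable {E : Type*} [NormedAddCommGroup E] [InnerProductSpace ℂ E] [CompleteSpace E]
  (P : ProjectionValuedMeasure E)

theorem measureAt_apply (ψ : E) {S : Set ℝ} (hS : MeasurableSet S) :
    P.measureAt ψ S = ENNReal.ofReal (‖P.proj S ψ‖ ^ 2) := by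
  rw [measureAt, Measure.ofMeasurable_apply _ hS, P.inner_eq ψ hS, Complex.ofReal_re]

instance (ψ : E) : IsFiniteMeasure (P.measureAt ψ) := by
  constructor
  rw [P.measureAt_apply ψ MeasurableSet.univ]
  exact ENNReal.ofReal_lt_top

theorem measureAt_real (ψ : E) {S : Set ℝ} (hS : MeasurableSet S) :
    (P.measureAt ψ).real S = ‖P.proj S ψ‖ ^ 2 := by
  rw [measureReal_def, P.measureAt_apply ψ hS, ENNReal.toReal_ofReal (by positivity)]

theorem measureAt_univ (ψ : E) : P.measureAt ψ Set.univ = ENNReal.ofReal (‖ψ‖ ^ 2) := by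
  rw [P.measureAt_apply ψ MeasurableSet.univ, P.proj_univ]
  rfl

theorem inner_proj_left {S : Set ℝ} (hS : MeasurableSet S) (φ ψ : E) :
    ⟪P.proj S φ, ψ⟫_ℂ = ⟪φ, P.proj S ψ⟫_ℂ := by
  have := ContinuousLinearMap.adjoint_inner_left (P.proj S) ψ φ
  rwa [← ContinuousLinearMap.star_eq_adjoint,
    (P.isStarProjection S hS).isSelfAdjoint.star_eq] at this

theorem proj_proj_self {S : Set ℝ} (hS : MeasurableSet S) (ψ : E) :
    P.proj S (P.proj S ψ) = P.proj S ψ := by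
  have := congrArg (fun T : E →L[ℂ] E => T ψ) (P.isStarProjection S hS).isIdempotentElem
  simpa using this

theorem norm_proj_le {S : Set ℝ} (hS : MeasurableSet S) (ψ : E) : ‖P.proj S ψ‖ ≤ ‖ψ‖ := by
  have h : (P.measureAt ψ).real S ≤ (P.measureAt ψ).real Set.univ :=
    measureReal_mono (Set.subset_univ _)
  rw [P.measureAt_real ψ hS, P.measureAt_real ψ MeasurableSet.univ, P.proj_univ] at h
  exact (sq_le_sq₀ (norm_nonneg _) (norm_nonneg _)).1 h

theorem norm_sq_proj_union {S T : Set ℝ} (hS : MeasurableSet S) (hT : MeasurableSet T)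
    (hST : Disjoint S T) (ψ : E) :
    ‖P.proj (S ∪ T) ψ‖ ^ 2 = ‖P.proj S ψ‖ ^ 2 + ‖P.proj T ψ‖ ^ 2 := by
  rw [← P.measureAt_real ψ (hS.union hT), ← P.measureAt_real ψ hS, ← P.measureAt_real ψ hT,
    measureReal_union hST hT]

theorem proj_proj_of_disjoint {S T : Set ℝ} (hS : MeasurableSet S) (hT : MeasurableSet T)
    (hST : Disjoint S T) (ψ : E) : P.proj S (P.proj T ψ) = 0 := by
  have h1 := P.norm_sq_proj_union hS hT hST (P.proj T ψ)
  have h2 := P.norm_proj_le (hS.union hT) (P.proj T ψ)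
  rw [P.proj_proj_self hT] at h1
  have h3 : ‖P.proj (S ∪ T) (P.proj T ψ)‖ ^ 2 ≤ ‖P.proj T ψ‖ ^ 2 := by gcongr
  have h4 : ‖P.proj S (P.proj T ψ)‖ ^ 2 ≤ 0 := by linarith
  have h5 : ‖P.proj S (P.proj T ψ)‖ = 0 := by
    have := sq_nonneg ‖P.proj S (P.proj T ψ)‖
    exact pow_eq_zero_iff (two_ne_zero) |>.1 (le_antisymm h4 this)
  exact norm_eq_zero.1 h5

theorem proj_empty (ψ : E) : P.proj ∅ ψ = 0 := by
  have h := P.measureAt_real ψ MeasurableSet.empty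
  rw [measureReal_empty] at h
  exact norm_eq_zero.1 (pow_eq_zero_iff two_ne_zero |>.1 h.symm)

theorem proj_union {S T : Set ℝ} (hS : MeasurableSet S) (hT : MeasurableSet T)
    (hST : Disjoint S T) (ψ : E) : P.proj (S ∪ T) ψ = P.proj S ψ + P.proj T ψ := by
  let U : ℕ → Set ℝ := fun n => if n = 0 then S else if n = 1 then T else ∅
  have hU0 : U 0 = S := rfl
  have hU1 : U 1 = T := rfl
  have hU2 : ∀ n, n ≠ 0 → n ≠ 1 → U n = ∅ := fun n h0 h1 => by simp [U, h0, h1]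
  have hmeas : ∀ n, MeasurableSet (U n) := by
    intro n
    by_cases h0 : n = 0
    · rw [h0, hU0]; exact hS
    by_cases h1 : n = 1
    · rw [h1, hU1]; exact hT
    rw [hU2 n h0 h1]; exact MeasurableSet.empty
  have hdisj : Pairwise (Function.onFun Disjoint U) := by
    intro i j hij
    by_cases hi0 : i = 0 <;> by_cases hi1 : i = 1 <;> by_cases hj0 : j = 0 <;>
      by_cases hj1 : j = 1 <;> simp_all [Function.onFun, U, disjoint_comm]
  have hunion : ⋃ n, U n = S ∪ T := by
    ext x
    simp only [Set.mem_iUnion, Set.mem_union]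
    constructor
    · rintro ⟨n, hn⟩
      by_cases h0 : n = 0
      · rw [h0, hU0] at hn; exact Or.inl hn
      by_cases h1 : n = 1
      · rw [h1, hU1] at hn; exact Or.inr hn
      rw [hU2 n h0 h1] at hn; exact hn.elim
    · rintro (h | h)
      · exact ⟨0, h⟩
      · exact ⟨1, h⟩
  have h := P.hasSum_iUnion U hmeas hdisj ψ
  rw [hunion] at h
  have h' : HasSum (fun n => P.proj (U n) ψ) (∑ n ∈ {0, 1}, P.proj (U n) ψ) := by
    refine hasSum_sum_of_ne_finset_zero fun n hn => ?_
    simp only [Finset.mem_insert, Finset.mem_singleton, not_or] at hn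
    rw [hU2 n hn.1 hn.2, P.proj_empty]
  rw [h.unique h']
  simp [hU0, hU1]

theorem proj_proj {S T : Set ℝ} (hS : MeasurableSet S) (hT : MeasurableSet T) (ψ : E) :
    P.proj S (P.proj T ψ) = P.proj (S ∩ T) ψ := by
  have hd1 : Disjoint (S ∩ T) (T \ S) :=
    Set.disjoint_left.2 fun x hx hx' => hx'.2 hx.1
  have hd2 : Disjoint (S ∩ T) (S \ T) :=
    Set.disjoint_left.2 fun x hx hx' => hx'.2 hx.2
  have e1 : P.proj T ψ = P.proj (S ∩ T) ψ + P.proj (T \ S) ψ := by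
    rw [← P.proj_union (hS.inter hT) (hT.diff hS) hd1, Set.inter_comm, Set.inter_union_sdiff]
  have e2 : ∀ χ, P.proj S χ = P.proj (S ∩ T) χ + P.proj (S \ T) χ := fun χ => by
    rw [← P.proj_union (hS.inter hT) (hS.diff hT) hd2, Set.inter_union_sdiff]
  rw [e1, map_add, P.proj_proj_of_disjoint hS (hT.diff hS) Set.disjoint_sdiff_right, add_zero, e2,
    P.proj_proj_self (hS.inter hT),
    P.proj_proj_of_disjoint (hS.diff hT) (hS.inter hT) hd2.symm, add_zero]

theorem inner_proj_self {S : Set ℝ} (hS : MeasurableSet S) (ψ : E) :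
    ⟪ψ, P.proj S ψ⟫_ℂ = ((P.measureAt ψ).real S : ℂ) := by
  rw [P.inner_eq ψ hS, P.measureAt_real ψ hS]

theorem inner_proj_proj {S T : Set ℝ} (hS : MeasurableSet S) (hT : MeasurableSet T) (ψ : E) :
    ⟪P.proj S ψ, P.proj T ψ⟫_ℂ = ((P.measureAt ψ).real (S ∩ T) : ℂ) := by
  rw [P.inner_proj_left hS, P.proj_proj hS hT, P.inner_proj_self (hS.inter hT)]

/-- The cyclic subspace of `ψ` is a copy of `L²` of its scalar measure: there is an isometry with
`1_S ↦ P(S) ψ`. It is the functional calculus `f ↦ f(P) ψ`. -/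
theorem exists_cyclicIsometry (ψ : E) : ∃ J : Lp ℂ 2 (P.measureAt ψ) →ₗᵢ[ℂ] E,
    ∀ S (hS : MeasurableSet S),
      J (indicatorConstLp 2 hS (measure_ne_top _ S) (1 : ℂ)) = P.proj S ψ := by
  obtain ⟨J, hJ⟩ := exists_linearIsometry_of_gram
    (fun S : {S : Set ℝ // MeasurableSet S} =>
      indicatorConstLp 2 S.2 (measure_ne_top (P.measureAt ψ) S.1) (1 : ℂ))
    (fun S => P.proj S.1 ψ) (by
      rintro ⟨S, hS⟩ ⟨T, hT⟩
      rw [L2.inner_indicatorConstLp_one_indicatorConstLp_one, P.inner_proj_proj hS hT]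
      rfl)
    (dense_span_indicatorConstLp _)
  exact ⟨J, fun S hS => hJ ⟨S, hS⟩⟩

/-- The functional calculus `f ↦ f(P) ψ`. -/
def cyclic (ψ : E) : Lp ℂ 2 (P.measureAt ψ) →ₗᵢ[ℂ] E := (P.exists_cyclicIsometry ψ).choose

theorem cyclic_indicator (ψ : E) {S : Set ℝ} (hS : MeasurableSet S) :
    P.cyclic ψ (indicatorConstLp 2 hS (measure_ne_top _ S) (1 : ℂ)) = P.proj S ψ :=
  (P.exists_cyclicIsometry ψ).choose_spec S hS

theorem cyclic_one (ψ : E) : P.cyclic ψ (MemLp.toLp (fun _ => (1 : ℂ)) (memLp_const 1)) = ψ := by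
  have h := P.cyclic_indicator ψ MeasurableSet.univ
  rw [P.proj_univ, indicatorConstLp_univ] at h
  exact h

/-- The coefficient of `χ` in the cyclic subspace of `ψ`, i.e. the adjoint of `f ↦ f(P) ψ`. -/
def coeff (ψ χ : E) : Lp ℂ 2 (P.measureAt ψ) :=
  ContinuousLinearMap.adjoint (P.cyclic ψ).toContinuousLinearMap χ

theorem inner_coeff (ψ χ : E) (f : Lp ℂ 2 (P.measureAt ψ)) :
    ⟪P.coeff ψ χ, f⟫_ℂ = ⟪χ, P.cyclic ψ f⟫_ℂ :=
  ContinuousLinearMap.adjoint_inner_left _ _ _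

theorem coeff_cyclic (ψ : E) (f : Lp ℂ 2 (P.measureAt ψ)) : P.coeff ψ (P.cyclic ψ f) = f := by
  refine ext_inner_right ℂ fun g => ?_
  rw [inner_coeff, LinearIsometry.inner_map_map]

/-- `S ↦ ⟨χ, P(S) f(P) ψ⟩` has density `conj k f` with respect to the measure of `ψ`. -/
theorem inner_proj_cyclic (ψ χ : E) {S : Set ℝ} (hS : MeasurableSet S)
    (f : Lp ℂ 2 (P.measureAt ψ)) :
    ⟪χ, P.proj S (P.cyclic ψ f)⟫_ℂ =
      ∫ x in S, conj (P.coeff ψ χ x) * f x ∂(P.measureAt ψ) := by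
  set k := P.coeff ψ χ
  set kS : Lp ℂ 2 (P.measureAt ψ) := ((Lp.memLp k).indicator hS).toLp _
  have hkS : ∀ g : Lp ℂ 2 (P.measureAt ψ),
      ⟪kS, g⟫_ℂ = ∫ x in S, conj (k x) * g x ∂(P.measureAt ψ) := by
    intro g
    rw [L2.inner_def, ← integral_indicator hS]
    refine integral_congr_ae ?_
    filter_upwards [((Lp.memLp k).indicator hS).coeFn_toLp] with x hx
    rw [hx]
    by_cases hxS : x ∈ S <;> simp [hxS, mul_comm]
  rw [← hkS]
  have key : ((innerSL ℂ χ).comp (P.proj S)).comp (P.cyclic ψ).toContinuousLinearMap =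
      innerSL ℂ kS := by
    refine ContinuousLinearMap.ext_on (dense_span_indicatorConstLp (P.measureAt ψ)) ?_
    rintro _ ⟨⟨T, hT⟩, rfl⟩
    simp only [ContinuousLinearMap.comp_apply, LinearIsometry.coe_toContinuousLinearMap,
      innerSL_apply_apply]
    rw [P.cyclic_indicator ψ hT, P.proj_proj hS hT, ← P.cyclic_indicator ψ (hS.inter hT),
      ← inner_coeff, hkS, ← inner_conj_symm, L2.inner_indicatorConstLp_one, ← integral_conj,
      ← integral_indicator hS, ← integral_indicator (hS.inter hT)]
    refine integral_congr_ae ?_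
    filter_upwards [indicatorConstLp_coeFn (p := 2) (hs := hT) (c := (1 : ℂ))
      (hμs := measure_ne_top (P.measureAt ψ) T)] with x hx
    by_cases hxS : x ∈ S <;> by_cases hxT : x ∈ T <;> simp [hxS, hxT, hx, k]
  exact congrArg (fun T => T f) key

theorem measureAt_cyclic (ψ : E) {S : Set ℝ} (hS : MeasurableSet S)
    (f : Lp ℂ 2 (P.measureAt ψ)) :
    (P.measureAt (P.cyclic ψ f)).real S = ∫ x in S, ‖f x‖ ^ 2 ∂(P.measureAt ψ) := by
  have h := P.inner_proj_cyclic ψ (P.cyclic ψ f) hS f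
  rw [P.inner_proj_self hS, coeff_cyclic] at h
  have h2 : ∫ x in S, conj (f x) * f x ∂(P.measureAt ψ) =
      ((∫ x in S, ‖f x‖ ^ 2 ∂(P.measureAt ψ) : ℝ) : ℂ) := by
    rw [← integral_complex_ofReal]
    refine integral_congr_ae (ae_of_all _ fun x => ?_)
    simp only
    rw [mul_comm, Complex.mul_conj, Complex.normSq_eq_norm_sq]
  rw [h2] at h
  exact_mod_cast h

end ProjectionValuedMeasure
end
end BetheAnderson

namespace BetheAnderson

noncomputable section

open scoped InnerProductSpace ComplexConjugate ENNReal

/-! ### Uniqueness in the spectral theorem -/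

section Uniqueness

variable {E : Type*} [NormedAddCommGroup E] [InnerProductSpace ℂ E]

/-- A densely defined symmetric operator `H` such that `H - z` is onto for all non-real `z`, i.e. a
self-adjoint operator, described through its resolvents. -/
structure HasResolvents (H : E →ₗ.[ℂ] E) : Prop where
  dense : Dense (H.domain : Set E)
  symm : ∀ φ ψ : H.domain, ⟪H φ, (ψ : E)⟫_ℂ = ⟪(φ : E), H ψ⟫_ℂ
  surj : ∀ z : ℂ, z.im ≠ 0 → ∀ f : E, ∃ ψ : H.domain, H ψ - z • (ψ : E) = f

/-- The standard lower bound for `H - z`, valid since `⟨ψ, H ψ⟩` is real. -/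
theorem im_mul_norm_le_of_symm {H : E →ₗ.[ℂ] E}
    (hsymm : ∀ φ ψ : H.domain, ⟪H φ, (ψ : E)⟫_ℂ = ⟪(φ : E), H ψ⟫_ℂ) (z : ℂ) (ψ : H.domain) :
    |z.im| * ‖(ψ : E)‖ ≤ ‖H ψ - z • (ψ : E)‖ := by
  have h1 : (⟪(ψ : E), H ψ⟫_ℂ).im = 0 := by
    have h := hsymm ψ ψ
    rw [← inner_conj_symm] at h
    exact Complex.conj_eq_iff_im.1 h
  have h2 : (⟪(ψ : E), H ψ - z • (ψ : E)⟫_ℂ).im = - z.im * ‖(ψ : E)‖ ^ 2 := by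
    rw [inner_sub_right, inner_smul_right, inner_self_eq_norm_sq_to_K, Complex.sub_im, h1]
    change 0 - (z * ((‖(ψ : E)‖ : ℂ)) ^ 2).im = _
    rw [← Complex.ofReal_pow, Complex.im_mul_ofReal]
    ring
  have h3 : |z.im| * ‖(ψ : E)‖ ^ 2 ≤ ‖(ψ : E)‖ * ‖H ψ - z • (ψ : E)‖ := by
    calc |z.im| * ‖(ψ : E)‖ ^ 2 = |(⟪(ψ : E), H ψ - z • (ψ : E)⟫_ℂ).im| := by
          rw [h2, abs_mul, abs_neg, abs_of_nonneg (sq_nonneg ‖(ψ : E)‖)]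
      _ ≤ ‖⟪(ψ : E), H ψ - z • (ψ : E)⟫_ℂ‖ := Complex.abs_im_le_norm _
      _ ≤ _ := norm_inner_le_norm _ _
  rcases (norm_nonneg (ψ : E)).eq_or_lt with h0 | h0
  · rw [← h0, mul_zero]; exact norm_nonneg _
  · refine le_of_mul_le_mul_left ?_ h0
    nlinarith

theorem HasResolvents.eq_of_sub_eq {H : E →ₗ.[ℂ] E} (hH : HasResolvents H) {z : ℂ}
    (hz : z.im ≠ 0) {φ ψ : H.domain} (h : H φ - z • (φ : E) = H ψ - z • (ψ : E)) : φ = ψ := by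
  have h1 := im_mul_norm_le_of_symm hH.symm z (φ - ψ)
  have h2 : H (φ - ψ) - z • ((φ - ψ : H.domain) : E) = 0 := by
    rw [LinearPMap.map_sub, Submodule.coe_sub, smul_sub]
    rw [← sub_eq_zero] at h
    rw [← h]; abel
  rw [h2, norm_zero] at h1
  have h3 : ‖((φ - ψ : H.domain) : E)‖ = 0 := by
    have := abs_pos.2 hz
    have := norm_nonneg ((φ - ψ : H.domain) : E)
    nlinarith
  have h4 := norm_eq_zero.1 h3
  exact sub_eq_zero.1 (Subtype.ext h4)

/-- Integration of `x` against measures that differ by a signed density `h`. Splitting `h` into its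
positive and negative parts turns the hypothesis into an equality of sums of positive measures. -/
theorem integral_id_eq_of_real_eq {μ₁ μ₂ ν : Measure ℝ} [IsFiniteMeasure μ₁] [IsFiniteMeasure μ₂]
    {h : ℝ → ℝ} (hh : Integrable h ν) (hxh : Integrable (fun x => x * h x) ν)
    (h₁ : Integrable (fun x : ℝ => x) μ₁) (h₂ : Integrable (fun x : ℝ => x) μ₂)
    (hS : ∀ S, MeasurableSet S → μ₁.real S = μ₂.real S + ∫ x in S, h x ∂ν) :
    ∫ x, x ∂μ₁ = ∫ x, x ∂μ₂ + ∫ x, x * h x ∂ν := by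
  have hfin : ∀ g : ℝ → ℝ, Integrable g ν →
      IsFiniteMeasure (ν.withDensity fun x => ENNReal.ofReal (g x)) := fun g hg =>
    isFiniteMeasure_withDensity_ofReal hg.2
  have hreal : ∀ g : ℝ → ℝ, Integrable g ν → ∀ S, MeasurableSet S →
      (ν.withDensity fun x => ENNReal.ofReal (g x)).real S = ∫ x in S, max (g x) 0 ∂ν := by
    intro g hg S hS
    have hp : Integrable (fun x => max (g x) 0) ν := hg.pos_part
    rw [measureReal_def, withDensity_apply _ hS, integral_eq_lintegral_of_nonneg_ae
      (f := fun x => max (g x) 0) (ae_of_all _ fun x => le_max_right _ _)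
      hp.restrict.aestronglyMeasurable]
    congr 1
    refine lintegral_congr fun x => ?_
    rcases le_total (g x) 0 with hx | hx
    · rw [max_eq_right hx, ENNReal.ofReal_of_nonpos hx, ENNReal.ofReal_zero]
    · rw [max_eq_left hx]
  have := hfin h hh
  have := hfin (fun x => - h x) hh.neg
  have hneg : Integrable (fun x => max (- h x) 0) ν := hh.neg.pos_part
  have hμ : μ₁ + (ν.withDensity fun x => ENNReal.ofReal (- h x)) =
      μ₂ + (ν.withDensity fun x => ENNReal.ofReal (h x)) := by
    refine Measure.ext fun S hSm => ?_
    rw [← ENNReal.toReal_eq_toReal_iff' (measure_ne_top _ _) (measure_ne_top _ _), ← measureReal_def,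
      ← measureReal_def, measureReal_add_apply, measureReal_add_apply, hS S hSm, hreal _ hh S hSm,
      hreal (fun x => - h x) hh.neg S hSm, add_assoc, ← integral_add hh.restrict hneg.restrict]
    congr 1
    refine integral_congr_ae (ae_of_all _ fun x => ?_)
    simp only
    rcases le_total (h x) 0 with hx | hx
    · rw [max_eq_left (by linarith), max_eq_right hx]; ring
    · rw [max_eq_right (by linarith), max_eq_left hx]; ring
  have hdens : ∀ g : ℝ → ℝ, Integrable g ν → Integrable (fun x => x * g x) ν →
      Integrable (fun x : ℝ => x) (ν.withDensity fun x => ENNReal.ofReal (g x)) ∧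
      ∫ x, x ∂(ν.withDensity fun x => ENNReal.ofReal (g x)) = ∫ x, max (g x) 0 * x ∂ν := by
    intro g hg hxg
    have e : (fun x => ENNReal.ofReal (g x)) = fun x => ((Real.toNNReal (g x) : NNReal) : ℝ≥0∞) :=
      rfl
    have hm : AEMeasurable (fun x => Real.toNNReal (g x)) ν := hg.aemeasurable.real_toNNReal
    constructor
    · rw [e, integrable_withDensity_iff_integrable_smul₀ hm]
      refine hxg.mono ?_ (ae_of_all _ fun x => ?_)
      · exact (hm.smul aemeasurable_id).aestronglyMeasurable
      · rw [NNReal.smul_def, smul_eq_mul, norm_mul, norm_mul, mul_comm]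
        gcongr
        rw [Real.coe_toNNReal', Real.norm_eq_abs, Real.norm_eq_abs, abs_of_nonneg (le_max_right _ _)]
        exact max_le (le_abs_self _) (abs_nonneg _)
    · rw [e, integral_withDensity_eq_integral_smul₀ hm]
      refine integral_congr_ae (ae_of_all _ fun x => ?_)
      simp only [NNReal.smul_def, smul_eq_mul, Real.coe_toNNReal']
  obtain ⟨i1, e1⟩ := hdens h hh hxh
  obtain ⟨i2, e2⟩ := hdens (fun x => - h x) hh.neg (by simpa using hxh.neg)
  have hint := congrArg (fun μ => ∫ x : ℝ, x ∂μ) hμ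
  rw [integral_add_measure h₁ i2, integral_add_measure h₂ i1, e1, e2] at hint
  have key : ∫ x, x * h x ∂ν = ∫ x, max (h x) 0 * x ∂ν - ∫ x, max (- h x) 0 * x ∂ν := by
    rw [← integral_sub]
    · refine integral_congr_ae (ae_of_all _ fun x => ?_)
      simp only
      rcases le_total (h x) 0 with hx | hx
      · rw [max_eq_right hx, max_eq_left (show 0 ≤ - h x by linarith)]; ring
      · rw [max_eq_left hx, max_eq_right (show - h x ≤ 0 by linarith)]; ring
    · refine hxh.mono ((hh.pos_part.aestronglyMeasurable).mul
        aestronglyMeasurable_id) (ae_of_all _ fun x => ?_)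
      rw [norm_mul, norm_mul, mul_comm]
      gcongr
      rw [Real.norm_eq_abs, Real.norm_eq_abs, abs_of_nonneg (le_max_right _ _)]
      exact max_le (le_abs_self _) (abs_nonneg _)
    · refine hxh.mono ((hh.neg.pos_part.aestronglyMeasurable).mul
        aestronglyMeasurable_id) (ae_of_all _ fun x => ?_)
      rw [norm_mul, norm_mul, mul_comm]
      gcongr
      rw [Real.norm_eq_abs, Real.norm_eq_abs, abs_of_nonneg (le_max_right _ _)]
      exact max_le (neg_le_abs _) (abs_nonneg _)
  rw [key]; linarith

theorem integrable_id_of_lintegral_sq {μ : Measure ℝ} [IsFiniteMeasure μ]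
    (h : ∫⁻ x, ENNReal.ofReal (x ^ 2) ∂μ < ⊤) : Integrable (fun x : ℝ => x) μ := by
  have h1 : Integrable (fun x : ℝ => x ^ 2) μ := by
    refine ⟨by fun_prop, ?_⟩
    rw [hasFiniteIntegral_iff_ofReal (ae_of_all _ fun x => sq_nonneg x)]
    exact h
  have h2 : MemLp (fun x : ℝ => x) 2 μ := (memLp_two_iff_integrable_sq (by fun_prop)).2 h1
  exact h2.integrable (by norm_num)

theorem norm_ofReal_sub_ge (x : ℝ) (z : ℂ) : |z.im| ≤ ‖(x : ℂ) - z‖ := by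
  have := Complex.abs_im_le_norm ((x : ℂ) - z)
  simpa using this

theorem ofReal_sub_ne_zero {z : ℂ} (hz : z.im ≠ 0) (x : ℝ) : (x : ℂ) - z ≠ 0 := by
  intro h
  have := norm_ofReal_sub_ge x z
  rw [h, norm_zero] at this
  exact hz (abs_eq_zero.1 (le_antisymm this (abs_nonneg _)))

theorem norm_one_div_sub_le {z : ℂ} (hz : z.im ≠ 0) (x : ℝ) :
    ‖1 / ((x : ℂ) - z)‖ ≤ 1 / |z.im| := by
  rw [norm_div, norm_one]
  exact one_div_le_one_div_of_le (abs_pos.2 hz) (norm_ofReal_sub_ge x z)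

theorem continuous_one_div_sub {z : ℂ} (hz : z.im ≠ 0) :
    Continuous fun x : ℝ => 1 / ((x : ℂ) - z) :=
  continuous_const.div (by fun_prop) fun x => ofReal_sub_ne_zero hz x

variable [CompleteSpace E]

/-- The Stieltjes transform of the scalar measure of `ψ` is a resolvent matrix element, for every
projection-valued measure that resolves `H`. -/
theorem IsSpectralResolution.stieltjesTransform_measureAt {H : E →ₗ.[ℂ] E}
    (hH : HasResolvents H) {P : ProjectionValuedMeasure E} (hP : IsSpectralResolution H P)
    {z : ℂ} (hz : z.im ≠ 0) {ψ : E} {φ : H.domain} (hφ : H φ - z • (φ : E) = ψ) :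
    stieltjesTransform (P.measureAt ψ) z = ⟪ψ, (φ : E)⟫_ℂ := by
  set μ := P.measureAt ψ with hμ
  have hr : MemLp (fun x : ℝ => 1 / ((x : ℂ) - z)) 2 μ :=
    MemLp.of_bound (continuous_one_div_sub hz).aestronglyMeasurable (1 / |z.im|)
      (ae_of_all _ (norm_one_div_sub_le hz))
  set r := hr.toLp with hrdef
  set φ₀ := P.cyclic ψ r with hφ₀
  set s : Lp ℂ 2 μ := MemLp.toLp (fun _ => (1 : ℂ)) (memLp_const 1) + z • r with hs
  have hJs : P.cyclic ψ s = ψ + z • φ₀ := by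
    rw [hs, map_add, map_smul, P.cyclic_one]
  have hsx : ∀ᵐ x ∂μ, s x = x * r x := by
    filter_upwards [Lp.coeFn_add (MemLp.toLp (fun _ => (1 : ℂ)) (memLp_const 1)) (z • r),
      Lp.coeFn_smul z r, (memLp_const (1 : ℂ)).coeFn_toLp (p := 2) (μ := μ), hr.coeFn_toLp]
      with x h1 h2 h3 h4
    rw [hs, h1, Pi.add_apply, h2, Pi.smul_apply, h3, hrdef, h4, smul_eq_mul]
    field_simp [ofReal_sub_ne_zero hz x]
    ring
  -- `φ₀ = (P - z)⁻¹ ψ` lies in the domain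
  have hφ₀dom : φ₀ ∈ H.domain := by
    rw [hP.1]
    have hwd : P.measureAt φ₀ = μ.withDensity fun x => ENNReal.ofReal (‖r x‖ ^ 2) := by
      have hint : Integrable (fun x => ‖r x‖ ^ 2) μ := (Lp.memLp r).norm.integrable_sq
      refine Measure.ext fun S hS => ?_
      have : IsFiniteMeasure (μ.withDensity fun x => ENNReal.ofReal (‖r x‖ ^ 2)) :=
        isFiniteMeasure_withDensity_ofReal hint.2
      rw [← ENNReal.toReal_eq_toReal_iff' (measure_ne_top _ _) (measure_ne_top _ _),
        ← measureReal_def, P.measureAt_cyclic ψ hS, withDensity_apply _ hS,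
        integral_eq_lintegral_of_nonneg_ae (ae_of_all _ fun x => by positivity)
          hint.restrict.aestronglyMeasurable]
    rw [hwd, lintegral_withDensity_eq_lintegral_mul₀
      ((Lp.aestronglyMeasurable r).aemeasurable.norm.pow_const 2).ennreal_ofReal (by fun_prop)]
    have hsfin : ∫⁻ x, ENNReal.ofReal (‖s x‖ ^ 2) ∂μ < ⊤ := by
      have := (Lp.memLp s).norm.integrable_sq.2
      rwa [hasFiniteIntegral_iff_ofReal (ae_of_all _ fun x => sq_nonneg _)] at this
    refine lt_of_le_of_lt (le_of_eq (lintegral_congr_ae ?_)) hsfin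
    filter_upwards [hsx] with x hx
    rw [Pi.mul_apply, ← ENNReal.ofReal_mul (by positivity), hx, norm_mul, mul_pow,
      Complex.norm_real, Real.norm_eq_abs, sq_abs, mul_comm]
  -- `⟨χ, H φ₀⟩ = ⟨χ, ψ + z φ₀⟩`, by polarization of the quadratic form
  have hweak : ∀ χ : H.domain, ⟪(χ : E), H ⟨φ₀, hφ₀dom⟩⟫_ℂ = ⟪(χ : E), ψ + z • φ₀⟫_ℂ := by
    intro χ
    set k := P.coeff ψ χ with hk
    have hw : Integrable (fun x => conj (k x) * r x) μ := by
      have := L2.integrable_inner (𝕜 := ℂ) k r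
      simpa [mul_comm] using this
    have hxw : Integrable (fun x : ℝ => (x : ℂ) * (conj (k x) * r x)) μ := by
      have := L2.integrable_inner (𝕜 := ℂ) k s
      refine this.congr ?_
      filter_upwards [hsx] with x hx
      rw [hx]; simp; ring
    have hright : ⟪(χ : E), ψ + z • φ₀⟫_ℂ = ∫ x : ℝ, (x : ℂ) * (conj (k x) * r x) ∂μ := by
      rw [← hJs, ← P.inner_coeff, L2.inner_def]
      refine integral_congr_ae ?_
      filter_upwards [hsx] with x hx
      rw [hx]; simp; ring
    set φ₁ : H.domain := ⟨φ₀, hφ₀dom⟩ with hφ₁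
    -- The measure of `χ + c φ₁` differs from the sum of the measures of `χ` and `φ₁` by the density
    -- of the cross term, `2 Re (c k̄ r)`; the values `c = 1` and `c = i` give real and imaginary part.
    have key : ∀ c : ℂ, ‖c‖ = 1 → (c * ⟪(χ : E), H φ₁⟫_ℂ).re =
        (c * ∫ x : ℝ, (x : ℂ) * (conj (k x) * r x) ∂μ).re := by
      intro c hc
      have hdom : ∀ θ : H.domain, ∫⁻ x, ENNReal.ofReal (x ^ 2) ∂(P.measureAt (θ : E)) < ⊤ :=
        fun θ => (hP.1 _).1 θ.2
      have hi : ∀ θ : H.domain, Integrable (fun x : ℝ => x) (P.measureAt (θ : E)) :=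
        fun θ => integrable_id_of_lintegral_sq (hdom θ)
      have hM := integral_id_eq_of_real_eq (μ₁ := P.measureAt ((χ + c • φ₁ : H.domain) : E))
        (μ₂ := P.measureAt (χ : E) + P.measureAt (φ₁ : E)) (ν := μ)
        (h := fun x => 2 * (c * (conj (k x) * r x)).re)
        ((hw.const_mul c).re.const_mul 2)
        (by
          have := (hxw.const_mul c).re.const_mul 2
          refine this.congr (ae_of_all _ fun x => ?_)
          simp only
          have : c * ((x : ℂ) * (conj (k x) * r x)) = (x : ℂ) * (c * (conj (k x) * r x)) := by ring
          rw [this]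
          change 2 * ((x : ℂ) * (c * (conj (k x) * r x))).re = _
          rw [Complex.re_ofReal_mul]; ring)
        (hi _) ((hi χ).add_measure (hi φ₁))
        (by
          intro S hS
          rw [measureReal_add_apply, P.measureAt_real _ hS, P.measureAt_real _ hS,
            P.measureAt_real _ hS, Submodule.coe_add, Submodule.coe_smul, map_add, map_smul,
            @norm_add_sq ℂ, norm_smul, hc, one_mul, inner_smul_right, P.inner_proj_left hS,
            P.proj_proj_self hS, hφ₁, P.inner_proj_cyclic ψ χ hS r]
          have : ∫ x in S, 2 * (c * (conj (k x) * r x)).re ∂μ =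
              2 * (c * ∫ x in S, conj (k x) * r x ∂μ).re := by
            rw [integral_const_mul, ← integral_const_mul (c : ℂ)]
            congr 1
            exact integral_re (hw.restrict.const_mul c)
          rw [this]
          simp only [RCLike.re_to_complex]
          ring)
      have q := hP.2 (χ + c • φ₁)
      rw [hM, integral_add_measure (hi χ) (hi φ₁)] at q
      have q1 := congrArg Complex.re (hP.2 χ)
      have q2 := congrArg Complex.re (hP.2 φ₁)
      have q3 := congrArg Complex.re q
      rw [LinearPMap.map_add, LinearPMap.map_smul, Submodule.coe_add, Submodule.coe_smul,
        inner_add_left, inner_add_right, inner_add_right, inner_smul_left, inner_smul_left,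
        inner_smul_right, inner_smul_right, ← hH.symm φ₁ χ, ← inner_conj_symm (H φ₁) (χ : E)] at q3
      simp only [Complex.ofReal_re] at q1 q2 q3
      have hcc : (conj c * (c * ⟪(φ₁ : E), H φ₁⟫_ℂ)) = ⟪(φ₁ : E), H φ₁⟫_ℂ := by
        rw [← mul_assoc, mul_comm (conj c), Complex.mul_conj, Complex.normSq_eq_norm_sq, hc]
        simp
      have hconj : (conj c * conj ⟪(χ : E), H φ₁⟫_ℂ).re = (c * ⟪(χ : E), H φ₁⟫_ℂ).re := by
        rw [← map_mul, Complex.conj_re]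
      have hint : ∫ x : ℝ, x * (2 * (c * (conj (k x) * r x)).re) ∂μ =
          2 * (c * ∫ x : ℝ, (x : ℂ) * (conj (k x) * r x) ∂μ).re := by
        rw [← integral_const_mul (c : ℂ)]
        have h := integral_re (𝕜 := ℂ) (hxw.const_mul c)
        simp only [RCLike.re_to_complex] at h
        rw [← h, ← integral_const_mul]
        refine integral_congr_ae (ae_of_all _ fun x => ?_)
        simp only
        have : c * ((x : ℂ) * (conj (k x) * r x)) = (x : ℂ) * (c * (conj (k x) * r x)) := by ring
        rw [this, Complex.re_ofReal_mul]; ring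
      rw [hint, Complex.add_re, Complex.add_re, Complex.add_re, hcc, hconj, q1, q2] at q3
      linarith
    rw [hright]
    have k1 := key 1 (by simp)
    have k2 := key Complex.I (by simp)
    rw [one_mul, one_mul] at k1
    rw [Complex.I_mul_re, Complex.I_mul_re] at k2
    exact Complex.ext k1 (by linarith)
  -- By uniqueness of solutions, `φ₀` is the given `φ`, and `⟨ψ, φ₀⟩` is an integral in `L²(μ)`.
  have hstrong : H ⟨φ₀, hφ₀dom⟩ = ψ + z • φ₀ := by
    refine hH.dense.eq_of_inner_right ℂ fun χ hχ => ?_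
    exact hweak ⟨χ, hχ⟩
  have hfin : φ = ⟨φ₀, hφ₀dom⟩ := by
    refine hH.eq_of_sub_eq hz ?_
    rw [hφ, hstrong]; simp
  rw [hfin]
  change _ = ⟪ψ, φ₀⟫_ℂ
  have h1 : ⟪ψ, φ₀⟫_ℂ = ⟪MemLp.toLp (fun _ => (1 : ℂ)) (memLp_const 1), r⟫_ℂ := by
    rw [← LinearIsometry.inner_map_map (P.cyclic ψ), P.cyclic_one]
  rw [h1, L2.inner_def, stieltjesTransform]
  refine integral_congr_ae ?_
  filter_upwards [hr.coeFn_toLp, (memLp_const (1 : ℂ)).coeFn_toLp (p := 2) (μ := μ)] with x h2 h3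
  rw [hrdef, h2, h3]
  simp

end Uniqueness
end
end BetheAnderson

namespace BetheAnderson

noncomputable section

open scoped InnerProductSpace ComplexConjugate ENNReal

/-! ### Spectral measures of a continuous functional calculus -/

section Calculus

variable {E : Type*} [NormedAddCommGroup E] [InnerProductSpace ℂ E] [CompleteSpace E]
  {X : Type*} [MetricSpace X] (Φ : C(X, ℂ) →⋆ₐ[ℂ] (E →L[ℂ] E))

theorem inner_starHom (f g : C(X, ℂ)) (φ ψ : E) : ⟪Φ f φ, Φ g ψ⟫_ℂ = ⟪φ, Φ (star f * g) ψ⟫_ℂ := by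
  rw [map_mul, map_star, ContinuousLinearMap.star_eq_adjoint]
  exact (ContinuousLinearMap.adjoint_inner_right (Φ f) φ (Φ g ψ)).symm

/-- A real continuous function, viewed as a complex one. -/
def complexify (f : C(X, ℝ)) : C(X, ℂ) := ⟨fun x => (f x : ℂ), by fun_prop⟩

variable [CompactSpace X] [MeasurableSpace X] [BorelSpace X]

/-- The measure is obtained from the Riesz representation theorem: the functional is positive since a
nonnegative function is a square. -/
theorem exists_starHomMeasure (ψ : E) : ∃ m : Measure X, IsFiniteMeasure m ∧
    ∀ f : C(X, ℂ), ⟪ψ, Φ f ψ⟫_ℂ = ∫ x, f x ∂m := by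
  have hreal : ∀ f : C(X, ℝ), (⟪ψ, Φ (complexify f) ψ⟫_ℂ).im = 0 := by
    intro f
    have hs : star (complexify f) = complexify f := by
      ext x; simp [complexify]
    have h := inner_starHom Φ (complexify f) 1 ψ ψ
    rw [hs, mul_one, map_one] at h
    rw [← h, ← Complex.conj_eq_iff_im, inner_conj_symm, h]
    rfl
  let Λ₀ : CompactlySupportedContinuousMap X ℝ →ₗ[ℝ] ℝ :=
    { toFun := fun f => (⟪ψ, Φ (complexify (f : C(X, ℝ))) ψ⟫_ℂ).re
      map_add' := by
        intro f g
        have : complexify ((f + g : CompactlySupportedContinuousMap X ℝ) : C(X, ℝ)) =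
            complexify (f : C(X, ℝ)) + complexify (g : C(X, ℝ)) := by
          ext x; simp [complexify]
        rw [this, map_add, _root_.add_apply, inner_add_right, Complex.add_re]
      map_smul' := by
        intro c f
        have : complexify ((c • f : CompactlySupportedContinuousMap X ℝ) : C(X, ℝ)) =
            (c : ℂ) • complexify (f : C(X, ℝ)) := by
          ext x; simp [complexify]
        rw [this, map_smul, _root_.smul_apply, inner_smul_right, Complex.re_ofReal_mul]
        rfl }
  let Λ := PositiveLinearMap.mk₀ Λ₀ (by
    intro f hf
    let h : C(X, ℝ) := ⟨fun x => Real.sqrt (f x), by fun_prop⟩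
    have hfh : complexify (f : C(X, ℝ)) = star (complexify h) * complexify h := by
      ext x
      have : (0 : ℝ) ≤ f x := hf x
      simp only [complexify, ContinuousMap.coe_mk, ContinuousMap.mul_apply, ContinuousMap.star_apply,
        h, RCLike.star_def, Complex.conj_ofReal]
      rw [← Complex.ofReal_mul, Real.mul_self_sqrt this]
    change 0 ≤ (⟪ψ, Φ (complexify (f : C(X, ℝ))) ψ⟫_ℂ).re
    rw [hfh, ← inner_starHom]
    exact inner_self_nonneg (𝕜 := ℂ))
  refine ⟨RealRMK.rieszMeasure Λ, ?_, ?_⟩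
  · have := RealRMK.regular_rieszMeasure Λ
    exact CompactSpace.isFiniteMeasure
  · intro f
    have := RealRMK.regular_rieszMeasure Λ
    have : IsFiniteMeasure (RealRMK.rieszMeasure Λ) := CompactSpace.isFiniteMeasure
    have hint : ∀ g : C(X, ℝ), ⟪ψ, Φ (complexify g) ψ⟫_ℂ =
        ((∫ x, g x ∂(RealRMK.rieszMeasure Λ) : ℝ) : ℂ) := by
      intro g
      let g' : CompactlySupportedContinuousMap X ℝ := ⟨g, HasCompactSupport.of_compactSpace _⟩
      have h := RealRMK.integral_rieszMeasure Λ g'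
      refine Complex.ext ?_ ?_
      · rw [Complex.ofReal_re]; exact h.symm
      · rw [Complex.ofReal_im]; exact hreal g
    let fr : C(X, ℝ) := ⟨fun x => (f x).re, by fun_prop⟩
    let fi : C(X, ℝ) := ⟨fun x => (f x).im, by fun_prop⟩
    have hf : f = complexify fr + Complex.I • complexify fi := by
      ext x
      simp [complexify, fr, fi, mul_comm Complex.I, Complex.re_add_im]
    have hif : Integrable (fun x => f x) (RealRMK.rieszMeasure Λ) :=
      f.continuous.integrable_of_hasCompactSupport (HasCompactSupport.of_compactSpace _)
    conv_lhs => rw [hf]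
    rw [map_add, map_smul, _root_.add_apply, _root_.smul_apply,
      inner_add_right, inner_smul_right, hint, hint]
    have := integral_re_add_im (𝕜 := ℂ) hif
    rw [← this, mul_comm]
    rfl

/-- The measure `m` with `⟨ψ, f ψ⟩ = ∫ f dm` for all continuous `f`. -/
def starHomMeasure (ψ : E) : Measure X := (exists_starHomMeasure Φ ψ).choose

instance (ψ : E) : IsFiniteMeasure (starHomMeasure Φ ψ) := (exists_starHomMeasure Φ ψ).choose_spec.1

theorem inner_starHom_self (ψ : E) (f : C(X, ℂ)) :
    ⟪ψ, Φ f ψ⟫_ℂ = ∫ x, f x ∂(starHomMeasure Φ ψ) :=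
  (exists_starHomMeasure Φ ψ).choose_spec.2 f

theorem exists_starHomCyclic (ψ : E) : ∃ J : Lp ℂ 2 (starHomMeasure Φ ψ) →ₗᵢ[ℂ] E,
    ∀ f : C(X, ℂ), J (ContinuousMap.toLp 2 _ ℂ f) = Φ f ψ := by
  refine exists_linearIsometry_of_gram (ι := C(X, ℂ)) _ (fun f => Φ f ψ) ?_ ?_
  · intro f g
    rw [ContinuousMap.inner_toLp, inner_starHom, inner_starHom_self]
    refine integral_congr_ae (ae_of_all _ fun x => ?_)
    simp [mul_comm]
  · exact (ContinuousMap.toLp_denseRange ℂ (starHomMeasure Φ ψ) ℂ (by simp)).mono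
      Submodule.subset_span

/-- The isometry `f ↦ f ψ`, extended from continuous functions to `L²`. -/
def starHomCyclic (ψ : E) : Lp ℂ 2 (starHomMeasure Φ ψ) →ₗᵢ[ℂ] E := (exists_starHomCyclic Φ ψ).choose

theorem starHomCyclic_toLp (ψ : E) (f : C(X, ℂ)) :
    starHomCyclic Φ ψ (ContinuousMap.toLp 2 _ ℂ f) = Φ f ψ :=
  (exists_starHomCyclic Φ ψ).choose_spec f

theorem starHomCyclic_one (ψ : E) : starHomCyclic Φ ψ (ContinuousMap.toLp 2 _ ℂ 1) = ψ := by
  rw [starHomCyclic_toLp, map_one]; rfl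

open Classical in
/-- The spectral projection of a Borel set, as a function. -/
def starHomProjFun (S : Set X) (ψ : E) : E :=
  if hS : MeasurableSet S then
    starHomCyclic Φ ψ (indicatorConstLp 2 hS (measure_ne_top _ S) (1 : ℂ)) else 0

theorem starHomProjFun_eq {S : Set X} (hS : MeasurableSet S) (ψ : E) : starHomProjFun Φ S ψ =
    starHomCyclic Φ ψ (indicatorConstLp 2 hS (measure_ne_top _ S) (1 : ℂ)) := dif_pos hS

theorem inner_starHomProjFun {S : Set X} (hS : MeasurableSet S) (ψ : E) :
    ⟪ψ, starHomProjFun Φ S ψ⟫_ℂ = ((starHomMeasure Φ ψ).real S : ℂ) := by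
  have h1 := starHomCyclic_one Φ ψ
  have h2 : ContinuousMap.toLp 2 (starHomMeasure Φ ψ) ℂ (1 : C(X, ℂ)) =
      indicatorConstLp 2 MeasurableSet.univ (measure_ne_top _ Set.univ) (1 : ℂ) := by
    rw [indicatorConstLp_univ]; rfl
  rw [starHomProjFun_eq Φ hS]
  nth_rw 1 [← h1]
  rw [LinearIsometry.inner_map_map, h2,
    L2.inner_indicatorConstLp_one_indicatorConstLp_one, Set.univ_inter]
  rfl

theorem norm_sq_starHomProjFun {S : Set X} (hS : MeasurableSet S) (ψ : E) :
    ‖starHomProjFun Φ S ψ‖ ^ 2 = (starHomMeasure Φ ψ).real S := by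
  have h : ⟪starHomProjFun Φ S ψ, starHomProjFun Φ S ψ⟫_ℂ = ((starHomMeasure Φ ψ).real S : ℂ) := by
    rw [starHomProjFun_eq Φ hS, LinearIsometry.inner_map_map,
      L2.inner_indicatorConstLp_one_indicatorConstLp_one, Set.inter_self]
    rfl
  rw [inner_self_eq_norm_sq_to_K] at h
  exact Complex.ofReal_injective (by push_cast; exact h)

theorem starHomMeasure_univ (ψ : E) : (starHomMeasure Φ ψ).real Set.univ = ‖ψ‖ ^ 2 := by
  have h := inner_starHom_self Φ ψ 1
  rw [map_one] at h
  simp only [one_apply_eq_self, ContinuousMap.one_apply, integral_const,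
    inner_self_eq_norm_sq_to_K] at h
  rw [Complex.real_smul, mul_one] at h
  exact Complex.ofReal_injective (by push_cast; exact h.symm)

/-- On finitely many vectors, a spectral projection is approximated by one continuous function. -/
theorem exists_approx_starHomProjFun {S : Set X} (hS : MeasurableSet S) (L : Finset E) {ε : ℝ}
    (hε : 0 < ε) : ∃ f : C(X, ℂ), ∀ ψ ∈ L, ‖starHomProjFun Φ S ψ - Φ f ψ‖ ≤ ε := by
  set m : Measure X := ∑ ψ ∈ L, starHomMeasure Φ ψ with hm
  obtain ⟨g, hg, -⟩ := MemLp.exists_boundedContinuous_eLpNorm_sub_le (μ := m) (p := 2) (by simp)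
    (f := S.indicator fun _ => (1 : ℂ)) (memLp_indicator_const 2 hS 1 (Or.inr (measure_ne_top _ _)))
    (ε := ENNReal.ofReal ε) (by simpa using hε)
  refine ⟨g.toContinuousMap, fun ψ hψ => ?_⟩
  have hle : starHomMeasure Φ ψ ≤ m := Finset.single_le_sum (f := fun ψ => starHomMeasure Φ ψ)
    (fun _ _ => Measure.zero_le _) hψ
  rw [starHomProjFun_eq Φ hS, ← starHomCyclic_toLp, ← map_sub, LinearIsometry.norm_map, Lp.norm_def]
  refine ENNReal.toReal_le_of_le_ofReal hε.le ?_
  refine le_trans (le_of_eq ?_) ((eLpNorm_mono_measure _ hle).trans hg)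
  refine eLpNorm_congr_ae ?_
  filter_upwards [Lp.coeFn_sub (indicatorConstLp 2 hS (measure_ne_top (starHomMeasure Φ ψ) S) (1 : ℂ))
      (ContinuousMap.toLp 2 (starHomMeasure Φ ψ) ℂ g.toContinuousMap),
    indicatorConstLp_coeFn (p := 2) (hs := hS) (c := (1 : ℂ))
      (hμs := measure_ne_top (starHomMeasure Φ ψ) S),
    ContinuousMap.coeFn_toLp (p := 2) (𝕜 := ℂ) (starHomMeasure Φ ψ) g.toContinuousMap]
    with x h1 h2 h3
  rw [h1, Pi.sub_apply, h2, h3]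
  rfl

/-- Linearity of the spectral projections in the vector is not evident from their definition, since
the measure depends on the vector; it is inherited from the continuous functions that approximate
them. -/
theorem starHomProjFun_add {S : Set X} (hS : MeasurableSet S) (φ ψ : E) :
    starHomProjFun Φ S (φ + ψ) = starHomProjFun Φ S φ + starHomProjFun Φ S ψ := by
  classical
  rw [← sub_eq_zero, ← norm_le_zero_iff]
  refine le_of_forall_pos_le_add fun ε hε => ?_
  obtain ⟨f, hf⟩ := exists_approx_starHomProjFun Φ hS {φ, ψ, φ + ψ} (ε := ε / 3) (by positivity)
  have h1 := hf φ (by simp)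
  have h2 := hf ψ (by simp)
  have h3 := hf (φ + ψ) (by simp)
  have e : starHomProjFun Φ S (φ + ψ) - (starHomProjFun Φ S φ + starHomProjFun Φ S ψ) =
      (starHomProjFun Φ S (φ + ψ) - Φ f (φ + ψ)) - (starHomProjFun Φ S φ - Φ f φ) -
        (starHomProjFun Φ S ψ - Φ f ψ) := by rw [map_add]; abel
  rw [e]
  have := norm_sub_le ((starHomProjFun Φ S (φ + ψ) - Φ f (φ + ψ)) - (starHomProjFun Φ S φ - Φ f φ))
    (starHomProjFun Φ S ψ - Φ f ψ)
  have := norm_sub_le (starHomProjFun Φ S (φ + ψ) - Φ f (φ + ψ)) (starHomProjFun Φ S φ - Φ f φ)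
  linarith

theorem starHomProjFun_smul {S : Set X} (hS : MeasurableSet S) (c : ℂ) (ψ : E) :
    starHomProjFun Φ S (c • ψ) = c • starHomProjFun Φ S ψ := by
  classical
  rw [← sub_eq_zero, ← norm_le_zero_iff]
  refine le_of_forall_pos_le_add fun ε hε => ?_
  have hc : 0 < 1 + ‖c‖ := by positivity
  obtain ⟨f, hf⟩ := exists_approx_starHomProjFun Φ hS {ψ, c • ψ} (ε := ε / (1 + ‖c‖))
    (by positivity)
  have h1 := hf ψ (by simp)
  have h2 := hf (c • ψ) (by simp)
  have e : starHomProjFun Φ S (c • ψ) - c • starHomProjFun Φ S ψ =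
      (starHomProjFun Φ S (c • ψ) - Φ f (c • ψ)) - c • (starHomProjFun Φ S ψ - Φ f ψ) := by
    rw [map_smul, smul_sub]; abel
  rw [e]
  have h3 := norm_sub_le (starHomProjFun Φ S (c • ψ) - Φ f (c • ψ))
    (c • (starHomProjFun Φ S ψ - Φ f ψ))
  rw [norm_smul] at h3
  have h4 : ‖c‖ * ‖starHomProjFun Φ S ψ - Φ f ψ‖ ≤ ‖c‖ * (ε / (1 + ‖c‖)) := by gcongr
  have h5 : ε / (1 + ‖c‖) + ‖c‖ * (ε / (1 + ‖c‖)) = ε := by field_simp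
  linarith

/-- The spectral projection of a Borel set. -/
def starHomProj (S : Set X) (hS : MeasurableSet S) : E →L[ℂ] E :=
  LinearMap.mkContinuous
    { toFun := starHomProjFun Φ S
      map_add' := starHomProjFun_add Φ hS
      map_smul' := starHomProjFun_smul Φ hS } 1 (by
    intro ψ
    rw [one_mul]
    refine (sq_le_sq₀ (norm_nonneg _) (norm_nonneg _)).1 ?_
    change ‖starHomProjFun Φ S ψ‖ ^ 2 ≤ _
    rw [norm_sq_starHomProjFun Φ hS, ← starHomMeasure_univ Φ]
    exact measureReal_mono (Set.subset_univ _))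

theorem inner_starHomProj {S : Set X} (hS : MeasurableSet S) (ψ : E) :
    ⟪ψ, starHomProj Φ S hS ψ⟫_ℂ = ((starHomMeasure Φ ψ).real S : ℂ) :=
  inner_starHomProjFun Φ hS ψ

theorem norm_sq_starHomProj {S : Set X} (hS : MeasurableSet S) (ψ : E) :
    ‖starHomProj Φ S hS ψ‖ ^ 2 = (starHomMeasure Φ ψ).real S :=
  norm_sq_starHomProjFun Φ hS ψ

theorem isStarProjection_starHomProj {S : Set X} (hS : MeasurableSet S) :
    IsStarProjection (starHomProj Φ S hS) := by
  have hsymm : ((starHomProj Φ S hS : E →L[ℂ] E) : E →ₗ[ℂ] E).IsSymmetric := by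
    rw [LinearMap.isSymmetric_iff_inner_map_self_real]
    intro ψ
    rw [inner_conj_symm]
    have h := inner_starHomProj Φ hS ψ
    change ⟪ψ, starHomProj Φ S hS ψ⟫_ℂ = ⟪starHomProj Φ S hS ψ, ψ⟫_ℂ
    rw [← inner_conj_symm (starHomProj Φ S hS ψ) ψ, h, Complex.conj_ofReal]
  constructor
  · change starHomProj Φ S hS * starHomProj Φ S hS = starHomProj Φ S hS
    apply ContinuousLinearMap.coe_injective
    rw [← ext_inner_map]
    intro ψ
    have h1 : ⟪starHomProj Φ S hS (starHomProj Φ S hS ψ), ψ⟫_ℂ =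
        ⟪starHomProj Φ S hS ψ, starHomProj Φ S hS ψ⟫_ℂ := hsymm _ _
    change ⟪starHomProj Φ S hS (starHomProj Φ S hS ψ), ψ⟫_ℂ = ⟪starHomProj Φ S hS ψ, ψ⟫_ℂ
    rw [h1, inner_self_eq_norm_sq_to_K, ← inner_conj_symm, inner_starHomProj Φ hS,
      Complex.conj_ofReal, ← norm_sq_starHomProj Φ hS]
    norm_cast
  · exact ContinuousLinearMap.isSelfAdjoint_iff_isSymmetric.2 hsymm

theorem starHomProj_add {S T : Set X} (hS : MeasurableSet S) (hT : MeasurableSet T)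
    (hST : Disjoint S T) (ψ : E) :
    starHomProj Φ (S ∪ T) (hS.union hT) ψ = starHomProj Φ S hS ψ + starHomProj Φ T hT ψ := by
  change starHomProjFun Φ (S ∪ T) ψ = starHomProjFun Φ S ψ + starHomProjFun Φ T ψ
  rw [starHomProjFun_eq Φ hS, starHomProjFun_eq Φ hT, starHomProjFun_eq Φ (hS.union hT),
    indicatorConstLp_disjoint_union hS hT (measure_ne_top _ _) (measure_ne_top _ _) hST, map_add]

theorem hasSum_starHomProj (S : ℕ → Set X) (hS : ∀ n, MeasurableSet (S n))
    (hd : Pairwise (Function.onFun Disjoint S)) (ψ : E) :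
    HasSum (fun n => starHomProj Φ (S n) (hS n) ψ)
      (starHomProj Φ (⋃ n, S n) (MeasurableSet.iUnion hS) ψ) := by
  have hfin : ∀ s : Finset ℕ, ∑ n ∈ s, starHomProjFun Φ (S n) ψ =
      starHomProjFun Φ (⋃ n ∈ s, S n) ψ := by
    intro s
    induction s using Finset.induction_on with
    | empty =>
      have h := norm_sq_starHomProjFun Φ (MeasurableSet.empty) ψ
      rw [measureReal_empty] at h
      simp [norm_eq_zero.1 (pow_eq_zero_iff two_ne_zero |>.1 h)]
    | insert a s ha ih =>
      rw [Finset.sum_insert ha, ih, Finset.set_biUnion_insert]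
      refine (starHomProj_add Φ (hS a) (s.measurableSet_biUnion fun n _ => hS n) ?_ ψ).symm
      rw [Set.disjoint_iUnion₂_right]
      intro n hn
      exact hd (fun h => ha (h ▸ hn))
  have hsum : HasSum (fun n => (starHomMeasure Φ ψ).real (S n))
      ((starHomMeasure Φ ψ).real (⋃ n, S n)) := by
    have h1 := measure_iUnion (μ := starHomMeasure Φ ψ) (fun i j h => hd h) hS
    rw [measureReal_def, h1, ENNReal.tsum_toReal_eq fun n => measure_ne_top _ _]
    exact ENNReal.hasSum_toReal (h1 ▸ measure_ne_top _ _)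
  rw [HasSum, tendsto_iff_norm_sub_tendsto_zero]
  have hkey : ∀ s : Finset ℕ, ‖∑ n ∈ s, starHomProj Φ (S n) (hS n) ψ -
      starHomProj Φ (⋃ n, S n) (MeasurableSet.iUnion hS) ψ‖ = Real.sqrt
      ((starHomMeasure Φ ψ).real (⋃ n, S n) - ∑ n ∈ s, (starHomMeasure Φ ψ).real (S n)) := by
    intro s
    have hms : MeasurableSet (⋃ n ∈ s, S n) := s.measurableSet_biUnion fun n _ => hS n
    have hsub : (⋃ n ∈ s, S n) ⊆ ⋃ n, S n := Set.iUnion₂_subset_iUnion _ _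
    have h1 := starHomProj_add Φ hms ((MeasurableSet.iUnion hS).diff hms)
      Set.disjoint_sdiff_right ψ
    have h2 : starHomProj Φ (⋃ n, S n) (MeasurableSet.iUnion hS) ψ =
        starHomProj Φ (⋃ n ∈ s, S n) hms ψ +
        starHomProj Φ ((⋃ n, S n) \ ⋃ n ∈ s, S n) ((MeasurableSet.iUnion hS).diff hms) ψ := by
      rw [← h1]
      change starHomProjFun Φ _ ψ = starHomProjFun Φ _ ψ
      rw [Set.union_sdiff_cancel hsub]
    have h3 : ∑ n ∈ s, starHomProj Φ (S n) (hS n) ψ = starHomProj Φ (⋃ n ∈ s, S n) hms ψ := hfin s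
    rw [h3, h2, sub_add_cancel_left, norm_neg, ← Real.sqrt_sq (norm_nonneg _),
      norm_sq_starHomProj, measureReal_sdiff hsub hms, measureReal_biUnion_finset (fun i _ j _ h => hd h)
        (fun n _ => hS n)]
  simp_rw [hkey]
  have h4 : Tendsto (fun s : Finset ℕ => (starHomMeasure Φ ψ).real (⋃ n, S n) -
      ∑ n ∈ s, (starHomMeasure Φ ψ).real (S n)) atTop (𝓝 0) := by
    have := hsum.const_sub ((starHomMeasure Φ ψ).real (⋃ n, S n))
    simpa using this
  have h5 := (Real.continuous_sqrt.tendsto 0).comp h4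
  simpa [Function.comp_def] using h5

/-- The projection-valued measure on `ℝ` obtained by transporting the spectral projections along a
measurable map `κ : X → ℝ`. -/
def starHomPVM {κ : X → ℝ} (hκ : Measurable κ) : ProjectionValuedMeasure E where
  proj S := by
    classical
    exact if hS : MeasurableSet S then starHomProj Φ (κ ⁻¹' S) (hκ hS) else 0
  isStarProjection S hS := by
    rw [dif_pos hS]; exact isStarProjection_starHomProj Φ _
  proj_univ := by
    rw [dif_pos MeasurableSet.univ]
    ext ψ
    have h1 : starHomProjFun Φ Set.univ ψ = ψ := by
      rw [starHomProjFun_eq Φ MeasurableSet.univ, indicatorConstLp_univ]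
      exact starHomCyclic_one Φ ψ
    exact h1
  hasSum_iUnion S hS hd ψ := by
    simp only [dif_pos (hS _), dif_pos (MeasurableSet.iUnion hS)]
    have h := hasSum_starHomProj Φ (fun n => κ ⁻¹' S n) (fun n => hκ (hS n))
      (fun i j h => (hd h).preimage κ) ψ
    convert! h using 1
    change starHomProjFun Φ _ ψ = starHomProjFun Φ _ ψ
    rw [Set.preimage_iUnion]

theorem measureAt_starHomPVM {κ : X → ℝ} (hκ : Measurable κ) (ψ : E) :
    (starHomPVM Φ hκ).measureAt ψ = (starHomMeasure Φ ψ).map κ := by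
  refine Measure.ext fun S hS => ?_
  rw [ProjectionValuedMeasure.measureAt_apply _ _ hS, Measure.map_apply hκ hS]
  have : (starHomPVM Φ hκ).proj S = starHomProj Φ (κ ⁻¹' S) (hκ hS) := dif_pos hS
  rw [this, norm_sq_starHomProj, measureReal_def, ENNReal.ofReal_toReal (measure_ne_top _ _)]

end Calculus
end
end BetheAnderson

namespace BetheAnderson

noncomputable section

open scoped InnerProductSpace ComplexConjugate ENNReal

/-! ### Existence in the spectral theorem -/

section Existence

variable {E : Type*} [NormedAddCommGroup E] [InnerProductSpace ℂ E]

section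

variable [CompleteSpace E] {X : Type*} [MetricSpace X] [CompactSpace X] [MeasurableSpace X] [BorelSpace X]
  (Φ : C(X, ℂ) →⋆ₐ[ℂ] (E →L[ℂ] E))

theorem starHomMeasure_apply (w : C(X, ℂ)) (φ : E) : starHomMeasure Φ (Φ w φ) =
    (starHomMeasure Φ φ).withDensity fun x => ENNReal.ofReal (‖w x‖ ^ 2) := by
  have hint : Integrable (fun x => ‖w x‖ ^ 2) (starHomMeasure Φ φ) :=
    Continuous.integrable_of_hasCompactSupport (by fun_prop) (HasCompactSupport.of_compactSpace _)
  have : IsFiniteMeasure ((starHomMeasure Φ φ).withDensity fun x => ENNReal.ofReal (‖w x‖ ^ 2)) :=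
    isFiniteMeasure_withDensity_ofReal hint.2
  refine ext_of_forall_integral_eq_of_IsFiniteMeasure fun f => ?_
  have h1 := inner_starHom_self Φ (Φ w φ) (complexify f.toContinuousMap)
  have h2 : ⟪Φ w φ, Φ (complexify f.toContinuousMap) (Φ w φ)⟫_ℂ =
      ⟪φ, Φ (star w * (complexify f.toContinuousMap * w)) φ⟫_ℂ := by
    rw [← inner_starHom, map_mul]; rfl
  rw [h2, inner_starHom_self] at h1
  have e : (fun x => ENNReal.ofReal (‖w x‖ ^ 2)) =
      fun x => ((Real.toNNReal (‖w x‖ ^ 2) : NNReal) : ℝ≥0∞) := rfl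
  rw [e, integral_withDensity_eq_integral_smul (by fun_prop)]
  apply Complex.ofReal_injective
  rw [← integral_complex_ofReal, ← integral_complex_ofReal]
  refine h1.symm.trans (integral_congr_ae (ae_of_all _ fun x => ?_))
  simp only [complexify, ContinuousMap.mul_apply, ContinuousMap.star_apply, ContinuousMap.coe_mk,
    RCLike.star_def, NNReal.smul_def, smul_eq_mul, Real.coe_toNNReal _ (sq_nonneg ‖w x‖),
    Complex.ofReal_mul]
  rw [mul_left_comm, ← Complex.normSq_eq_conj_mul_self, Complex.normSq_eq_norm_sq, mul_comm]
  rfl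

/-- Applying a function of the calculus to `h ψ` amounts to multiplying `h`. -/
theorem starHom_starHomCyclic (w : C(X, ℂ)) (ψ : E) (h g : Lp ℂ 2 (starHomMeasure Φ ψ))
    (hg : ∀ᵐ x ∂(starHomMeasure Φ ψ), g x = w x * h x) :
    Φ w (starHomCyclic Φ ψ h) = starHomCyclic Φ ψ g := by
  refine ext_inner_left ℂ fun χ => ?_
  set k : Lp ℂ 2 (starHomMeasure Φ ψ) :=
    ContinuousLinearMap.adjoint (starHomCyclic Φ ψ).toContinuousLinearMap χ with hk
  have hkf : ∀ f, ⟪k, f⟫_ℂ = ⟪χ, starHomCyclic Φ ψ f⟫_ℂ := fun f =>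
    ContinuousLinearMap.adjoint_inner_left _ _ _
  have hmem : MemLp (fun x => conj (w x) * k x) 2 (starHomMeasure Φ ψ) := by
    refine MemLp.of_le_mul (c := ‖w‖) (Lp.memLp k) ?_ (ae_of_all _ fun x => ?_)
    · exact (by fun_prop : Continuous fun x => conj (w x)).aestronglyMeasurable.mul
        (Lp.aestronglyMeasurable k)
    · rw [norm_mul, RCLike.norm_conj]
      gcongr
      exact w.norm_coe_le_norm x
  have key : ((innerSL ℂ χ).comp (Φ w)).comp (starHomCyclic Φ ψ).toContinuousLinearMap =
      innerSL ℂ (hmem.toLp _) := by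
    refine DFunLike.coe_injective ((ContinuousMap.toLp_denseRange ℂ (starHomMeasure Φ ψ) ℂ (by simp)).equalizer
      (ContinuousLinearMap.continuous _) (ContinuousLinearMap.continuous _) (funext fun f => ?_))
    simp only [Function.comp_apply, ContinuousLinearMap.comp_apply, innerSL_apply_apply,
      LinearIsometry.coe_toContinuousLinearMap]
    have h1 : Φ w (starHomCyclic Φ ψ (ContinuousMap.toLp 2 (starHomMeasure Φ ψ) ℂ f)) =
        starHomCyclic Φ ψ (ContinuousMap.toLp 2 (starHomMeasure Φ ψ) ℂ (w * f)) := by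
      rw [starHomCyclic_toLp, starHomCyclic_toLp, map_mul]; rfl
    rw [h1, ← hkf, L2.inner_def, L2.inner_def]
    refine integral_congr_ae ?_
    filter_upwards [hmem.coeFn_toLp, ContinuousMap.coeFn_toLp (p := 2) (𝕜 := ℂ) (starHomMeasure Φ ψ) f,
      ContinuousMap.coeFn_toLp (p := 2) (𝕜 := ℂ) (starHomMeasure Φ ψ) (w * f)] with x h2 h3 h4
    rw [h2, h3, h4]
    simp only [RCLike.inner_apply, ContinuousMap.mul_apply, map_mul, RCLike.conj_conj]
    ring
  have h5 := congrArg (fun T => T h) key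
  simp only [ContinuousLinearMap.comp_apply, innerSL_apply_apply,
      LinearIsometry.coe_toContinuousLinearMap] at h5
  rw [h5, ← hkf, L2.inner_def, L2.inner_def]
  refine integral_congr_ae ?_
  filter_upwards [hmem.coeFn_toLp, hg] with x h2 h3
  rw [h2, h3]
  simp only [RCLike.inner_apply, map_mul, RCLike.conj_conj]
  ring

/-- If a function `w` of the calculus represents `(H - i)⁻¹`, then `Re (1 / w)` represents `H`. The
relation `hw` says that `1 / w + i` is real where `w ≠ 0`; the junk value of `w⁻¹` at the zeros of
`w` is harmless, as these are a null set for the measures of all vectors. -/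
theorem isSpectralResolution_starHomPVM {H : E →ₗ.[ℂ] E} (hH : HasResolvents H) (w : C(X, ℂ))
    (hres : ∀ f : E, ∃ u : H.domain, H u - Complex.I • (u : E) = f ∧ Φ w f = u)
    (hw : ∀ x, (w x).im = Complex.normSq (w x))
    (hκ : Measurable fun x => ((w x)⁻¹).re) :
    IsSpectralResolution H (starHomPVM Φ hκ) := by
  have hI : Complex.I.im ≠ 0 := by simp
  have hrange : ∀ ψ : H.domain, Φ w (H ψ - Complex.I • (ψ : E)) = ψ := by
    intro ψ
    obtain ⟨u, hu1, hu2⟩ := hres (H ψ - Complex.I • (ψ : E))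
    rw [hu2, hH.eq_of_sub_eq hI hu1]
  have hκre : ∀ x, ((w x)⁻¹).re * Complex.normSq (w x) = (w x).re := by
    intro x
    rcases eq_or_ne (w x) 0 with h | h
    · simp [h]
    · rw [Complex.inv_re, div_mul_cancel₀ _ (by simpa using h)]
  constructor
  · intro ψ
    rw [measureAt_starHomPVM, lintegral_map (by fun_prop) hκ]
    constructor
    · intro hψ
      set φ := H ⟨ψ, hψ⟩ - Complex.I • ψ with hφ
      have h1 : Φ w φ = ψ := hrange ⟨ψ, hψ⟩
      rw [← h1, starHomMeasure_apply,
        lintegral_withDensity_eq_lintegral_mul₀ (by fun_prop) (by fun_prop)]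
      refine lt_of_le_of_lt (lintegral_mono (g := fun _ => 1) fun x => ?_) (by
        rw [lintegral_const, one_mul]; exact measure_lt_top _ _)
      rw [Pi.mul_apply, ← ENNReal.ofReal_mul (by positivity)]
      refine ENNReal.ofReal_le_one.2 ?_
      have h2 : ‖w x‖ ^ 2 * ((w x)⁻¹).re ^ 2 ≤ ‖w x‖ ^ 2 * ‖(w x)⁻¹‖ ^ 2 := by
        gcongr ?_ * ?_
        rw [← sq_abs]
        gcongr
        exact Complex.abs_re_le_norm _
      refine h2.trans ?_
      rw [← mul_pow, ← norm_mul]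
      rcases eq_or_ne (w x) 0 with h | h
      · simp [h]
      · rw [mul_inv_cancel₀ h]; simp
    · intro hψ
      set m := starHomMeasure Φ ψ with hm
      have hwm : Measurable fun x => w x := w.continuous.measurable
      -- `0` is not an atom since `(H - i)⁻¹` is injective
      have hzero : ∀ᵐ x ∂m, w x ≠ 0 := by
        have hZ : MeasurableSet {x | w x = 0} := hwm (measurableSet_singleton 0)
        have h1 := starHom_starHomCyclic Φ w ψ
          (indicatorConstLp 2 hZ (measure_ne_top _ _) (1 : ℂ)) 0 (by
          filter_upwards [indicatorConstLp_coeFn (p := 2) (hs := hZ) (c := (1 : ℂ))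
            (hμs := measure_ne_top m _), Lp.coeFn_zero ℂ 2 m] with x h1 h2
          rw [h1, h2]
          by_cases hx : w x = 0 <;> simp [hx])
        rw [map_zero] at h1
        have h2 := norm_sq_starHomProjFun Φ hZ ψ
        rw [starHomProjFun_eq Φ hZ] at h2
        obtain ⟨u, hu1, hu2⟩ := hres (starHomCyclic Φ ψ
          (indicatorConstLp 2 hZ (measure_ne_top _ _) (1 : ℂ)))
        rw [h1] at hu2
        have hu0 : u = 0 := Subtype.ext hu2.symm
        rw [hu0, LinearPMap.map_zero] at hu1
        rw [← hu1] at h2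
        simp only [ZeroMemClass.coe_zero, smul_zero, sub_zero, norm_zero] at h2
        rw [ae_iff]
        simp only [not_not]
        have h3 : m.real {x | w x = 0} = 0 := by rw [← h2]; norm_num
        exact (measureReal_eq_zero_iff (measure_ne_top _ _)).1 h3
      have hinv : MemLp (fun x => (w x)⁻¹) 2 m := by
        have hwi : Measurable fun x => (w x)⁻¹ := hwm.inv
        rw [memLp_two_iff_integrable_sq_norm hwi.aestronglyMeasurable]
        have h1 : Integrable (fun x => ((w x)⁻¹).re ^ 2) m := by
          refine ⟨(hκ.pow_const 2).aestronglyMeasurable, ?_⟩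
          rw [hasFiniteIntegral_iff_ofReal (ae_of_all _ fun x => sq_nonneg _)]
          exact hψ
        refine (h1.add (integrable_const 1)).congr ?_
        filter_upwards [hzero] with x hx
        have him : ((w x)⁻¹).im = -1 := by
          rw [Complex.inv_im, hw, neg_div, div_self (by simpa using hx)]
        rw [Pi.add_apply, ← Complex.normSq_eq_norm_sq, Complex.normSq_apply, him]
        ring
      have h1 := starHom_starHomCyclic Φ w ψ (hinv.toLp _) (ContinuousMap.toLp 2 _ ℂ 1) (by
        filter_upwards [hinv.coeFn_toLp, ContinuousMap.coeFn_toLp (p := 2) (𝕜 := ℂ) m (1 : C(X, ℂ)),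
          hzero]
          with x h1 h2 h3
        rw [h1, h2, mul_inv_cancel₀ h3]; rfl)
      rw [starHomCyclic_one] at h1
      obtain ⟨u, -, hu⟩ := hres (starHomCyclic Φ ψ (hinv.toLp _))
      rw [← h1, hu]
      exact u.2
  · intro ψ
    set φ := H ψ - Complex.I • (ψ : E) with hφ
    have h1 : Φ w φ = ψ := hrange ψ
    have h2 : H ψ = Φ 1 φ + Complex.I • Φ w φ := by
      rw [h1, map_one, hφ]; simp
    have hint : Integrable (fun x => ‖w x‖ ^ 2) (starHomMeasure Φ φ) :=
      Continuous.integrable_of_hasCompactSupport (by fun_prop) (HasCompactSupport.of_compactSpace _)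
    rw [measureAt_starHomPVM, integral_map hκ.aemeasurable (by fun_prop), h2]
    nth_rw 1 [← h1]
    rw [← h1, starHomMeasure_apply, h1]
    have e : (fun x => ENNReal.ofReal (‖w x‖ ^ 2)) =
        fun x => ((Real.toNNReal (‖w x‖ ^ 2) : NNReal) : ℝ≥0∞) := rfl
    rw [e, integral_withDensity_eq_integral_smul (by fun_prop)]
    have h3 : Φ 1 φ + Complex.I • (ψ : E) = Φ (1 + Complex.I • w) φ := by
      rw [map_add, map_smul, ← h1]; rfl
    rw [h3, ← h1, inner_starHom, inner_starHom_self, ← integral_complex_ofReal]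
    refine integral_congr_ae (ae_of_all _ fun x => ?_)
    simp only [ContinuousMap.mul_apply, ContinuousMap.star_apply, ContinuousMap.add_apply,
      ContinuousMap.one_apply, ContinuousMap.smul_apply, RCLike.star_def, NNReal.smul_def,
      smul_eq_mul, Real.coe_toNNReal _ (sq_nonneg ‖w x‖)]
    rw [← Complex.normSq_eq_norm_sq, mul_comm (Complex.normSq (w x)), hκre]
    have h4 := hw x
    rw [Complex.normSq_apply] at h4
    apply Complex.ext
    · simp; nlinarith
    · simp; nlinarith

end

/-- The resolvent `(H - z)⁻¹`, as a map into the domain. -/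
def HasResolvents.solve {H : E →ₗ.[ℂ] E} (hH : HasResolvents H) {z : ℂ} (hz : z.im ≠ 0) (f : E) :
    H.domain := (hH.surj z hz f).choose

theorem HasResolvents.solve_spec {H : E →ₗ.[ℂ] E} (hH : HasResolvents H) {z : ℂ} (hz : z.im ≠ 0)
    (f : E) : H (hH.solve hz f) - z • (hH.solve hz f : E) = f := (hH.surj z hz f).choose_spec

/-- The resolvent `(H - z)⁻¹`, as a bounded operator. -/
def HasResolvents.resolvent {H : E →ₗ.[ℂ] E} (hH : HasResolvents H) {z : ℂ} (hz : z.im ≠ 0) :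
    E →L[ℂ] E :=
  LinearMap.mkContinuous
    { toFun := fun f => (hH.solve hz f : E)
      map_add' := by
        intro f g
        rw [← Submodule.coe_add]
        congr 1
        refine hH.eq_of_sub_eq hz ?_
        rw [LinearPMap.map_add, Submodule.coe_add, smul_add, add_sub_add_comm, hH.solve_spec,
          hH.solve_spec, hH.solve_spec]
      map_smul' := by
        intro c f
        rw [RingHom.id_apply, ← Submodule.coe_smul]
        congr 1
        refine hH.eq_of_sub_eq hz ?_
        rw [LinearPMap.map_smul, Submodule.coe_smul, smul_comm z c, ← smul_sub, hH.solve_spec,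
          hH.solve_spec] } (1 / |z.im|) (by
    intro f
    have h := im_mul_norm_le_of_symm hH.symm z (hH.solve hz f)
    rw [hH.solve_spec] at h
    have := abs_pos.2 hz
    rw [div_mul_eq_mul_div, one_mul, le_div_iff₀ this, mul_comm]
    exact h)

theorem HasResolvents.resolvent_apply {H : E →ₗ.[ℂ] E} (hH : HasResolvents H) {z : ℂ}
    (hz : z.im ≠ 0) (f : E) : hH.resolvent hz f = hH.solve hz f := rfl

theorem HasResolvents.resolvent_sub {H : E →ₗ.[ℂ] E} (hH : HasResolvents H) {z w : ℂ}
    (hz : z.im ≠ 0) (hw : w.im ≠ 0) (f : E) :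
    hH.resolvent hz f - hH.resolvent hw f = (z - w) • hH.resolvent hw (hH.resolvent hz f) := by
  simp only [HasResolvents.resolvent_apply]
  rw [← Submodule.coe_sub, ← Submodule.coe_smul]
  congr 1
  refine hH.eq_of_sub_eq hw ?_
  rw [LinearPMap.map_smul, Submodule.coe_smul, smul_comm w, ← smul_sub, hH.solve_spec,
    LinearPMap.map_sub, Submodule.coe_sub, smul_sub, sub_smul]
  have h1 := hH.solve_spec hz f
  have h2 := hH.solve_spec hw f
  rw [sub_eq_iff_eq_add] at h1 h2
  rw [h1, h2]
  abel

variable [CompleteSpace E]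

theorem HasResolvents.star_resolvent {H : E →ₗ.[ℂ] E} (hH : HasResolvents H) {z : ℂ}
    (hz : z.im ≠ 0) (hz' : (conj z).im ≠ 0) :
    star (hH.resolvent hz) = hH.resolvent hz' := by
  rw [ContinuousLinearMap.star_eq_adjoint]
  symm
  rw [ContinuousLinearMap.eq_adjoint_iff]
  intro f g
  rw [hH.resolvent_apply, hH.resolvent_apply]
  have h1 := hH.solve_spec hz g
  have h2 := hH.solve_spec hz' f
  nth_rw 2 [← h2]
  nth_rw 1 [← h1]
  rw [inner_sub_left, inner_sub_right, hH.symm, inner_smul_left, inner_smul_right, RCLike.conj_conj]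

/-- **Spectral theorem**: a self-adjoint operator has a spectral resolution. -/
theorem HasResolvents.exists_isSpectralResolution {H : E →ₗ.[ℂ] E} (hH : HasResolvents H) :
    ∃ P : ProjectionValuedMeasure E, IsSpectralResolution H P := by
  have hI : Complex.I.im ≠ 0 := by simp
  have hI' : (conj Complex.I).im ≠ 0 := by simp
  set R := hH.resolvent hI with hR
  have hstar : star R = hH.resolvent hI' := hH.star_resolvent hI hI'
  have h1 : R - star R = (2 * Complex.I) • (star R * R) := by
    ext f
    have := hH.resolvent_sub hI hI' f
    rw [hstar]
    simpa [two_mul] using this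
  have h2 : R - star R = (2 * Complex.I) • (R * star R) := by
    ext f
    have := hH.resolvent_sub hI' hI f
    rw [hstar, ← neg_sub]
    have h3 := congrArg Neg.neg this
    rw [_root_.neg_apply]
    refine h3.trans ?_
    rw [← neg_smul]
    congr 1
    simp [two_mul]
  -- The two forms of the resolvent identity show that the resolvent at `i` is normal.
  have hnormal : IsStarNormal R := by
    constructor
    have h3 := h1.symm.trans h2
    exact smul_right_injective _ (by simp : (2 * Complex.I : ℂ) ≠ 0) h3
  let Φ := cfcHom (R := ℂ) hnormal
  let w : C(spectrum ℂ R, ℂ) := ContinuousMap.restrict (spectrum ℂ R) (ContinuousMap.id ℂ)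
  have hΦw : Φ w = R := cfcHom_id hnormal
  have hwrel : w - star w = (2 * Complex.I) • (star w * w) := by
    refine (cfcHom_isClosedEmbedding hnormal).injective ?_
    change Φ _ = Φ _
    rw [map_sub, map_smul, map_mul, map_star, hΦw, h1]
  have hw : ∀ x, (w x).im = Complex.normSq (w x) := by
    intro x
    have h3 := congrArg (fun f : C(spectrum ℂ R, ℂ) => (f x).im) hwrel
    simp only [ContinuousMap.sub_apply, ContinuousMap.star_apply, ContinuousMap.smul_apply,
      ContinuousMap.mul_apply, RCLike.star_def, smul_eq_mul] at h3
    rw [← Complex.normSq_eq_conj_mul_self] at h3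
    simp at h3
    linarith
  have hκ : Measurable fun x => ((w x)⁻¹).re :=
    Complex.measurable_re.comp w.continuous.measurable.inv
  exact ⟨starHomPVM Φ hκ, isSpectralResolution_starHomPVM Φ hH w
    (fun f => ⟨hH.solve hI f, hH.solve_spec hI f, by rw [hΦw]; rfl⟩) hw hκ⟩

end Existence
end
end BetheAnderson

namespace BetheAnderson

noncomputable section

open scoped InnerProductSpace ComplexConjugate ENNReal

/-! ### Self-adjointness of Anderson operators -/

section AndersonOperator

variable {V : Type*}

theorem ofReal_norm_sq_eq_tsum (f : lp (fun _ : V => ℂ) 2) :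
    ENNReal.ofReal (‖f‖ ^ 2) = ∑' v, ENNReal.ofReal (‖f v‖ ^ 2) := by
  have h1 := lp.norm_rpow_eq_tsum (p := 2) (by norm_num) f
  have h2 : Summable fun v => ‖f v‖ ^ 2 := by
    have := (lp.memℓp f).summable (by norm_num)
    simpa using this
  simp only [ENNReal.toReal_ofNat, Real.rpow_ofNat] at h1
  rw [h1, ENNReal.ofReal_tsum_of_nonneg (fun v => sq_nonneg _) h2]

theorem tsum_sum_neighbor_le (Γ : SimpleGraph V) [Γ.LocallyFinite] {d : ℕ}
    (h : ∀ v, Γ.degree v ≤ d) (a : V → ℝ≥0∞) :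
    ∑' v, ∑ w ∈ Γ.neighborFinset v, a w ≤ d * ∑' w, a w := by
  classical
  have e : ∀ v, ∑ w ∈ Γ.neighborFinset v, a w = ∑' w, if Γ.Adj v w then a w else 0 := by
    intro v
    rw [tsum_eq_sum (s := Γ.neighborFinset v) (fun w hw => by
      rw [if_neg (by simpa using hw)])]
    exact Finset.sum_congr rfl fun w hw => (if_pos (by simpa using hw)).symm
  simp_rw [e]
  rw [ENNReal.tsum_comm, ← ENNReal.tsum_mul_left]
  refine ENNReal.tsum_le_tsum fun w => ?_
  rw [tsum_eq_sum (s := Γ.neighborFinset w) (fun v hv => by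
    rw [if_neg (by simpa [Γ.adj_comm] using hv)])]
  calc _ ≤ ∑ v ∈ Γ.neighborFinset w, a w :=
        Finset.sum_le_sum fun v _ => by split_ifs <;> simp
    _ ≤ _ := by
        rw [Finset.sum_const, nsmul_eq_mul]
        gcongr
        exact h w

/-- The Schur bound for an operator of bounded hopping. -/
theorem tsum_norm_sq_hopping_le (Γ : SimpleGraph V) [Γ.LocallyFinite] {d : ℕ}
    (h : ∀ v, Γ.degree v ≤ d) (c : V → V → ℂ) {κ : ℝ} (hc : ∀ v w, Γ.Adj v w → ‖c v w‖ ≤ κ)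
    (ψ : V → ℂ) :
    ∑' v, ENNReal.ofReal (‖∑ w ∈ Γ.neighborFinset v, c v w * ψ w‖ ^ 2) ≤
      ENNReal.ofReal ((κ * d) ^ 2) * ∑' w, ENNReal.ofReal (‖ψ w‖ ^ 2) := by
  have key : ∀ v, ENNReal.ofReal (‖∑ w ∈ Γ.neighborFinset v, c v w * ψ w‖ ^ 2) ≤
      ENNReal.ofReal (d * κ ^ 2) * ∑ w ∈ Γ.neighborFinset v, ENNReal.ofReal (‖ψ w‖ ^ 2) := by
    intro v
    rw [← ENNReal.ofReal_sum_of_nonneg (fun _ _ => by positivity),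
      ← ENNReal.ofReal_mul (by positivity)]
    apply ENNReal.ofReal_le_ofReal
    calc ‖∑ w ∈ Γ.neighborFinset v, c v w * ψ w‖ ^ 2
        ≤ (∑ w ∈ Γ.neighborFinset v, κ * ‖ψ w‖) ^ 2 := by
          gcongr
          refine (norm_sum_le _ _).trans (Finset.sum_le_sum fun w hw => ?_)
          rw [norm_mul]
          gcongr
          exact hc v w (by simpa using hw)
      _ ≤ (Γ.neighborFinset v).card * ∑ w ∈ Γ.neighborFinset v, (κ * ‖ψ w‖) ^ 2 :=
          sq_sum_le_card_mul_sum_sq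
      _ ≤ d * ∑ w ∈ Γ.neighborFinset v, (κ * ‖ψ w‖) ^ 2 := by
          gcongr; exact h v
      _ = d * κ ^ 2 * ∑ w ∈ Γ.neighborFinset v, ‖ψ w‖ ^ 2 := by
          rw [mul_assoc, Finset.mul_sum (a := κ ^ 2)]
          simp_rw [mul_pow]
  refine (ENNReal.tsum_le_tsum key).trans ?_
  rw [ENNReal.tsum_mul_left]
  refine (mul_le_mul_right (tsum_sum_neighbor_le Γ h _) _).trans (le_of_eq ?_)
  rw [← mul_assoc]
  congr 1
  rw [← ENNReal.ofReal_natCast, ← ENNReal.ofReal_mul (by positivity)]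
  congr 1
  ring

variable (Γ : SimpleGraph V) [Γ.LocallyFinite] {d : ℕ} (h : ∀ v, Γ.degree v ≤ d)

theorem adjacencyOperator_apply (ψ : lp (fun _ : V => ℂ) 2) (v : V) :
    adjacencyOperator Γ h ψ v = ∑ w ∈ Γ.neighborFinset v, ψ w := rfl

theorem norm_adjacencyOperator_le (ψ : lp (fun _ : V => ℂ) 2) :
    ‖adjacencyOperator Γ h ψ‖ ≤ d * ‖ψ‖ := by
  have h1 := tsum_norm_sq_hopping_le Γ h (fun _ _ => 1) (κ := 1) (by simp) ψ
  simp only [one_mul] at h1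
  rw [← ofReal_norm_sq_eq_tsum ψ] at h1
  have h2 : ENNReal.ofReal (‖adjacencyOperator Γ h ψ‖ ^ 2) ≤ ENNReal.ofReal ((d * ‖ψ‖) ^ 2) := by
    rw [ofReal_norm_sq_eq_tsum]
    refine h1.trans (le_of_eq ?_)
    rw [← ENNReal.ofReal_mul (by positivity), mul_pow]
  rw [ENNReal.ofReal_le_ofReal_iff (by positivity)] at h2
  exact (sq_le_sq₀ (norm_nonneg _) (by positivity)).1 h2

/-- The adjacency operator as a bounded operator. -/
def adjacencyCLM : lp (fun _ : V => ℂ) 2 →L[ℂ] lp (fun _ : V => ℂ) 2 :=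
  (adjacencyOperator Γ h).mkContinuous d (norm_adjacencyOperator_le Γ h)

theorem adjacencyCLM_apply (ψ : lp (fun _ : V => ℂ) 2) :
    adjacencyCLM Γ h ψ = adjacencyOperator Γ h ψ := rfl

/-- Continuous linear functionals on `ℓ²` that agree on point masses are equal. -/
theorem ext_single [DecidableEq V] {F G : lp (fun _ : V => ℂ) 2 →L[ℂ] ℂ}
    (hFG : ∀ v, F (lp.single 2 v 1) = G (lp.single 2 v 1)) : F = G := by
  ext ψ
  have h1 := (lp.hasSum_single (by simp) ψ).mapL F
  have h2 := (lp.hasSum_single (by simp) ψ).mapL G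
  refine h1.unique (h2.congr_fun fun v => ?_) |>.trans rfl
  have : lp.single 2 v (ψ v) = ψ v • (lp.single 2 v (1 : ℂ) : lp (fun _ : V => ℂ) 2) := by
    rw [← lp.single_smul, smul_eq_mul, mul_one]
  rw [this, map_smul, map_smul, hFG]

theorem adjacencyOperator_single [DecidableEq V] [DecidableRel Γ.Adj] (w v : V) :
    adjacencyOperator Γ h (lp.single 2 w 1) v = if Γ.Adj w v then 1 else 0 := by
  rw [adjacencyOperator_apply]
  simp only [lp.coeFn_single, Pi.single_apply]
  rw [Finset.sum_ite_eq']
  simp [Γ.adj_comm]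

theorem adjacencyOperator_symm (φ ψ : lp (fun _ : V => ℂ) 2) :
    ⟪adjacencyOperator Γ h φ, ψ⟫_ℂ = ⟪φ, adjacencyOperator Γ h ψ⟫_ℂ := by
  classical
  have key : innerSL ℂ (adjacencyOperator Γ h φ) = (innerSL ℂ φ).comp (adjacencyCLM Γ h) := by
    refine ext_single fun v => ?_
    rw [ContinuousLinearMap.comp_apply, innerSL_apply_apply, innerSL_apply_apply,
      lp.inner_single_right, lp.inner_eq_tsum, adjacencyCLM_apply,
      tsum_eq_sum (s := Γ.neighborFinset v)]
    · rw [adjacencyOperator_apply, sum_inner]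
      refine Finset.sum_congr rfl fun w hw => ?_
      rw [adjacencyOperator_single, if_pos (by simpa using hw)]
    · intro w hw
      rw [adjacencyOperator_single, if_neg (by simpa using hw), inner_zero_right]
  exact congrArg (fun F => F ψ) key

variable (t : ℝ) (g : V → ℝ)

theorem mem_andersonOperator_domain (ψ : lp (fun _ : V => ℂ) 2) :
    ψ ∈ (andersonOperator Γ h t g).domain ↔ Memℓp (fun v => (g v : ℂ) * ψ v) 2 := Iff.rfl

theorem andersonOperator_apply (ψ : (andersonOperator Γ h t g).domain) (v : V) :
    andersonOperator Γ h t g ψ v =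
      -(t : ℂ) * ∑ w ∈ Γ.neighborFinset v, (ψ : lp (fun _ : V => ℂ) 2) w +
        g v * (ψ : lp (fun _ : V => ℂ) 2) v := rfl

theorem mem_domain_of_support_finite (ψ : lp (fun _ : V => ℂ) 2)
    (hψ : (Function.support ψ).Finite) : ψ ∈ (andersonOperator Γ h t g).domain := by
  rw [mem_andersonOperator_domain, memℓp_two_iff, tsum_eq_sum (s := hψ.toFinset)]
  · simp
  · intro v hv
    have : ψ v = 0 := by simpa using hv
    simp [this]

theorem single_mem_domain [DecidableEq V] (v : V) (a : ℂ) :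
    (lp.single 2 v a : lp (fun _ : V => ℂ) 2) ∈ (andersonOperator Γ h t g).domain := by
  refine mem_domain_of_support_finite Γ h t g _ ((Set.finite_singleton v).subset fun w hw => ?_)
  by_contra hne
  exact hw (lp.single_apply_ne (E := fun _ : V => ℂ) 2 v a hne)

theorem andersonOperator_symm (φ ψ : (andersonOperator Γ h t g).domain) :
    ⟪andersonOperator Γ h t g φ, (ψ : lp (fun _ : V => ℂ) 2)⟫_ℂ =
      ⟪(φ : lp (fun _ : V => ℂ) 2), andersonOperator Γ h t g ψ⟫_ℂ := by
  have e : ∀ χ : (andersonOperator Γ h t g).domain, andersonOperator Γ h t g χ =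
      -(t : ℂ) • adjacencyOperator Γ h χ + potentialOperator g χ := fun χ => rfl
  rw [e, e, inner_add_left, inner_add_right, inner_smul_left, inner_smul_right,
    adjacencyOperator_symm]
  congr 1
  · simp
  · rw [lp.inner_eq_tsum, lp.inner_eq_tsum]
    refine tsum_congr fun v => ?_
    change ⟪(g v : ℂ) * (φ : lp (fun _ : V => ℂ) 2) v, (ψ : lp (fun _ : V => ℂ) 2) v⟫_ℂ =
      ⟪(φ : lp (fun _ : V => ℂ) 2) v, (g v : ℂ) * (ψ : lp (fun _ : V => ℂ) 2) v⟫_ℂ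
    simp only [RCLike.inner_apply, map_mul, Complex.conj_ofReal]
    ring

theorem dense_domain : Dense ((andersonOperator Γ h t g).domain : Set (lp (fun _ : V => ℂ) 2)) := by
  classical
  intro ψ
  refine mem_closure_of_tendsto (lp.hasSum_single (by simp) ψ) (Eventually.of_forall fun s => ?_)
  exact Submodule.sum_mem _ fun v _ => single_mem_domain Γ h t g v _

/-- The Anderson operator is self-adjoint: the range of `H - z` is closed by the lower bound for
symmetric operators, and a vector orthogonal to it is an eigenvector of the symmetric operator `H`
at the nonreal value `z̄`, hence zero. -/
theorem hasResolvents_andersonOperator : HasResolvents (andersonOperator Γ h t g) := by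
  classical
  set H := andersonOperator Γ h t g with hH
  have hsymm := andersonOperator_symm Γ h t g
  refine ⟨dense_domain Γ h t g, hsymm, ?_⟩
  intro z hz
  let T : H.domain →ₗ[ℂ] lp (fun _ : V => ℂ) 2 := H.toFun - z • H.domain.subtype
  have hT : ∀ ψ : H.domain, T ψ = H ψ - z • (ψ : lp (fun _ : V => ℂ) 2) := fun ψ => rfl
  have hTv : ∀ (ψ : H.domain) (v : V), T ψ v =
      -(t : ℂ) * adjacencyOperator Γ h ψ v + g v * (ψ : lp (fun _ : V => ℂ) 2) v -
        z * (ψ : lp (fun _ : V => ℂ) 2) v := fun ψ v => rfl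
  have hzpos := abs_pos.2 hz
  have hclosed : IsClosed (LinearMap.range T : Set (lp (fun _ : V => ℂ) 2)) := by
    refine IsSeqClosed.isClosed fun f f₀ hf hlim => ?_
    choose ψ hψ using hf
    have hcauchy : CauchySeq fun n => (ψ n : lp (fun _ : V => ℂ) 2) := by
      refine Metric.cauchySeq_iff'.2 fun ε hε => ?_
      obtain ⟨N, hN⟩ := Metric.cauchySeq_iff'.1 hlim.cauchySeq (|z.im| * ε) (by positivity)
      refine ⟨N, fun n hn => ?_⟩
      have h1 := im_mul_norm_le_of_symm hsymm z (ψ n - ψ N)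
      have h2 : H (ψ n - ψ N) - z • ((ψ n - ψ N : H.domain) : lp (fun _ : V => ℂ) 2) =
          f n - f N := by
        rw [← hψ, ← hψ, ← map_sub]; rfl
      rw [h2] at h1
      have h3 := hN n hn
      rw [dist_eq_norm] at h3 ⊢
      exact lt_of_mul_lt_mul_left (h1.trans_lt h3) hzpos.le
    obtain ⟨ψ₀, hψ₀⟩ := cauchySeq_tendsto_of_complete hcauchy
    -- The limit lies in the domain, since the equation `g ψ = f + z ψ + t A ψ` passes to the limit
    -- pointwise and its right-hand side is in `ℓ²`.
    have hpt : ∀ {F : ℕ → lp (fun _ : V => ℂ) 2} {F₀ : lp (fun _ : V => ℂ) 2},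
        Tendsto F atTop (𝓝 F₀) → ∀ v, Tendsto (fun n => F n v) atTop (𝓝 (F₀ v)) := by
      intro F F₀ hF v
      rw [tendsto_iff_norm_sub_tendsto_zero] at hF ⊢
      refine squeeze_zero (fun n => norm_nonneg _) (fun n => ?_) hF
      exact lp.norm_apply_le_norm (by simp) (F n - F₀) v
    have hA : Tendsto (fun n => adjacencyOperator Γ h (ψ n)) atTop
        (𝓝 (adjacencyOperator Γ h ψ₀)) :=
      ((adjacencyCLM Γ h).continuous.tendsto ψ₀).comp hψ₀
    set F := f₀ + z • ψ₀ + (t : ℂ) • adjacencyOperator Γ h ψ₀ with hF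
    have hFv : ∀ v, F v = g v * ψ₀ v := by
      intro v
      have h1 : Tendsto (fun n => f n v + z * (ψ n : lp (fun _ : V => ℂ) 2) v +
          (t : ℂ) * adjacencyOperator Γ h (ψ n) v) atTop (𝓝 (F v)) :=
        ((hpt hlim v).add ((hpt hψ₀ v).const_mul z)).add ((hpt hA v).const_mul (t : ℂ))
      have h2 : Tendsto (fun n => (g v : ℂ) * (ψ n : lp (fun _ : V => ℂ) 2) v) atTop
          (𝓝 (g v * ψ₀ v)) := (hpt hψ₀ v).const_mul _
      refine tendsto_nhds_unique h1 (h2.congr fun n => ?_)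
      rw [← hψ n, hTv]
      ring
    have hdom : ψ₀ ∈ H.domain := by
      rw [hH, mem_andersonOperator_domain]
      have := lp.memℓp F
      rwa [funext hFv] at this
    refine ⟨⟨ψ₀, hdom⟩, ?_⟩
    ext v
    rw [hTv]
    change -(t : ℂ) * adjacencyOperator Γ h ψ₀ v + g v * ψ₀ v - z * ψ₀ v = f₀ v
    rw [← hFv, hF]
    change _ + (f₀ v + z * ψ₀ v + t * adjacencyOperator Γ h ψ₀ v) - _ = _
    ring
  have htop : LinearMap.range T = ⊤ := by
    have : CompleteSpace (LinearMap.range T) := hclosed.completeSpace_coe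
    rw [← Submodule.orthogonal_eq_bot_iff, Submodule.eq_bot_iff]
    intro χ hχ
    rw [Submodule.mem_orthogonal'] at hχ
    have hχv : ∀ v, (g v : ℂ) * χ v = conj z * χ v + t * adjacencyOperator Γ h χ v := by
      intro v
      have h1 := hχ _ ⟨⟨lp.single 2 v 1, single_mem_domain Γ h t g v 1⟩, rfl⟩
      have h2 : T ⟨lp.single 2 v 1, single_mem_domain Γ h t g v 1⟩ =
          -(t : ℂ) • adjacencyOperator Γ h (lp.single 2 v 1) +
            ((g v : ℂ) - z) • lp.single 2 v 1 := by
        ext w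
        rw [hTv]
        change _ = -(t : ℂ) * adjacencyOperator Γ h (lp.single 2 v 1) w +
          ((g v : ℂ) - z) * (lp.single 2 v (1 : ℂ) : lp (fun _ : V => ℂ) 2) w
        rcases eq_or_ne w v with rfl | hw
        · ring
        · change _ + (g w : ℂ) * (lp.single 2 v (1 : ℂ) : lp (fun _ : V => ℂ) 2) w -
            z * (lp.single 2 v (1 : ℂ) : lp (fun _ : V => ℂ) 2) w = _
          rw [lp.single_apply_ne 2 v _ hw]; ring
      rw [h2, inner_add_right, inner_smul_right, inner_smul_right, ← adjacencyOperator_symm,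
        lp.inner_single_right, lp.inner_single_right] at h1
      simp only [RCLike.inner_apply, one_mul] at h1
      have h3 := congrArg conj h1
      simp only [map_add, map_mul, map_neg, map_sub, map_zero, Complex.conj_ofReal,
        RCLike.conj_conj] at h3
      linear_combination h3
    have hdom : χ ∈ H.domain := by
      rw [hH, mem_andersonOperator_domain]
      have := lp.memℓp (conj z • χ + (t : ℂ) • adjacencyOperator Γ h χ)
      refine (congrArg (fun f => Memℓp f 2) (funext fun v => ?_)).mp this
      exact (hχv v).symm
    have h4 := im_mul_norm_le_of_symm hsymm (conj z) ⟨χ, hdom⟩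
    have h5 : H ⟨χ, hdom⟩ - conj z • χ = 0 := by
      ext v
      change -(t : ℂ) * adjacencyOperator Γ h χ v + g v * χ v - conj z * χ v = 0
      rw [hχv]; ring
    rw [h5, norm_zero, Complex.conj_im, abs_neg] at h4
    have h6 : ‖χ‖ ≤ 0 := le_of_mul_le_mul_left (by simpa using h4) hzpos
    exact norm_le_zero_iff.1 h6
  intro f
  have : f ∈ LinearMap.range T := htop ▸ Submodule.mem_top
  obtain ⟨ψ, hψ⟩ := this
  exact ⟨ψ, hψ⟩

end AndersonOperator
end
end BetheAnderson

namespace BetheAnderson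

noncomputable section

open scoped InnerProductSpace ComplexConjugate ENNReal

/-! ### Locality of the resolvent at the root -/

/-- Distance to the root of the Bethe lattice. -/
def depth {d : ℕ} : BetheVertex d → ℕ
  | none => 0
  | some (_, l) => l.length + 1

theorem IsChild.depth_eq {d : ℕ} {x y : BetheVertex d} (h : IsChild x y) :
    depth y = depth x + 1 := by
  cases h <;> rfl

theorem depth_adj {d : ℕ} {x y : BetheVertex d} (h : (betheLattice d).Adj x y) :
    depth y = depth x + 1 ∨ depth x = depth y + 1 :=
  (betheLattice_adj.1 h).imp IsChild.depth_eq IsChild.depth_eq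

theorem depth_eq_zero {d : ℕ} {x : BetheVertex d} (h : depth x = 0) : x = none := by
  rcases x with _ | ⟨a, l⟩
  · rfl
  · simp [depth] at h

theorem finite_depth_le (d R : ℕ) : {x : BetheVertex d | depth x ≤ R}.Finite := by
  have h1 : (insert none ((fun p : Fin d × List (Fin (d - 1)) => (some p : BetheVertex d)) ''
      (Set.univ ×ˢ {l : List (Fin (d - 1)) | l.length ≤ R}))).Finite :=
    ((Set.finite_univ.prod (List.finite_length_le _ R)).image _).insert _
  refine h1.subset ?_
  rintro (_ | ⟨a, l⟩) hx
  · exact Set.mem_insert _ _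
  · refine Set.mem_insert_of_mem _ ⟨(a, l), ⟨Set.mem_univ _, ?_⟩, rfl⟩
    simp only [depth, Set.mem_ofPred_eq] at hx ⊢
    omega

/-- The ball of radius `R` around the root. -/
def treeBall (d R : ℕ) : Finset (BetheVertex d) := (finite_depth_le d R).toFinset

theorem mem_treeBall {d R : ℕ} {x : BetheVertex d} : x ∈ treeBall d R ↔ depth x ≤ R := by
  simp [treeBall]

section Vertex

variable {V : Type*} [DecidableEq V] (Γ : SimpleGraph V) [Γ.LocallyFinite] {d : ℕ}
  (h : ∀ v, Γ.degree v ≤ d) (t : ℝ) (g : V → ℝ) {z : ℂ} (hz : z.im ≠ 0)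

/-- The column `(H - z)⁻¹ δ_v` of the resolvent of an Anderson operator. -/
def greenColumn (v : V) : (andersonOperator Γ h t g).domain :=
  (hasResolvents_andersonOperator Γ h t g).solve hz (lp.single 2 v 1)

theorem greenColumn_spec (v : V) : andersonOperator Γ h t g (greenColumn Γ h t g hz v) -
    z • (greenColumn Γ h t g hz v : lp (fun _ : V => ℂ) 2) = lp.single 2 v 1 :=
  (hasResolvents_andersonOperator Γ h t g).solve_spec hz _

theorem greenColumn_eq (v w : V) :
    -(t : ℂ) * ∑ y ∈ Γ.neighborFinset w,
        (greenColumn Γ h t g hz v : lp (fun _ : V => ℂ) 2) y +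
      (g w - z) * (greenColumn Γ h t g hz v : lp (fun _ : V => ℂ) 2) w =
      if w = v then 1 else 0 := by
  have h1 := congrArg (fun f : lp (fun _ : V => ℂ) 2 => f w) (greenColumn_spec Γ h t g hz v)
  have h2 : (lp.single 2 v (1 : ℂ) : lp (fun _ : V => ℂ) 2) w = if w = v then 1 else 0 := by
    rw [lp.coeFn_single, Pi.single_apply]
  rw [← h2, ← h1]
  change _ = andersonOperator Γ h t g (greenColumn Γ h t g hz v) w -
    z * (greenColumn Γ h t g hz v : lp (fun _ : V => ℂ) 2) w
  rw [andersonOperator_apply]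
  ring

theorem norm_greenColumn_le (v : V) :
    ‖(greenColumn Γ h t g hz v : lp (fun _ : V => ℂ) 2)‖ ≤ 1 / |z.im| := by
  have h1 := im_mul_norm_le_of_symm (andersonOperator_symm Γ h t g) z (greenColumn Γ h t g hz v)
  rw [greenColumn_spec, lp.norm_single (by norm_num), norm_one] at h1
  rw [le_div_iff₀ (abs_pos.2 hz), mul_comm]
  exact h1

/-- An approximate solution of the resolvent equation is close to the exact one. -/
theorem norm_sub_greenColumn_le (v : V) (u : (andersonOperator Γ h t g).domain) :
    ‖(u : lp (fun _ : V => ℂ) 2) v - (greenColumn Γ h t g hz v : lp (fun _ : V => ℂ) 2) v‖ ≤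
      ‖andersonOperator Γ h t g u - z • (u : lp (fun _ : V => ℂ) 2) - lp.single 2 v 1‖ /
        |z.im| := by
  rw [le_div_iff₀ (abs_pos.2 hz), mul_comm]
  have h1 := im_mul_norm_le_of_symm (andersonOperator_symm Γ h t g) z
    (u - greenColumn Γ h t g hz v)
  have h2 : andersonOperator Γ h t g (u - greenColumn Γ h t g hz v) -
      z • ((u - greenColumn Γ h t g hz v : (andersonOperator Γ h t g).domain) :
        lp (fun _ : V => ℂ) 2) =
      andersonOperator Γ h t g u - z • (u : lp (fun _ : V => ℂ) 2) - lp.single 2 v 1 := by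
    rw [← greenColumn_spec Γ h t g hz v, LinearPMap.map_sub, Submodule.coe_sub, smul_sub]
    abel
  rw [h2] at h1
  refine le_trans ?_ h1
  gcongr
  exact lp.norm_apply_le_norm (by simp) ((u : lp (fun _ : V => ℂ) 2) -
    (greenColumn Γ h t g hz v : lp (fun _ : V => ℂ) 2)) v

end Vertex

section Tree

variable (d : ℕ) (t : ℝ) {z : ℂ} (hz : z.im ≠ 0)

/-- The diagonal resolvent element `⟨δ₀, (H - z)⁻¹ δ₀⟩` at the root of the Bethe lattice. -/
def treeGreen (h : BetheVertex d → ℝ) : ℂ :=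
  (greenColumn (betheLattice d) (fun v => (betheLattice_isRegular d v).le) t h hz none :
    lp (fun _ : BetheVertex d => ℂ) 2) none

theorem norm_treeGreen_le (h : BetheVertex d → ℝ) : ‖treeGreen d t hz h‖ ≤ 1 / |z.im| :=
  (lp.norm_apply_le_norm (by simp) _ _).trans (norm_greenColumn_le _ _ _ _ hz _)

/-- A function that solves the resolvent equation on the ball of radius `R` only, and is
square-summable there, has almost the right value at the root. The proof multiplies it by the
cutoff `max 0 (1 - depth / R)`, whose commutator with the adjacency operator is `O(1/R)`. -/
theorem norm_sub_treeGreen_le (h : BetheVertex d → ℝ) {R : ℕ} (hR : 0 < R) {M : ℝ} (hM : 0 ≤ M)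
    (φ : BetheVertex d → ℂ)
    (hφM : ∑ x ∈ treeBall d R, ‖φ x‖ ^ 2 ≤ M ^ 2)
    (hφ : ∀ x, depth x ≤ R → -(t : ℂ) * ∑ y ∈ (betheLattice d).neighborFinset x, φ y +
      (h x - z) * φ x = if x = none then 1 else 0) :
    ‖φ none - treeGreen d t hz h‖ ≤ |t| * d * M / (R * |z.im|) := by
  have hR' : (0 : ℝ) < R := by exact_mod_cast hR
  set χ : BetheVertex d → ℝ := fun x => max 0 (1 - depth x / R) with hχ
  have hχ0 : ∀ x, R ≤ depth x → χ x = 0 := by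
    intro x hx
    have : (R : ℝ) ≤ depth x := by exact_mod_cast hx
    have : 1 ≤ (depth x : ℝ) / R := by rwa [le_div_iff₀ hR', one_mul]
    exact max_eq_left (by linarith)
  have hχroot : χ none = 1 := by simp [hχ, depth]
  have hχadj : ∀ x y, (betheLattice d).Adj x y → |χ y - χ x| ≤ 1 / R := by
    intro x y hxy
    have h1 : |χ y - χ x| ≤ |(1 - (depth y : ℝ) / R) - (1 - depth x / R)| := by
      simp only [hχ, max_comm (0 : ℝ)]
      exact abs_max_sub_max_le_abs _ _ _
    refine h1.trans (le_of_eq ?_)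
    rcases depth_adj hxy with e | e
    · rw [e]; push_cast
      rw [show (1 - ((depth x : ℝ) + 1) / R) - (1 - depth x / R) = -(1 / R) by ring, abs_neg,
        abs_of_pos (by positivity)]
    · rw [e]; push_cast
      rw [show (1 - (depth y : ℝ) / R) - (1 - ((depth y : ℝ) + 1) / R) = 1 / R by ring,
        abs_of_pos (by positivity)]
  set φR : BetheVertex d → ℂ := fun x => if depth x ≤ R then φ x else 0 with hφR
  -- The function `χ φ` is finitely supported, hence in the domain of `H`.
  have hsupp : (Function.support fun x => (χ x : ℂ) * φ x).Finite := by
    refine (finite_depth_le d R).subset fun x hx => ?_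
    by_contra hne
    simp only [Set.mem_ofPred_eq, not_le] at hne
    exact hx (by simp [hχ0 x hne.le])
  have hmem : Memℓp (fun x => (χ x : ℂ) * φ x) 2 := by
    rw [memℓp_two_iff, tsum_eq_sum (s := hsupp.toFinset)]
    · simp
    · intro v hv
      have : (χ v : ℂ) * φ v = 0 := by
        by_contra hne
        exact hv (hsupp.mem_toFinset.2 hne)
      simp [this]
  set H := andersonOperator (betheLattice d) (fun v => (betheLattice_isRegular d v).le) t h with hH
  let u : H.domain := ⟨⟨_, hmem⟩, mem_domain_of_support_finite _ _ _ _ ⟨_, hmem⟩ hsupp⟩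
  have hu : ∀ x, (u : lp (fun _ : BetheVertex d => ℂ) 2) x = χ x * φ x := fun x => rfl
  -- The error is a commutator term. Replacing `φ` by `φR` there is free: if `y` has depth
  -- above `R`, then `χ` vanishes at `y` and at its neighbours.
  have herr : ∀ x, (H u - z • (u : lp (fun _ : BetheVertex d => ℂ) 2) - lp.single 2 none 1 :
      lp (fun _ : BetheVertex d => ℂ) 2) x = ∑ y ∈ (betheLattice d).neighborFinset x,
      (-(t : ℂ) * ((χ y - χ x : ℝ) : ℂ)) * φR y := by
    intro x
    have h1 : (H u - z • (u : lp (fun _ : BetheVertex d => ℂ) 2) - lp.single 2 none 1 :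
      lp (fun _ : BetheVertex d => ℂ) 2) x =
      -(t : ℂ) * ∑ y ∈ (betheLattice d).neighborFinset x, (χ y : ℂ) * φ y +
        (h x - z) * (χ x * φ x) - if x = none then 1 else 0 := by
      have h2 : (lp.single 2 none (1 : ℂ) : lp (fun _ : BetheVertex d => ℂ) 2) x =
          if x = none then 1 else 0 := by
        rw [lp.coeFn_single, Pi.single_apply]
      rw [← h2]
      change H u x - z * (u : lp (fun _ : BetheVertex d => ℂ) 2) x - _ = _
      have h5 : H u x = _ := andersonOperator_apply _ _ t h u x
      rw [h5]
      simp only [hu]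
      ring
    rw [h1]
    have h3 : ∀ y ∈ (betheLattice d).neighborFinset x,
        (-(t : ℂ) * ((χ y - χ x : ℝ) : ℂ)) * φR y =
        -(t : ℂ) * ((χ y : ℂ) * φ y) + χ x * (t * φ y) := by
      intro y hy
      have hxy : (betheLattice d).Adj x y := by simpa using hy
      by_cases hyR : depth y ≤ R
      · simp only [hφR, if_pos hyR]; push_cast; ring
      · have hx0 : χ x = 0 := hχ0 x (by have := depth_adj hxy; omega)
        have hy0 : χ y = 0 := hχ0 y (by omega)
        simp [hx0, hy0]
    rw [Finset.sum_congr rfl h3, Finset.sum_add_distrib, ← Finset.mul_sum, ← Finset.mul_sum,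
      ← Finset.mul_sum]
    by_cases hx : depth x ≤ R
    · have h4 := hφ x hx
      by_cases hx0 : x = none
      · subst hx0
        rw [if_pos rfl] at h4 ⊢
        rw [hχroot]
        push_cast
        linear_combination h4
      · rw [if_neg hx0] at h4 ⊢
        linear_combination (χ x : ℂ) * h4
    · have hx0 : x ≠ none := by
        rintro rfl; exact hx (Nat.zero_le _)
      rw [hχ0 x (by omega), if_neg hx0]
      simp
  have hbound : ‖H u - z • (u : lp (fun _ : BetheVertex d => ℂ) 2) - lp.single 2 none 1‖ ≤
      |t| * (1 / R) * d * M := by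
    have h1 := tsum_norm_sq_hopping_le (betheLattice d)
      (fun v => (betheLattice_isRegular d v).le) (fun x y => -(t : ℂ) * ((χ y - χ x : ℝ) : ℂ))
      (κ := |t| * (1 / R)) (by
        intro x y hxy
        rw [norm_mul, norm_neg, Complex.norm_real, Complex.norm_real, Real.norm_eq_abs,
          Real.norm_eq_abs]
        gcongr
        exact hχadj x y hxy) φR
    have h2 : ∑' x, ENNReal.ofReal (‖φR x‖ ^ 2) ≤ ENNReal.ofReal (M ^ 2) := by
      rw [tsum_eq_sum (s := treeBall d R)]
      · rw [← ENNReal.ofReal_sum_of_nonneg (fun _ _ => by positivity)]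
        refine ENNReal.ofReal_le_ofReal (le_trans (le_of_eq ?_) hφM)
        refine Finset.sum_congr rfl fun x hx => ?_
        rw [mem_treeBall] at hx
        simp only [hφR, if_pos hx]
      · intro x hx
        rw [mem_treeBall] at hx
        simp [hφR, hx]
    refine (sq_le_sq₀ (norm_nonneg _) (by positivity)).1 ?_
    rw [← ENNReal.ofReal_le_ofReal_iff (by positivity), ofReal_norm_sq_eq_tsum]
    simp_rw [herr]
    refine (h1.trans (mul_le_mul_right h2 _)).trans (le_of_eq ?_)
    rw [← ENNReal.ofReal_mul (by positivity), mul_pow (_ * (d : ℝ))]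
  have hfin := norm_sub_greenColumn_le (betheLattice d)
    (fun v => (betheLattice_isRegular d v).le) t h hz none u
  rw [hu, hχroot, Complex.ofReal_one, one_mul] at hfin
  refine hfin.trans ?_
  have : |t| * d * M / (R * |z.im|) = (|t| * (1 / R) * d * M) / |z.im| := by
    field_simp
  rw [this]
  gcongr

theorem sum_norm_sq_le {V : Type*} (f : lp (fun _ : V => ℂ) 2) (s : Finset V) :
    ∑ v ∈ s, ‖f v‖ ^ 2 ≤ ‖f‖ ^ 2 := by
  rw [← ENNReal.ofReal_le_ofReal_iff (by positivity), ofReal_norm_sq_eq_tsum,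
    ENNReal.ofReal_sum_of_nonneg (fun _ _ => by positivity)]
  exact ENNReal.sum_le_tsum s

/-- The resolvent at the root depends little on the potential outside a large ball. -/
theorem norm_treeGreen_sub_le {h h' : BetheVertex d → ℝ} {R : ℕ} (hR : 0 < R)
    (hh : ∀ x, depth x ≤ R → h x = h' x) :
    ‖treeGreen d t hz h' - treeGreen d t hz h‖ ≤ |t| * d * (1 / |z.im|) / (R * |z.im|) := by
  refine norm_sub_treeGreen_le d t hz h hR (by positivity)
    (fun x => (greenColumn (betheLattice d) (fun v => (betheLattice_isRegular d v).le) t h' hz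
      none : lp (fun _ : BetheVertex d => ℂ) 2) x) ?_ ?_
  · refine (sum_norm_sq_le _ _).trans ?_
    gcongr
    exact norm_greenColumn_le _ _ _ _ hz _
  · intro x hx
    rw [hh x hx]
    exact greenColumn_eq _ _ _ _ hz _ _

/-- The resolvent at the root of a graph agrees approximately with the resolvent at the root of the
Bethe lattice when a covering map is injective on a large ball and matches the potentials there. -/
theorem norm_greenColumn_sub_treeGreen_le {V : Type*} [DecidableEq V] (Γ : SimpleGraph V)
    [Γ.LocallyFinite] (hΓ : ∀ v, Γ.degree v ≤ d) (g : V → ℝ) {h : BetheVertex d → ℝ}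
    (p : BetheVertex d → V) {R : ℕ} (hR : 0 < R)
    (hcov : ∀ x, Set.BijOn p ((betheLattice d).neighborSet x) (Γ.neighborSet (p x)))
    (hinj : Set.InjOn p {x | depth x ≤ R}) (hh : ∀ x, depth x ≤ R → h x = g (p x)) :
    ‖(greenColumn Γ hΓ t g hz (p none) : lp (fun _ : V => ℂ) 2) (p none) - treeGreen d t hz h‖ ≤
      |t| * d * (1 / |z.im|) / (R * |z.im|) := by
  set φ : lp (fun _ : V => ℂ) 2 := (greenColumn Γ hΓ t g hz (p none)).1 with hφ
  refine norm_sub_treeGreen_le d t hz h hR (by positivity) (fun x => φ (p x)) ?_ ?_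
  · have h1 : ∑ x ∈ treeBall d R, ‖φ (p x)‖ ^ 2 = ∑ v ∈ (treeBall d R).image p, ‖φ v‖ ^ 2 := by
      rw [Finset.sum_image fun x hx y hy hxy => hinj (mem_treeBall.1 hx) (mem_treeBall.1 hy) hxy]
    rw [h1]
    refine (sum_norm_sq_le _ _).trans ?_
    gcongr
    exact norm_greenColumn_le _ _ _ _ hz _
  · intro x hx
    have h1 : ∑ y ∈ (betheLattice d).neighborFinset x, φ (p y) =
        ∑ w ∈ Γ.neighborFinset (p x), φ w := by
      refine Finset.sum_nbij p ?_ ?_ ?_ (fun _ _ => rfl)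
      · intro y hy
        have := (hcov x).mapsTo (by simpa using hy)
        simpa using this
      · have := (hcov x).injOn
        simpa using this
      · have := (hcov x).surjOn
        simpa using this
    rw [h1, hh x hx]
    have h2 := greenColumn_eq Γ hΓ t g hz (p none) (p x)
    rw [← hφ] at h2
    rw [h2]
    have h3 : p x = p none ↔ x = none :=
      ⟨fun e => hinj hx (Nat.zero_le R) e, fun e => by rw [e]⟩
    simp only [h3]

/-- The resolvent at the root is Lipschitz in the potential, for the uniform norm. -/
theorem norm_treeGreen_sub_le_of_abs_sub_le {h h' : BetheVertex d → ℝ} {δ : ℝ}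
    (hh : ∀ x, |h x - h' x| ≤ δ) :
    ‖treeGreen d t hz h' - treeGreen d t hz h‖ ≤ δ * (1 / |z.im|) / |z.im| := by
  have hδ : 0 ≤ δ := (abs_nonneg _).trans (hh none)
  set ψ := greenColumn (betheLattice d) (fun v => (betheLattice_isRegular d v).le) t h' hz none
    with hψ
  have hle : ∀ x, ENNReal.ofReal (‖((h x - h' x : ℝ) : ℂ) *
      (ψ : lp (fun _ : BetheVertex d => ℂ) 2) x‖ ^ 2) ≤
      ENNReal.ofReal (δ ^ 2) * ENNReal.ofReal (‖(ψ : lp (fun _ : BetheVertex d => ℂ) 2) x‖ ^ 2) := by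
    intro x
    rw [← ENNReal.ofReal_mul (by positivity)]
    refine ENNReal.ofReal_le_ofReal ?_
    rw [norm_mul, mul_pow, Complex.norm_real, Real.norm_eq_abs]
    gcongr
    exact hh x
  have hsum := ENNReal.tsum_le_tsum hle
  rw [ENNReal.tsum_mul_left, ← ofReal_norm_sq_eq_tsum, ← ENNReal.ofReal_mul (by positivity)] at hsum
  have hmem : Memℓp (fun x => ((h x - h' x : ℝ) : ℂ) *
      (ψ : lp (fun _ : BetheVertex d => ℂ) 2) x) 2 := by
    rw [memℓp_two_iff]
    exact ne_top_of_le_ne_top ENNReal.ofReal_ne_top hsum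
  have hdom : (ψ : lp (fun _ : BetheVertex d => ℂ) 2) ∈ (andersonOperator (betheLattice d)
      (fun v => (betheLattice_isRegular d v).le) t h).domain := by
    rw [mem_andersonOperator_domain]
    refine (congrArg (fun f => Memℓp f 2) (funext fun x => ?_)).mp (hmem.add ψ.2)
    change ((h x - h' x : ℝ) : ℂ) * (ψ : lp (fun _ : BetheVertex d => ℂ) 2) x +
      (h' x : ℂ) * (ψ : lp (fun _ : BetheVertex d => ℂ) 2) x = _
    push_cast; ring
  have h1 := norm_sub_greenColumn_le (betheLattice d) (fun v => (betheLattice_isRegular d v).le) t h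
    hz none ⟨ψ, hdom⟩
  refine h1.trans ?_
  gcongr
  have h2 : andersonOperator (betheLattice d) (fun v => (betheLattice_isRegular d v).le) t h
      ⟨ψ, hdom⟩ - z • (ψ : lp (fun _ : BetheVertex d => ℂ) 2) - lp.single 2 none 1 =
      (⟨_, hmem⟩ : lp (fun _ : BetheVertex d => ℂ) 2) := by
    rw [← greenColumn_spec (betheLattice d) (fun v => (betheLattice_isRegular d v).le) t h' hz none]
    ext x
    change andersonOperator (betheLattice d) (fun v => (betheLattice_isRegular d v).le) t h
      ⟨ψ, hdom⟩ x - z * (ψ : lp (fun _ : BetheVertex d => ℂ) 2) x -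
      (andersonOperator (betheLattice d) (fun v => (betheLattice_isRegular d v).le) t h' ψ x -
      z * (ψ : lp (fun _ : BetheVertex d => ℂ) 2) x) =
      ((h x - h' x : ℝ) : ℂ) * (ψ : lp (fun _ : BetheVertex d => ℂ) 2) x
    rw [andersonOperator_apply, andersonOperator_apply]
    push_cast; ring
  change ‖andersonOperator (betheLattice d) (fun v => (betheLattice_isRegular d v).le) t h
      ⟨ψ, hdom⟩ - z • (ψ : lp (fun _ : BetheVertex d => ℂ) 2) - lp.single 2 none 1‖ ≤ _
  rw [h2]
  refine (sq_le_sq₀ (norm_nonneg _) (by positivity)).1 ?_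
  rw [← ENNReal.ofReal_le_ofReal_iff (by positivity), ofReal_norm_sq_eq_tsum]
  refine hsum.trans (ENNReal.ofReal_le_ofReal ?_)
  rw [mul_pow]
  gcongr
  exact norm_greenColumn_le _ _ _ _ hz _

end Tree
end
end BetheAnderson

namespace BetheAnderson

noncomputable section

/-! ### The universal covering of a regular graph -/

section Covering

variable {V : Type*}

/-- An enumeration of a finset by `Fin k`, meaningful if the finset has `k` elements (otherwise the
value is the default `v`). -/
def enumFinset (s : Finset V) (k : ℕ) (v : V) (i : Fin k) : V :=
  if h : s.card = k then ((s.equivFinOfCardEq h).symm i : V) else v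

theorem enumFinset_mem {s : Finset V} {k : ℕ} (h : s.card = k) (v : V) (i : Fin k) :
    enumFinset s k v i ∈ s := by
  rw [enumFinset, dif_pos h]
  exact Subtype.prop _

theorem enumFinset_injective {s : Finset V} {k : ℕ} (h : s.card = k) (v : V) :
    Function.Injective (enumFinset s k v) := by
  intro i j hij
  rw [enumFinset, enumFinset, dif_pos h, dif_pos h] at hij
  exact (s.equivFinOfCardEq h).symm.injective (Subtype.ext hij)

theorem exists_enumFinset_eq {s : Finset V} {k : ℕ} (h : s.card = k) (v : V) {w : V} (hw : w ∈ s) :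
    ∃ i, enumFinset s k v i = w :=
  ⟨s.equivFinOfCardEq h ⟨w, hw⟩, by rw [enumFinset, dif_pos h]; simp⟩

variable [DecidableEq V] (Γ : SimpleGraph V) [Γ.LocallyFinite] {d : ℕ}

/-- The images under the covering map of the vertex `some (a, l)` and of its parent. -/
def coveringPair (v : V) (a : Fin d) : List (Fin (d - 1)) → V × V
  | [] => (enumFinset (Γ.neighborFinset v) d v a, v)
  | b :: l => (enumFinset ((Γ.neighborFinset (coveringPair v a l).1).erase (coveringPair v a l).2)
      (d - 1) v b, (coveringPair v a l).1)

/-- The covering map from the Bethe lattice to a `d`-regular graph with `0 ↦ v`: the children of a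
vertex are mapped to the neighbours of its image other than the image of its parent. -/
def coveringMap (v : V) : BetheVertex d → V
  | none => v
  | some (a, l) => (coveringPair Γ v a l).1

theorem coveringPair_snd (v : V) (a : Fin d) (l : List (Fin (d - 1))) {p : BetheVertex d}
    (hp : IsChild p (some (a, l))) : (coveringPair Γ v a l).2 = coveringMap Γ v p := by
  cases hp <;> rfl

variable (hΓ : ∀ v, Γ.degree v = d)

include hΓ in
theorem adj_coveringPair (v : V) (a : Fin d) (l : List (Fin (d - 1))) :
    Γ.Adj (coveringPair Γ v a l).1 (coveringPair Γ v a l).2 := by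
  induction l with
  | nil =>
    have := enumFinset_mem (hΓ v) v a
    rw [SimpleGraph.mem_neighborFinset] at this
    exact this.symm
  | cons b l ih =>
    have hcard : ((Γ.neighborFinset (coveringPair Γ v a l).1).erase
        (coveringPair Γ v a l).2).card = d - 1 := by
      rw [Finset.card_erase_of_mem (by simpa using ih)]
      congr 1
      exact hΓ _
    have := Finset.mem_of_mem_erase (enumFinset_mem hcard v b)
    rw [SimpleGraph.mem_neighborFinset] at this
    exact this.symm

include hΓ in
/-- The covering map is a local isomorphism. -/
theorem coveringMap_bijOn (v : V) (x : BetheVertex d) :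
    Set.BijOn (coveringMap Γ v) ((betheLattice d).neighborSet x)
      (Γ.neighborSet (coveringMap Γ v x)) := by
  rcases x with _ | ⟨a, l⟩
  · rw [neighborSet_root]
    refine ⟨?_, ?_, ?_⟩
    · rintro _ ⟨a, rfl⟩
      exact (SimpleGraph.mem_neighborFinset _ _ _).1 (enumFinset_mem (hΓ v) v a)
    · rintro _ ⟨a, rfl⟩ _ ⟨b, rfl⟩ hab
      rw [enumFinset_injective (hΓ v) v hab]
    · intro w hw
      obtain ⟨i, hi⟩ := exists_enumFinset_eq (hΓ v) v ((SimpleGraph.mem_neighborFinset _ _ _).2 hw)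
      exact ⟨_, ⟨i, rfl⟩, hi⟩
  · obtain ⟨p, hp⟩ := exists_parent a l
    rw [neighborSet_some a l p hp]
    have hadj := adj_coveringPair Γ hΓ v a l
    have hp' := coveringPair_snd Γ v a l hp
    have hcard : ((Γ.neighborFinset (coveringPair Γ v a l).1).erase
        (coveringPair Γ v a l).2).card = d - 1 := by
      rw [Finset.card_erase_of_mem (by simpa using hadj)]
      congr 1
      exact hΓ _
    have hmem : ∀ b : Fin (d - 1), coveringMap Γ v (some (a, b :: l)) ∈
        (Γ.neighborFinset (coveringPair Γ v a l).1).erase (coveringPair Γ v a l).2 :=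
      fun b => enumFinset_mem hcard v b
    have hne : ∀ b : Fin (d - 1), coveringMap Γ v (some (a, b :: l)) ≠ coveringMap Γ v p :=
      fun b => hp' ▸ Finset.ne_of_mem_erase (hmem b)
    refine ⟨?_, ?_, ?_⟩
    · rintro _ (rfl | ⟨b, rfl⟩)
      · rw [← hp']; exact hadj
      · have := Finset.mem_of_mem_erase (hmem b)
        rwa [SimpleGraph.mem_neighborFinset] at this
    · rintro _ (rfl | ⟨b, rfl⟩) _ (rfl | ⟨c, rfl⟩) hbc
      · rfl
      · exact (hne c hbc.symm).elim
      · exact (hne b hbc).elim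
      · rw [enumFinset_injective hcard v hbc]
    · intro w hw
      by_cases hwp : w = coveringMap Γ v p
      · exact ⟨p, Or.inl rfl, hwp.symm⟩
      · obtain ⟨i, hi⟩ := exists_enumFinset_eq hcard v (w := w) (by
          rw [Finset.mem_erase, hp']
          exact ⟨hwp, (SimpleGraph.mem_neighborFinset _ _ _).2 hw⟩)
        exact ⟨_, Or.inr ⟨i, rfl⟩, hi⟩

end Covering

/-! ### Short cycles and injectivity of the covering map -/

section ShortCycle

variable {V : Type*}

/-- The edge `{u, w}` lies on a closed walk of length at most `L + 1` that uses it only once. -/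
def IsShortCycleEdge (Γ : SimpleGraph V) (L : ℕ) (u w : V) : Prop :=
  Γ.Adj u w ∧ ∃ p : Γ.Walk u w, p.length ≤ L ∧ s(u, w) ∉ p.edges

variable {Γ : SimpleGraph V} {d : ℕ} {f : BetheVertex d → V}
  (hf : ∀ x, Set.BijOn f ((betheLattice d).neighborSet x) (Γ.neighborSet (f x)))

include hf in
theorem adj_of_isChild {x y : BetheVertex d} (h : IsChild x y) : Γ.Adj (f x) (f y) :=
  (hf x).mapsTo (betheLattice_adj.2 (Or.inl h))

include hf in
/-- The image of the path from the root to `x`, with a description of its edges. -/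
theorem exists_walk_of_depth (x : BetheVertex d) : ∃ p : Γ.Walk (f none) (f x),
    p.length = depth x ∧ ∀ e ∈ p.edges, ∃ y' y, IsChild y' y ∧ depth y ≤ depth x ∧
      (depth y = depth x → y = x) ∧ e = s(f y', f y) := by
  have hstep : ∀ {q x : BetheVertex d}, IsChild q x →
      (∃ p : Γ.Walk (f none) (f q), p.length = depth q ∧ ∀ e ∈ p.edges, ∃ y' y, IsChild y' y ∧
        depth y ≤ depth q ∧ (depth y = depth q → y = q) ∧ e = s(f y', f y)) →
      ∃ p : Γ.Walk (f none) (f x), p.length = depth x ∧ ∀ e ∈ p.edges, ∃ y' y, IsChild y' y ∧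
        depth y ≤ depth x ∧ (depth y = depth x → y = x) ∧ e = s(f y', f y) := by
    rintro q x hqx ⟨p, hp, he⟩
    have hd := hqx.depth_eq
    refine ⟨p.concat (adj_of_isChild hf hqx), by rw [SimpleGraph.Walk.length_concat, hp, hd], ?_⟩
    intro e hmem
    rw [SimpleGraph.Walk.edges_concat, List.concat_eq_append, List.mem_append,
      List.mem_singleton] at hmem
    rcases hmem with hmem | rfl
    · obtain ⟨y', y, h1, h2, -, h4⟩ := he e hmem
      exact ⟨y', y, h1, by omega, fun h => by omega, h4⟩
    · exact ⟨q, x, hqx, le_rfl, fun _ => rfl, rfl⟩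
  rcases x with _ | ⟨a, l⟩
  · exact ⟨SimpleGraph.Walk.nil, rfl, by simp⟩
  · induction l with
    | nil => exact hstep (.root a) ⟨SimpleGraph.Walk.nil, rfl, by simp⟩
    | cons b l ih => exact hstep (.step a b l) ih

include hf in
/-- A covering map is locally injective. -/
theorem eq_of_adj_of_eq {x y y' : BetheVertex d} (h : (betheLattice d).Adj x y)
    (h' : (betheLattice d).Adj x y') (he : f y = f y') : y = y' :=
  (hf x).injOn h h' he

include hf in
/-- If the covering map is not injective on the ball of radius `R`, then there is a short cycle
close to the image of the root. The cycle is found at the smallest radius at which injectivity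
fails. -/
theorem exists_isShortCycleEdge_of_not_injOn {R : ℕ} (hR : ¬ Set.InjOn f {x | depth x ≤ R}) :
    ∃ u w, IsShortCycleEdge Γ (2 * R) u w ∧ ∃ q : Γ.Walk u (f none), q.length ≤ R := by
  classical
  have hex : ∃ k, ¬ Set.InjOn f {x : BetheVertex d | depth x ≤ k} := ⟨R, hR⟩
  set k := Nat.find hex with hk
  have hkR : k ≤ R := Nat.find_min' hex hR
  have hkno : ¬ Set.InjOn f {x : BetheVertex d | depth x ≤ k} := Nat.find_spec hex
  have hkpos : 0 < k := by
    rcases Nat.eq_zero_or_pos k with h0 | h0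
    · exfalso
      rw [h0] at hkno
      refine hkno fun x hx y hy _ => ?_
      rw [depth_eq_zero (Nat.le_zero.1 hx), depth_eq_zero (Nat.le_zero.1 hy)]
    · exact h0
  have hinj : ∀ x y : BetheVertex d, depth x < k → depth y < k → f x = f y → x = y := by
    have h1 : Set.InjOn f {x : BetheVertex d | depth x ≤ k - 1} := by
      by_contra h
      have := Nat.find_min' hex h
      omega
    intro x y hx hy hxy
    exact h1 (by simp only [Set.mem_ofPred_eq]; omega) (by simp only [Set.mem_ofPred_eq]; omega) hxy
  obtain ⟨x, y, hxk, hyk, hxy, hne⟩ : ∃ x y : BetheVertex d, depth x = k ∧ depth y ≤ k ∧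
      f x = f y ∧ x ≠ y := by
    simp only [Set.InjOn, not_forall] at hkno
    obtain ⟨x, hx, y, hy, hxy, hne⟩ := hkno
    simp only [Set.mem_ofPred_eq] at hx hy
    -- One of two points with the same image is at distance exactly `k`.
    by_cases hxk : depth x = k
    · exact ⟨x, y, hxk, hy, hxy, hne⟩
    · by_cases hyk : depth y = k
      · exact ⟨y, x, hyk, hx, hxy.symm, Ne.symm hne⟩
      · exact (hne (hinj x y (by omega) (by omega) hxy)).elim
  obtain ⟨q, hq⟩ : ∃ q, IsChild q x := by
    rcases x with _ | ⟨a, l⟩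
    · simp only [depth] at hxk; omega
    · exact exists_parent a l
  have hqd := hq.depth_eq
  have hqx : (betheLattice d).Adj q x := betheLattice_adj.2 (Or.inl hq)
  obtain ⟨p₁, hp₁, he₁⟩ := exists_walk_of_depth hf q
  obtain ⟨p₂, hp₂, he₂⟩ := exists_walk_of_depth hf y
  -- The cycle runs from the image of the parent `q` of `x` to the root, on to the image of `y`, and
  -- back through the edge `q x`, whose image is not used by the two paths, by minimality of `k`.
  refine ⟨f q, f x, ⟨adj_of_isChild hf hq, (p₁.reverse.append p₂).copy rfl hxy.symm, ?_, ?_⟩,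
    p₁.reverse, ?_⟩
  · rw [SimpleGraph.Walk.length_copy, SimpleGraph.Walk.length_append,
      SimpleGraph.Walk.length_reverse]
    omega
  · rw [SimpleGraph.Walk.edges_copy, SimpleGraph.Walk.edges_append, List.mem_append,
      SimpleGraph.Walk.edges_reverse, List.mem_reverse]
    rintro (h | h)
    · obtain ⟨y', y₁, h1, h2, -, h4⟩ := he₁ _ h
      have hd := h1.depth_eq
      rcases Sym2.eq_iff.1 h4 with ⟨e1, e2⟩ | ⟨e1, e2⟩
      · have := hinj q y' (by omega) (by omega) e1
        subst this
        omega
      · have h5 := hinj q y₁ (by omega) (by omega) e1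
        subst h5
        have h6 := eq_of_adj_of_eq hf hqx (betheLattice_adj.2 (Or.inr h1)) e2
        subst h6
        omega
    · obtain ⟨y', y₁, h1, h2, h3, h4⟩ := he₂ _ h
      have hd := h1.depth_eq
      rcases Sym2.eq_iff.1 h4 with ⟨e1, e2⟩ | ⟨e1, e2⟩
      · have h5 := hinj q y' (by omega) (by omega) e1
        subst h5
        have h6 := eq_of_adj_of_eq hf hqx (betheLattice_adj.2 (Or.inl h1)) e2
        subst h6
        exact hne (h3 (by omega))
      · by_cases hy₁ : depth y₁ < k
        · have h5 := hinj q y₁ (by omega) hy₁ e1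
          subst h5
          have h6 := eq_of_adj_of_eq hf hqx (betheLattice_adj.2 (Or.inr h1)) e2
          subst h6
          omega
        · have h5 : y₁ = y := h3 (by omega)
          subst h5
          exact (adj_of_isChild hf h1).ne (e2.symm.trans hxy)
  · rw [SimpleGraph.Walk.length_reverse]
    omega

end ShortCycle
end
end BetheAnderson

namespace BetheAnderson

noncomputable section

/-! ### Switchings and the number of short cycles of a random regular graph -/

section Switching

open Classical

variable {V : Type*}

/-- The `4`-cycle `u, w, y, x`. -/
def fourCycle (u w x y : V) : SimpleGraph V :=
  SimpleGraph.fromEdgeSet {s(u, w), s(w, y), s(y, x), s(x, u)}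

/-- The switching that replaces the edges `uw` and `xy` by `ux` and `wy`. -/
def switch (Γ : SimpleGraph V) (u w x y : V) : SimpleGraph V := symmDiff Γ (fourCycle u w x y)

theorem switch_switch (Γ : SimpleGraph V) (u w x y : V) :
    switch (switch Γ u w x y) u w x y = Γ := symmDiff_symmDiff_cancel_right _ _

theorem switch_adj {Γ : SimpleGraph V} {u w x y a b : V} : (switch Γ u w x y).Adj a b ↔
    (Γ.Adj a b ∧ ¬ (fourCycle u w x y).Adj a b) ∨ ((fourCycle u w x y).Adj a b ∧ ¬ Γ.Adj a b) := by
  rw [switch, symmDiff_def, SimpleGraph.sup_adj, SimpleGraph.sdiff_adj, SimpleGraph.sdiff_adj]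

theorem fourCycle_adj {u w x y a b : V} : (fourCycle u w x y).Adj a b ↔
    (s(a, b) = s(u, w) ∨ s(a, b) = s(w, y) ∨ s(a, b) = s(y, x) ∨ s(a, b) = s(x, u)) ∧ a ≠ b := by
  simp [fourCycle]

variable [Fintype V]

/-- The vertices that can be reached from `u` by a walk of length at most `L`. -/
def walkBall (Γ : SimpleGraph V) (L : ℕ) (u : V) : Finset V :=
  Finset.univ.filter fun w => ∃ p : Γ.Walk u w, p.length ≤ L

theorem mem_walkBall {Γ : SimpleGraph V} {L : ℕ} {u w : V} :
    w ∈ walkBall Γ L u ↔ ∃ p : Γ.Walk u w, p.length ≤ L := by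
  simp [walkBall]

theorem card_walkBall_le {Γ : SimpleGraph V} {d : ℕ} (hΓ : ∀ v, Γ.degree v ≤ d) (L : ℕ) (u : V) :
    (walkBall Γ L u).card ≤ (d + 1) ^ L := by
  induction L generalizing u with
  | zero =>
    have : walkBall Γ 0 u ⊆ {u} := by
      intro w hw
      obtain ⟨p, hp⟩ := mem_walkBall.1 hw
      rw [Finset.mem_singleton]
      exact (SimpleGraph.Walk.eq_of_length_eq_zero (Nat.le_zero.1 hp)).symm
    simpa using Finset.card_le_card this
  | succ L ih =>
    have h1 : walkBall Γ (L + 1) u ⊆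
        insert u ((Γ.neighborFinset u).biUnion fun x => walkBall Γ L x) := by
      intro w hw
      obtain ⟨p, hp⟩ := mem_walkBall.1 hw
      rw [Finset.mem_insert, Finset.mem_biUnion]
      cases p with
      | nil => exact Or.inl rfl
      | cons h q =>
        rw [SimpleGraph.Walk.length_cons] at hp
        exact Or.inr ⟨_, (SimpleGraph.mem_neighborFinset _ _ _).2 h,
          mem_walkBall.2 ⟨q, by omega⟩⟩
    have h2 : ((Γ.neighborFinset u).biUnion fun x => walkBall Γ L x).card ≤ d * (d + 1) ^ L := by
      refine (Finset.card_biUnion_le_card_mul _ _ _ fun x _ => ih x).trans ?_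
      gcongr
      exact hΓ u
    calc (walkBall Γ (L + 1) u).card ≤ _ := Finset.card_le_card h1
      _ ≤ _ + 1 := Finset.card_insert_le _ _
      _ ≤ d * (d + 1) ^ L + 1 := by gcongr
      _ ≤ (d + 1) ^ (L + 1) := by
        have : 1 ≤ (d + 1) ^ L := Nat.one_le_pow _ _ (Nat.succ_pos d)
        rw [pow_succ]
        nlinarith

/-- Removing the neighbour `p` of `a` and adding the neighbour `q` keeps the degree. -/
theorem degree_switch_eq {Γ : SimpleGraph V} {u w x y a p q : V}
    (hC : ∀ b, (fourCycle u w x y).Adj a b ↔ b = p ∨ b = q) (hp : Γ.Adj a p) (hq : ¬ Γ.Adj a q) :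
    (switch Γ u w x y).degree a = Γ.degree a := by
  have h1 : (switch Γ u w x y).neighborFinset a = insert q ((Γ.neighborFinset a).erase p) := by
    ext b
    rw [SimpleGraph.mem_neighborFinset, switch_adj, hC, Finset.mem_insert, Finset.mem_erase,
      SimpleGraph.mem_neighborFinset]
    by_cases hbp : b = p
    · subst hbp
      have : b ≠ q := fun h => hq (h ▸ hp)
      simp [hp, this]
    · by_cases hbq : b = q
      · subst hbq; simp [hq]
      · simp [hbp, hbq]
  rw [SimpleGraph.degree, h1, Finset.card_insert_of_notMem, Finset.card_erase_of_mem]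
  · have : 0 < (Γ.neighborFinset a).card := Finset.card_pos.2 ⟨p, by simpa using hp⟩
    rw [← SimpleGraph.card_neighborFinset_eq_degree]
    omega
  · simpa using hp
  · intro h
    have := Finset.mem_of_mem_erase h
    rw [SimpleGraph.mem_neighborFinset] at this
    exact hq this

theorem degree_switch {Γ : SimpleGraph V} {u w x y : V} (huw : Γ.Adj u w) (hxy : Γ.Adj x y)
    (hux : ¬ Γ.Adj u x) (hwy : ¬ Γ.Adj w y) (h1 : u ≠ x) (h2 : u ≠ y) (h3 : w ≠ x) (h4 : w ≠ y)
    (a : V) : (switch Γ u w x y).degree a = Γ.degree a := by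
  have h5 := huw.ne
  have h6 := hxy.ne
  by_cases hau : a = u
  · subst hau
    refine degree_switch_eq (p := w) (q := x) (fun b => ?_) huw hux
    rw [fourCycle_adj]
    simp only [Sym2.eq_iff]
    constructor
    · aesop
    · rintro (rfl | rfl) <;> aesop
  by_cases haw : a = w
  · subst haw
    refine degree_switch_eq (p := u) (q := y) (fun b => ?_) huw.symm hwy
    rw [fourCycle_adj]
    simp only [Sym2.eq_iff]
    constructor
    · aesop
    · rintro (rfl | rfl) <;> aesop
  by_cases hax : a = x
  · subst hax
    refine degree_switch_eq (p := y) (q := u) (fun b => ?_) hxy (fun h => hux h.symm)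
    rw [fourCycle_adj]
    simp only [Sym2.eq_iff]
    constructor
    · aesop
    · rintro (rfl | rfl) <;> aesop
  by_cases hay : a = y
  · subst hay
    refine degree_switch_eq (p := x) (q := w) (fun b => ?_) hxy.symm (fun h => hwy h.symm)
    rw [fourCycle_adj]
    simp only [Sym2.eq_iff]
    constructor
    · aesop
    · rintro (rfl | rfl) <;> aesop
  · have h7 : (switch Γ u w x y).neighborFinset a = Γ.neighborFinset a := by
      ext b
      rw [SimpleGraph.mem_neighborFinset, switch_adj, fourCycle_adj, SimpleGraph.mem_neighborFinset]
      simp only [Sym2.eq_iff]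
      simp [hau, haw, hax, hay]
    rw [SimpleGraph.degree, h7]
    rfl

/-- The number of oriented edges on short cycles of length at most `L + 1`. -/
def shortCycleCount (Γ : SimpleGraph V) (L : ℕ) : ℕ :=
  ∑ u, (Finset.univ.filter fun w => IsShortCycleEdge Γ L u w).card

/-- An edge of a short cycle and a far away edge can be switched, and the short cycle leaves a short
path behind. -/
theorem switch_spec {Γ : SimpleGraph V} {L : ℕ} (hL : 1 ≤ L) {u w x y : V}
    (huw : IsShortCycleEdge Γ L u w) (hx : x ∉ walkBall Γ (L + 2) u) (hxy : Γ.Adj x y) :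
    (∀ a, (switch Γ u w x y).degree a = Γ.degree a) ∧ w ∈ walkBall (switch Γ u w x y) L u ∧
      (switch Γ u w x y).Adj u x ∧ (switch Γ u w x y).Adj w y := by
  obtain ⟨hadj, p, hp, hep⟩ := huw
  have hfar : ∀ q : Γ.Walk u x, L + 2 < q.length := by
    intro q
    by_contra h
    exact hx (mem_walkBall.2 ⟨q, by omega⟩)
  have h1 : u ≠ x := by
    rintro rfl
    have := hfar SimpleGraph.Walk.nil
    simp at this
  have hux : ¬ Γ.Adj u x := fun h => by
    have := hfar (SimpleGraph.Walk.cons h SimpleGraph.Walk.nil)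
    simp at this
  have h2 : u ≠ y := by
    rintro rfl
    exact hux hxy.symm
  have h3 : w ≠ x := by
    rintro rfl
    exact hux hadj
  have h4 : w ≠ y := by
    rintro rfl
    have := hfar (SimpleGraph.Walk.cons hadj (SimpleGraph.Walk.cons hxy.symm SimpleGraph.Walk.nil))
    simp at this
  have hwy : ¬ Γ.Adj w y := fun h => by
    have := hfar (SimpleGraph.Walk.cons hadj (SimpleGraph.Walk.cons h
      (SimpleGraph.Walk.cons hxy.symm SimpleGraph.Walk.nil)))
    simp at this
    omega
  refine ⟨degree_switch hadj hxy hux hwy h1 h2 h3 h4, ?_, ?_, ?_⟩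
  · have hedges : ∀ e ∈ p.edges, e ∈ (switch Γ u w x y).edgeSet := by
      intro e he
      have heΓ := p.edges_subset_edgeSet he
      induction e using Sym2.ind with
      | _ a b =>
        rw [SimpleGraph.mem_edgeSet] at heΓ ⊢
        rw [switch_adj]
        refine Or.inl ⟨heΓ, fun hC => ?_⟩
        rcases (fourCycle_adj.1 hC).1 with h | h | h | h
        · exact hep (h ▸ he)
        · rw [← SimpleGraph.mem_edgeSet, h, SimpleGraph.mem_edgeSet] at heΓ
          exact hwy heΓ
        · rw [h] at he
          have hmem := p.snd_mem_support_of_mem_edges he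
          have h5 := hfar (p.takeUntil x hmem)
          have h6 := p.length_takeUntil_le_length hmem
          omega
        · rw [← SimpleGraph.mem_edgeSet, h, SimpleGraph.mem_edgeSet] at heΓ
          exact hux heΓ.symm
    exact mem_walkBall.2 ⟨p.transfer _ hedges, by rwa [SimpleGraph.Walk.length_transfer]⟩
  · rw [switch_adj, fourCycle_adj]
    exact Or.inr ⟨⟨by simp [Sym2.eq_swap], h1⟩, hux⟩
  · rw [switch_adj, fourCycle_adj]
    exact Or.inr ⟨⟨by simp, h4⟩, hwy⟩

/-- The sum over all regular graphs of the number of edges on short cycles: each such edge `uw` can be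
switched with every edge `xy` far away from it. The switching is an involution, and in the graph that
results `w` is in a ball around `u`, while `x` and `y` are neighbours of `u` and `w`, so there are
few choices of `u, w, x, y` for each resulting graph. -/
theorem sum_shortCycleCount_le (𝒢 : Finset (SimpleGraph V)) {d : ℕ} (hd : 0 < d)
    (h𝒢 : ∀ Γ, Γ ∈ 𝒢 ↔ Γ.IsRegularOfDegree d) {L : ℕ} (hL : 1 ≤ L) :
    (∑ Γ ∈ 𝒢, shortCycleCount Γ L) * (Fintype.card V - (d + 1) ^ (L + 2)) ≤
      𝒢.card * (Fintype.card V * ((d + 1) ^ L * d)) := by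
  let A : Finset (Σ _ : SimpleGraph V, Σ _ : V, Σ _ : V, Σ _ : V, V) :=
    𝒢.sigma fun Γ => Finset.univ.sigma fun u =>
      (Finset.univ.filter fun w => IsShortCycleEdge Γ L u w).sigma fun _ =>
        (walkBall Γ (L + 2) u)ᶜ.sigma fun x => Γ.neighborFinset x
  let B : Finset (Σ _ : SimpleGraph V, Σ _ : V, Σ _ : V, Σ _ : V, V) :=
    𝒢.sigma fun Γ => Finset.univ.sigma fun u => (walkBall Γ L u).sigma fun w =>
      (Γ.neighborFinset u).sigma fun _ => Γ.neighborFinset w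
  have hAB : A.card ≤ B.card := by
    refine Finset.card_le_card_of_injOn
      (fun s => ⟨switch s.1 s.2.1 s.2.2.1 s.2.2.2.1 s.2.2.2.2, s.2⟩) ?_ ?_
    · rintro ⟨Γ, u, w, x, y⟩ hs
      simp only [A, Finset.coe_sigma, Set.mem_sigma_iff, Finset.mem_coe, Finset.mem_univ, true_and,
        Finset.mem_filter, Finset.mem_compl, SimpleGraph.mem_neighborFinset] at hs
      obtain ⟨h1, h2, h3, h4⟩ := hs
      obtain ⟨k1, k2, k3, k4⟩ := switch_spec hL h2 h3 h4
      simp only [B, Finset.coe_sigma, Set.mem_sigma_iff, Finset.mem_coe, Finset.mem_univ, true_and,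
        SimpleGraph.mem_neighborFinset]
      refine ⟨?_, k2, k3, k4⟩
      rw [h𝒢] at h1 ⊢
      intro a
      rw [k1, h1 a]
    · rintro ⟨Γ, s⟩ _ ⟨Γ', s'⟩ _ h
      simp only [Sigma.mk.injEq, heq_eq_eq] at h
      obtain ⟨h1, rfl⟩ := h
      have := switch_switch Γ s.1 s.2.1 s.2.2.1 s.2.2.2
      rw [h1, switch_switch] at this
      rw [this]
  have hA : (∑ Γ ∈ 𝒢, shortCycleCount Γ L) * ((Fintype.card V - (d + 1) ^ (L + 2)) * d) ≤
      A.card := by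
    simp only [A, Finset.card_sigma, shortCycleCount]
    rw [Finset.sum_mul]
    refine Finset.sum_le_sum fun Γ hΓ => ?_
    rw [Finset.sum_mul]
    refine Finset.sum_le_sum fun u _ => ?_
    rw [Finset.sum_const, smul_eq_mul]
    gcongr
    have hreg := (h𝒢 Γ).1 hΓ
    have hcard : ∀ x ∈ (walkBall Γ (L + 2) u)ᶜ, (Γ.neighborFinset x).card = d := fun x _ => hreg x
    rw [Finset.sum_congr rfl hcard, Finset.sum_const, smul_eq_mul, Finset.card_compl]
    gcongr
    exact card_walkBall_le (fun v => (hreg v).le) _ _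
  have hB : B.card ≤ 𝒢.card * (Fintype.card V * ((d + 1) ^ L * (d * d))) := by
    simp only [B, Finset.card_sigma]
    refine Finset.sum_le_card_nsmul _ _ _ fun Γ hΓ => ?_
    have hreg := (h𝒢 Γ).1 hΓ
    refine Finset.sum_le_card_nsmul _ _ _ fun u _ => ?_
    refine (Finset.sum_le_card_nsmul _ _ (d * d) fun w _ => ?_).trans ?_
    · rw [Finset.sum_const, smul_eq_mul]
      exact le_of_eq (by rw [SimpleGraph.card_neighborFinset_eq_degree,
        SimpleGraph.card_neighborFinset_eq_degree, hreg u, hreg w])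
    · rw [smul_eq_mul]
      gcongr
      exact card_walkBall_le (fun v => (hreg v).le) _ _
  have h := (hA.trans hAB).trans hB
  refine Nat.le_of_mul_le_mul_right (c := d) ?_ hd
  calc _ = _ := mul_assoc _ _ _
    _ ≤ _ := h
    _ = _ := by ring

/-- The vertices around which a regular graph does not look like the Bethe lattice. -/
def badVertices (d : ℕ) (Γ : SimpleGraph V) (R : ℕ) : Finset V :=
  Finset.univ.filter fun v =>
    ¬ Set.InjOn (coveringMap Γ v : BetheVertex d → V) {x | depth x ≤ R}

/-- Every bad vertex is within distance `R` of an edge of a short cycle. -/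
theorem card_badVertices_le {d : ℕ} {Γ : SimpleGraph V} (hΓ : Γ.IsRegularOfDegree d) (R : ℕ) :
    (badVertices d Γ R).card ≤ shortCycleCount Γ (2 * R) * (d + 1) ^ R := by
  set U := Finset.univ.filter fun u => ∃ w, IsShortCycleEdge Γ (2 * R) u w with hU
  have h1 : badVertices d Γ R ⊆ U.biUnion fun u => walkBall Γ R u := by
    intro v hv
    rw [badVertices, Finset.mem_filter] at hv
    obtain ⟨u, w, huw, q, hq⟩ := exists_isShortCycleEdge_of_not_injOn
      (coveringMap_bijOn Γ hΓ v) hv.2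
    rw [Finset.mem_biUnion]
    exact ⟨u, by simpa [hU] using ⟨w, huw⟩, mem_walkBall.2 ⟨q, hq⟩⟩
  have h2 : U.card ≤ shortCycleCount Γ (2 * R) := by
    rw [Finset.card_eq_sum_ones, shortCycleCount, hU, Finset.sum_filter]
    refine Finset.sum_le_sum fun u _ => ?_
    split_ifs with h
    · obtain ⟨w, hw⟩ := h
      exact Finset.card_pos.2 ⟨w, by simpa using hw⟩
    · exact Nat.zero_le _
  refine (Finset.card_le_card h1).trans ?_
  refine (Finset.card_biUnion_le_card_mul _ _ _ fun u _ =>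
    card_walkBall_le (fun v => (hΓ v).le) R u).trans ?_
  gcongr

/-- The mean number of bad vertices over all regular graphs is bounded in the size of the graph. -/
theorem sum_card_badVertices_le (𝒢 : Finset (SimpleGraph V)) {d : ℕ} (hd : 0 < d)
    (h𝒢 : ∀ Γ, Γ ∈ 𝒢 ↔ Γ.IsRegularOfDegree d) {R : ℕ} (hR : 0 < R) :
    (∑ Γ ∈ 𝒢, (badVertices d Γ R).card) * (Fintype.card V - (d + 1) ^ (2 * R + 2)) ≤
      𝒢.card * (Fintype.card V * ((d + 1) ^ (2 * R) * d * (d + 1) ^ R)) := by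
  have h1 := sum_shortCycleCount_le 𝒢 hd h𝒢 (L := 2 * R) (by omega)
  have h2 : ∑ Γ ∈ 𝒢, (badVertices d Γ R).card ≤
      (∑ Γ ∈ 𝒢, shortCycleCount Γ (2 * R)) * (d + 1) ^ R := by
    rw [Finset.sum_mul]
    exact Finset.sum_le_sum fun Γ hΓ => card_badVertices_le ((h𝒢 Γ).1 hΓ) R
  calc _ ≤ (∑ Γ ∈ 𝒢, shortCycleCount Γ (2 * R)) * (d + 1) ^ R *
        (Fintype.card V - (d + 1) ^ (2 * R + 2)) := by gcongr
    _ = (∑ Γ ∈ 𝒢, shortCycleCount Γ (2 * R)) *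
        (Fintype.card V - (d + 1) ^ (2 * R + 2)) * (d + 1) ^ R := by ring
    _ ≤ 𝒢.card * (Fintype.card V * ((d + 1) ^ (2 * R) * d)) * (d + 1) ^ R := by gcongr
    _ = _ := by ring

end Switching
end
end BetheAnderson

namespace BetheAnderson

noncomputable section

open scoped InnerProductSpace

/-! ### Stieltjes transforms and measurability of families of measures -/

section Stieltjes

theorem measurable_uncurry_stieltjesTransform {α : Type*} [MeasurableSpace α] {μ : α → Measure ℝ}
    [∀ a, IsProbabilityMeasure (μ a)]
    (h : ∀ z : ℂ, z.im ≠ 0 → Measurable fun a => stieltjesTransform (μ a) z) {η : ℝ} (hη : 0 < η) :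
    Measurable (Function.uncurry fun (x : ℝ) (a : α) =>
      stieltjesTransform (μ a) ((x : ℂ) + η * Complex.I)) := by
  have him : ∀ x : ℝ, ((x : ℂ) + η * Complex.I).im = η := fun x => by simp
  refine measurable_uncurry_of_continuous_of_measurable (fun a => ?_) (fun x => h _ ?_)
  · refine continuous_of_dominated (bound := fun _ => 1 / η) (fun x => ?_) (fun x => ?_)
      (integrable_const _) ?_
    · exact (continuous_one_div_sub (by rw [him]; exact hη.ne')).aestronglyMeasurable
    · refine ae_of_all _ fun s => ?_
      have := norm_one_div_sub_le (z := (x : ℂ) + η * Complex.I) (by rw [him]; exact hη.ne') s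
      rwa [him, abs_of_pos hη] at this
    · refine ae_of_all _ fun s => ?_
      refine Continuous.div continuous_const (by fun_prop) fun x => ?_
      exact ofReal_sub_ne_zero (by rw [him]; exact hη.ne') s
  · rw [him]; exact hη.ne'

theorem im_one_div_sub (s x η : ℝ) : (1 / ((s : ℂ) - ((x : ℂ) + η * Complex.I))).im =
    η / ((x - s) ^ 2 + η ^ 2) := by
  rw [one_div, Complex.inv_im, Complex.normSq_apply]
  simp
  ring

theorem integral_im_one_div_sub (s a b : ℝ) {η : ℝ} (hη : 0 < η) :
    ∫ x in a..b, (1 / ((s : ℂ) - ((x : ℂ) + η * Complex.I))).im =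
      Real.arctan (b / η - s / η) - Real.arctan (a / η - s / η) := by
  have h1 : ∀ x : ℝ, (1 / ((s : ℂ) - ((x : ℂ) + η * Complex.I))).im =
      η⁻¹ * (fun y : ℝ => (1 + y ^ 2)⁻¹) (x / η - s / η) := by
    intro x
    rw [im_one_div_sub]
    have : (x - s) ^ 2 + η ^ 2 ≠ 0 := by positivity
    have h2 : 1 + (x / η - s / η) ^ 2 = ((x - s) ^ 2 + η ^ 2) / η ^ 2 := by
      field_simp
      ring
    simp only [h2]
    field_simp
  simp_rw [h1]
  rw [intervalIntegral.integral_const_mul,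
    intervalIntegral.integral_comp_div_sub (fun y : ℝ => (1 + y ^ 2)⁻¹) hη.ne',
    integral_inv_one_add_sq, smul_eq_mul, inv_mul_cancel_left₀ hη.ne']

/-- The Poisson integral of a measure over an interval, computed by exchanging integrals. -/
theorem intervalIntegral_im_stieltjesTransform (μ : Measure ℝ) [IsProbabilityMeasure μ] (a b : ℝ)
    {η : ℝ} (hη : 0 < η) :
    ∫ x in a..b, (stieltjesTransform μ ((x : ℂ) + η * Complex.I)).im =
      ∫ s, (Real.arctan (b / η - s / η) - Real.arctan (a / η - s / η)) ∂μ := by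
  have him : ∀ x : ℝ, ((x : ℂ) + η * Complex.I).im ≠ 0 := fun x => by simpa using hη.ne'
  have h1 : ∀ x : ℝ, (stieltjesTransform μ ((x : ℂ) + η * Complex.I)).im =
      ∫ s, (1 / ((s : ℂ) - ((x : ℂ) + η * Complex.I))).im ∂μ := by
    intro x
    have hi : Integrable (fun s : ℝ => 1 / ((s : ℂ) - ((x : ℂ) + η * Complex.I))) μ :=
      Integrable.of_bound (continuous_one_div_sub (him x)).aestronglyMeasurable _
        (ae_of_all _ (norm_one_div_sub_le (him x)))
    exact (integral_im hi).symm
  simp_rw [h1]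
  rw [intervalIntegral_integral_swap]
  · refine integral_congr_ae (ae_of_all _ fun s => ?_)
    exact integral_im_one_div_sub s a b hη
  · have hc : Continuous (Function.uncurry fun (x s : ℝ) =>
        (1 / ((s : ℂ) - ((x : ℂ) + η * Complex.I))).im) := by
      refine Complex.continuous_im.comp ?_
      refine Continuous.div continuous_const (by fun_prop) fun p => ?_
      exact ofReal_sub_ne_zero (him p.1) p.2
    have : IsFiniteMeasure (volume.restrict (Set.uIoc a b)) :=
      ⟨by rw [Measure.restrict_apply_univ, Set.uIoc]; exact measure_Ioc_lt_top⟩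
    refine Integrable.of_bound hc.aestronglyMeasurable (1 / η) (ae_of_all _ fun p => ?_)
    have := norm_one_div_sub_le (him p.1) p.2
    simp only [Complex.add_im, Complex.ofReal_im, Complex.mul_im, Complex.ofReal_re, Complex.I_im,
      mul_one, Complex.I_re, mul_zero, add_zero, zero_add, abs_of_pos hη] at this
    exact (Complex.abs_im_le_norm _).trans this

/-- Stieltjes inversion: the distribution function is a limit of Poisson integrals. The widths
`1 / (n + 1) ^ 2` are chosen to be negligible compared with the offset `1 / (n + 1)` of the right
endpoint, so that the atom at `c` is counted in full. -/
theorem tendsto_intervalIntegral_im_stieltjesTransform (μ : Measure ℝ) [IsProbabilityMeasure μ]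
    (c : ℝ) :
    Tendsto (fun n : ℕ => ∫ x in (-((n : ℝ) + 1))..(c + 1 / ((n : ℝ) + 1)),
      (stieltjesTransform μ ((x : ℂ) + (1 / ((n : ℝ) + 1) ^ 2 : ℝ) * Complex.I)).im)
      atTop (𝓝 (Real.pi * μ.real (Set.Iic c))) := by
  have hη : ∀ n : ℕ, (0 : ℝ) < 1 / ((n : ℝ) + 1) ^ 2 := fun n => by positivity
  simp_rw [fun n : ℕ => intervalIntegral_im_stieltjesTransform μ (-((n : ℝ) + 1))
    (c + 1 / ((n : ℝ) + 1)) (hη n)]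
  have h0 : Real.pi * μ.real (Set.Iic c) =
      ∫ s, (Set.Iic c).indicator (fun _ => Real.pi) s ∂μ := by
    rw [integral_indicator_const _ measurableSet_Iic, smul_eq_mul, mul_comm]
  rw [h0]
  have hn : Tendsto (fun n : ℕ => (n : ℝ) + 1) atTop atTop :=
    tendsto_atTop_add_const_right _ _ tendsto_natCast_atTop_atTop
  refine tendsto_integral_of_dominated_convergence (fun _ => Real.pi) (fun n => ?_)
    (integrable_const _) (fun n => ae_of_all _ fun s => ?_) (ae_of_all _ fun s => ?_)
  · exact Continuous.aestronglyMeasurable (by fun_prop)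
  · rw [Real.norm_eq_abs, abs_le]
    have h1 := Real.arctan_lt_pi_div_two ((c + 1 / ((n : ℝ) + 1)) / (1 / ((n : ℝ) + 1) ^ 2) -
      s / (1 / ((n : ℝ) + 1) ^ 2))
    have h2 := Real.neg_pi_div_two_lt_arctan ((c + 1 / ((n : ℝ) + 1)) / (1 / ((n : ℝ) + 1) ^ 2) -
      s / (1 / ((n : ℝ) + 1) ^ 2))
    have h3 := Real.arctan_lt_pi_div_two ((-((n : ℝ) + 1)) / (1 / ((n : ℝ) + 1) ^ 2) -
      s / (1 / ((n : ℝ) + 1) ^ 2))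
    have h4 := Real.neg_pi_div_two_lt_arctan ((-((n : ℝ) + 1)) / (1 / ((n : ℝ) + 1) ^ 2) -
      s / (1 / ((n : ℝ) + 1) ^ 2))
    constructor <;> linarith
  · have hb : Tendsto (fun n : ℕ => Real.arctan ((-((n : ℝ) + 1)) / (1 / ((n : ℝ) + 1) ^ 2) -
        s / (1 / ((n : ℝ) + 1) ^ 2))) atTop (𝓝 (-(Real.pi / 2))) := by
      refine (tendsto_nhdsWithin_iff.1 Real.tendsto_arctan_atBot).1.comp ?_
      have e : ∀ n : ℕ, (-((n : ℝ) + 1)) / (1 / ((n : ℝ) + 1) ^ 2) - s / (1 / ((n : ℝ) + 1) ^ 2) =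
          ((n : ℝ) + 1) ^ 2 * (-((n : ℝ) + 1) - s) := fun n => by
        have : (n : ℝ) + 1 ≠ 0 := by positivity
        field_simp
      simp_rw [e]
      exact ((tendsto_pow_atTop two_ne_zero).comp hn).atTop_mul_atBot₀
        (tendsto_atBot_add_const_right _ _ (tendsto_neg_atTop_atBot.comp hn))
    have e : ∀ n : ℕ, (c + 1 / ((n : ℝ) + 1)) / (1 / ((n : ℝ) + 1) ^ 2) -
        s / (1 / ((n : ℝ) + 1) ^ 2) = ((n : ℝ) + 1) * (((n : ℝ) + 1) * (c - s) + 1) := fun n => by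
      have : (n : ℝ) + 1 ≠ 0 := by positivity
      field_simp
      ring
    by_cases hs : s ≤ c
    · have ha : Tendsto (fun n : ℕ => Real.arctan ((c + 1 / ((n : ℝ) + 1)) /
          (1 / ((n : ℝ) + 1) ^ 2) - s / (1 / ((n : ℝ) + 1) ^ 2))) atTop (𝓝 (Real.pi / 2)) := by
        refine (tendsto_nhdsWithin_iff.1 Real.tendsto_arctan_atTop).1.comp ?_
        simp_rw [e]
        refine tendsto_atTop_mono (fun n => ?_) hn
        have h1 : (0 : ℝ) ≤ ((n : ℝ) + 1) * (c - s) :=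
          mul_nonneg (by positivity) (sub_nonneg.2 hs)
        have h2 : (0 : ℝ) ≤ (n : ℝ) + 1 := by positivity
        nlinarith
      have := ha.sub hb
      rwa [Set.indicator_of_mem (Set.mem_Iic.2 hs), ← add_halves Real.pi,
        ← sub_neg_eq_add (Real.pi / 2)]
    · have ha : Tendsto (fun n : ℕ => Real.arctan ((c + 1 / ((n : ℝ) + 1)) /
          (1 / ((n : ℝ) + 1) ^ 2) - s / (1 / ((n : ℝ) + 1) ^ 2))) atTop (𝓝 (-(Real.pi / 2))) := by
        refine (tendsto_nhdsWithin_iff.1 Real.tendsto_arctan_atBot).1.comp ?_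
        simp_rw [e]
        refine hn.atTop_mul_atBot₀ (tendsto_atBot_add_const_right _ _ ?_)
        exact hn.atTop_mul_const_of_neg (sub_neg.2 (not_le.1 hs))
      have := ha.sub hb
      rwa [Set.indicator_of_notMem (fun h => hs (Set.mem_Iic.1 h)), ← sub_self (-(Real.pi / 2))]

/-- A family of probability measures is measurable when its Stieltjes transforms are. -/
theorem measurable_of_measurable_stieltjesTransform {α : Type*} [MeasurableSpace α]
    {μ : α → Measure ℝ} [∀ a, IsProbabilityMeasure (μ a)]
    (h : ∀ z : ℂ, z.im ≠ 0 → Measurable fun a => stieltjesTransform (μ a) z) : Measurable μ := by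
  refine .measure_of_isPiSystem_of_isProbabilityMeasure (borel_eq_generateFrom_Iic ℝ)
    isPiSystem_Iic ?_
  rintro _ ⟨c, rfl⟩
  have h1 : Measurable fun a => Real.pi * (μ a).real (Set.Iic c) := by
    refine measurable_of_tendsto_metrizable (f := fun (n : ℕ) (a : α) =>
      ∫ x in (-((n : ℝ) + 1))..(c + 1 / ((n : ℝ) + 1)), (stieltjesTransform (μ a)
        ((x : ℂ) + (1 / ((n : ℝ) + 1) ^ 2 : ℝ) * Complex.I)).im) (fun n => ?_) ?_
    · have h2 : Measurable (Function.uncurry fun (x : ℝ) (a : α) => (stieltjesTransform (μ a)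
          ((x : ℂ) + (1 / ((n : ℝ) + 1) ^ 2 : ℝ) * Complex.I)).im) := Complex.measurable_im.comp
        (measurable_uncurry_stieltjesTransform h (η := 1 / ((n : ℝ) + 1) ^ 2) (by positivity))
      simp only [intervalIntegral]
      refine Measurable.sub ?_ ?_ <;>
      exact (h2.stronglyMeasurable.integral_prod_left).measurable
    · exact tendsto_pi_nhds.2 fun a => tendsto_intervalIntegral_im_stieltjesTransform (μ a) c
  have h2 : (fun a => μ a (Set.Iic c)) =
      fun a => ENNReal.ofReal (Real.pi⁻¹ * (Real.pi * (μ a).real (Set.Iic c))) := by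
    ext a
    rw [inv_mul_cancel_left₀ Real.pi_ne_zero, measureReal_def,
      ENNReal.ofReal_toReal (measure_ne_top _ _)]
  rw [h2]
  exact (h1.const_mul _).ennreal_ofReal

theorem stieltjesTransform_bind {α : Type*} [MeasurableSpace α] {m : Measure α}
    [IsProbabilityMeasure m] {μ : α → Measure ℝ} [hp : ∀ a, IsProbabilityMeasure (μ a)]
    (hμ : Measurable μ) {z : ℂ} (hz : z.im ≠ 0) :
    stieltjesTransform (m.bind μ) z = ∫ a, stieltjesTransform (μ a) z ∂m := by
  let κ : Kernel α ℝ := ⟨μ, hμ⟩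
  have : IsMarkovKernel κ := ⟨hp⟩
  have e : (κ ∘ₖ Kernel.const Unit m) () = m.bind μ := by
    rw [Kernel.comp_apply, Kernel.const_apply]
    rfl
  have hi : Integrable (fun s : ℝ => 1 / ((s : ℂ) - z)) ((κ ∘ₖ Kernel.const Unit m) ()) :=
    Integrable.of_bound (continuous_one_div_sub hz).aestronglyMeasurable _
      (ae_of_all _ (norm_one_div_sub_le hz))
  rw [stieltjesTransform, ← e, Kernel.integral_comp hi, Kernel.const_apply]
  rfl

end Stieltjes

/-! ### The density of states of the Bethe lattice -/

section DensityOfStates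

variable (d : ℕ) (t : ℝ)

/-- The potential `h` cut off outside the ball of radius `R`. -/
def truncate {d : ℕ} (R : ℕ) (h : BetheVertex d → ℝ) (x : BetheVertex d) : ℝ :=
  if depth x ≤ R then h x else 0

variable {z : ℂ} (hz : z.im ≠ 0)

/-- The cut-off potential depends on finitely many coordinates, so the Lipschitz bound for the
uniform norm gives continuity in the product topology. -/
theorem continuous_treeGreen_truncate (R : ℕ) :
    Continuous fun h : BetheVertex d → ℝ => treeGreen d t hz (truncate R h) := by
  rw [continuous_iff_continuousAt]
  intro h
  rw [ContinuousAt, tendsto_iff_norm_sub_tendsto_zero]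
  have h1 : Tendsto (fun h' : BetheVertex d → ℝ =>
      (∑ x ∈ treeBall d R, |h x - h' x|) * (1 / |z.im|) / |z.im|) (𝓝 h) (𝓝 0) := by
    have : Continuous fun h' : BetheVertex d → ℝ =>
        (∑ x ∈ treeBall d R, |h x - h' x|) * (1 / |z.im|) / |z.im| := by fun_prop
    simpa using this.tendsto h
  refine squeeze_zero (fun _ => norm_nonneg _) (fun h' => ?_) h1
  refine norm_treeGreen_sub_le_of_abs_sub_le d t hz fun x => ?_
  unfold truncate
  split_ifs with hx
  · exact Finset.single_le_sum (f := fun x => |h x - h' x|) (fun _ _ => abs_nonneg _)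
      (mem_treeBall.2 hx)
  · simpa using Finset.sum_nonneg fun _ _ => abs_nonneg _

theorem norm_treeGreen_truncate_sub_le {R : ℕ} (hR : 0 < R) (h : BetheVertex d → ℝ) :
    ‖treeGreen d t hz (truncate R h) - treeGreen d t hz h‖ ≤
      |t| * d * (1 / |z.im|) / (R * |z.im|) :=
  norm_treeGreen_sub_le d t hz hR fun _ hx => (if_pos hx).symm

theorem measurable_treeGreen : Measurable (treeGreen d t hz) := by
  refine measurable_of_tendsto_metrizable
    (f := fun (R : ℕ) h => treeGreen d t hz (truncate (R + 1) h))
    (fun R => (continuous_treeGreen_truncate d t hz _).measurable) ?_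
  refine tendsto_pi_nhds.2 fun h => ?_
  rw [tendsto_iff_norm_sub_tendsto_zero]
  refine squeeze_zero (fun _ => norm_nonneg _)
    (fun R => norm_treeGreen_truncate_sub_le d t hz R.succ_pos h) ?_
  have h1 : Tendsto (fun R : ℕ => ((R + 1 : ℕ) : ℝ)) atTop atTop :=
    tendsto_natCast_atTop_atTop.comp (tendsto_add_atTop_nat 1)
  exact Tendsto.const_div_atTop (h1.atTop_mul_const (abs_pos.2 hz)) _

theorem exists_isSpectralResolution_betheHamiltonian (g : BetheVertex d → ℝ) :
    ∃ P, IsSpectralResolution (betheHamiltonian d t g) P :=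
  (hasResolvents_andersonOperator _ _ _ _).exists_isSpectralResolution

instance isProbabilityMeasure_spectralMeasureAt (g : BetheVertex d → ℝ) :
    IsProbabilityMeasure (spectralMeasureAt (betheHamiltonian d t g) (lp.single 2 none 1)) := by
  rw [spectralMeasureAt, dif_pos (exists_isSpectralResolution_betheHamiltonian d t g)]
  constructor
  rw [ProjectionValuedMeasure.measureAt_univ, lp.norm_single (by simp)]
  simp

theorem stieltjesTransform_spectralMeasureAt (g : BetheVertex d → ℝ) :
    stieltjesTransform (spectralMeasureAt (betheHamiltonian d t g) (lp.single 2 none 1)) z =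
      treeGreen d t hz g := by
  have h := exists_isSpectralResolution_betheHamiltonian d t g
  rw [spectralMeasureAt, dif_pos h]
  rw [h.choose_spec.stieltjesTransform_measureAt (hasResolvents_andersonOperator _ _ _ _) hz
    (greenColumn_spec _ _ t g hz none), lp.inner_single_left]
  simp [treeGreen]

instance : IsProbabilityMeasure (gaussianField d) := by
  unfold gaussianField
  infer_instance

/-- The Stieltjes transform of the density of states is the mean resolvent at the root. -/
theorem stieltjesTransform_densityOfStates :
    stieltjesTransform (densityOfStates d t) z = ∫ g, treeGreen d t hz g ∂gaussianField d := by
  have hm : Measurable fun g =>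
      spectralMeasureAt (betheHamiltonian d t g) (lp.single 2 none 1) := by
    refine measurable_of_measurable_stieltjesTransform fun w hw => ?_
    simp_rw [stieltjesTransform_spectralMeasureAt d t hw]
    exact measurable_treeGreen d t hw
  rw [densityOfStates, stieltjesTransform_bind hm hz]
  simp_rw [stieltjesTransform_spectralMeasureAt d t hz]

end DensityOfStates
end
end BetheAnderson

namespace BetheAnderson

noncomputable section

open scoped ComplexConjugate

/-! ### Sums of bounded variables with few correlations -/

section SecondMoment

/-- The second moment of a sum of bounded variables, each of which is uncorrelated to all but `K` of
the others. -/
theorem integral_norm_sq_sum_le {Ω ι : Type*} [MeasurableSpace Ω] [Fintype ι] (P : Measure Ω)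
    [IsProbabilityMeasure P] {D : ι → Ω → ℂ} (hD : ∀ i, Measurable (D i)) {M : ℝ}
    (hM : ∀ i ω, ‖D i ω‖ ≤ M) (S : ι → Finset ι) {K : ℕ} (hS : ∀ i, (S i).card ≤ K)
    (h0 : ∀ i, ∀ j ∉ S i, ∫ ω, D i ω * conj (D j ω) ∂P = 0) :
    ∫ ω, ‖∑ i, D i ω‖ ^ 2 ∂P ≤ Fintype.card ι * (K * M ^ 2) := by
  have hbound : ∀ i j ω, ‖D i ω * conj (D j ω)‖ ≤ M ^ 2 := fun i j ω => by
    rw [norm_mul, RCLike.norm_conj, sq]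
    exact mul_le_mul (hM i ω) (hM j ω) (norm_nonneg _) ((norm_nonneg _).trans (hM i ω))
  have hint : ∀ i j, Integrable (fun ω => D i ω * conj (D j ω)) P := fun i j =>
    Integrable.of_bound (((hD i).mul
      (Complex.continuous_conj.measurable.comp (hD j))).aestronglyMeasurable) (M ^ 2)
      (ae_of_all _ (hbound i j))
  have h1 : ((∫ ω, ‖∑ i, D i ω‖ ^ 2 ∂P : ℝ) : ℂ) =
      ∑ i, ∑ j, ∫ ω, D i ω * conj (D j ω) ∂P := by
    rw [← integral_complex_ofReal]
    have e : ∀ ω, ((‖∑ i, D i ω‖ ^ 2 : ℝ) : ℂ) = ∑ i, ∑ j, D i ω * conj (D j ω) := fun ω => by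
      rw [← Finset.sum_mul_sum, ← map_sum, Complex.mul_conj, Complex.normSq_eq_norm_sq]
    simp_rw [e]
    rw [integral_finsetSum _ fun i _ => integrable_finsetSum _ fun j _ => hint i j]
    exact Finset.sum_congr rfl fun i _ => integral_finsetSum _ fun j _ => hint i j
  have h2 : ∫ ω, ‖∑ i, D i ω‖ ^ 2 ∂P ≤ ‖((∫ ω, ‖∑ i, D i ω‖ ^ 2 ∂P : ℝ) : ℂ)‖ := by
    rw [Complex.norm_real]
    exact Real.le_norm_self _
  refine h2.trans ?_
  rw [h1]
  refine (norm_sum_le _ _).trans ?_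
  have h3 : ∀ i ∈ Finset.univ, ‖∑ j, ∫ ω, D i ω * conj (D j ω) ∂P‖ ≤ K * M ^ 2 := by
    intro i _
    rw [← Finset.sum_subset (Finset.subset_univ (S i)) fun j _ hj => h0 i j hj]
    refine (norm_sum_le_of_le (S i) (f := fun j => ∫ ω, D i ω * conj (D j ω) ∂P)
      (n := fun _ => M ^ 2) fun j _ => ?_).trans ?_
    · have := norm_integral_le_of_norm_le_const (μ := P) (ae_of_all _ (hbound i j))
      simpa using this
    · rw [Finset.sum_const, nsmul_eq_mul]
      gcongr
      exact hS i
  refine (Finset.sum_le_sum h3).trans ?_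
  simp

end SecondMoment

/-! ### Local approximation of the resolvent on a finite graph -/

section Finite

open Classical

variable {V : Type*} [Fintype V] (d : ℕ) (t : ℝ) {z : ℂ} (hz : z.im ≠ 0) (R : ℕ)

/-- The resolvent at the root of the Bethe lattice, for the potential lifted from the ball of radius
`R` around a vertex `v` of a finite graph by the covering map. -/
def localGreen (Γ : SimpleGraph V) (v : V) (g : V → ℝ) : ℂ :=
  treeGreen d t hz (truncate R fun x => g (coveringMap Γ v x))

/-- The mean resolvent at the root for the potential restricted to the ball of radius `R`. -/
def meanGreen : ℂ := ∫ h, treeGreen d t hz (truncate R h) ∂gaussianField d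

/-- The law of independent standard Gaussian variables at the vertices of a finite graph. -/
def vertexField (V : Type*) : Measure (V → ℝ) := Measure.infinitePi fun _ => gaussianReal 0 1

instance (V : Type*) : IsProbabilityMeasure (vertexField V) := by
  unfold vertexField
  infer_instance

/-- The resolvent at the root as a function of the potential on the ball of radius `R`. -/
def ballGreen (u : {x : BetheVertex d // depth x ≤ R} → ℝ) : ℂ :=
  treeGreen d t hz fun x => if h : depth x ≤ R then u ⟨x, h⟩ else 0

theorem treeGreen_truncate (h : BetheVertex d → ℝ) :
    treeGreen d t hz (truncate R h) = ballGreen d t hz R fun x => h x := by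
  unfold ballGreen truncate
  congr 1

theorem measurable_ballGreen : Measurable (ballGreen d t hz R) := by
  refine (measurable_treeGreen d t hz).comp (measurable_pi_iff.2 fun x => ?_)
  split_ifs with h
  · exact measurable_pi_apply _
  · exact measurable_const

theorem norm_meanGreen_le : ‖meanGreen d t hz R‖ ≤ 1 / |z.im| := by
  have := norm_integral_le_of_norm_le_const (μ := gaussianField d)
    (ae_of_all _ fun h => norm_treeGreen_le d t hz (truncate R h))
  simpa [meanGreen] using this

theorem norm_meanGreen_sub_le (hR : 0 < R) :
    ‖meanGreen d t hz R - stieltjesTransform (densityOfStates d t) z‖ ≤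
      |t| * d * (1 / |z.im|) / (R * |z.im|) := by
  rw [stieltjesTransform_densityOfStates d t hz, meanGreen, ← integral_sub]
  · have := norm_integral_le_of_norm_le_const (μ := gaussianField d)
      (ae_of_all _ fun h => norm_treeGreen_truncate_sub_le d t hz hR h)
    simpa using this
  · exact Integrable.of_bound
      (continuous_treeGreen_truncate d t hz R).measurable.aestronglyMeasurable _ (ae_of_all _ fun h => norm_treeGreen_le d t hz _)
  · exact Integrable.of_bound (measurable_treeGreen d t hz).aestronglyMeasurable _
      (ae_of_all _ fun h => norm_treeGreen_le d t hz _)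

theorem localGreen_eq (Γ : SimpleGraph V) (v : V) (g : V → ℝ) : localGreen d t hz R Γ v g =
    ballGreen d t hz R fun x => g (coveringMap Γ v (x : BetheVertex d)) :=
  treeGreen_truncate d t hz R _

theorem norm_greenColumn_sub_localGreen_le [inst : DecidableEq V] {Γ : SimpleGraph V}
    (hΓ : Γ.IsRegularOfDegree d) (hR : 0 < R) {v : V} (hv : v ∉ badVertices d Γ R) (g : V → ℝ) :
    ‖(greenColumn Γ (fun v => (hΓ v).le) t g hz v : lp (fun _ : V => ℂ) 2) v -
      localGreen d t hz R Γ v g‖ ≤ |t| * d * (1 / |z.im|) / (R * |z.im|) := by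
  obtain rfl : inst = fun a b => propDecidable (a = b) := Subsingleton.elim _ _
  have hinj : Set.InjOn (coveringMap Γ v : BetheVertex d → V) {x | depth x ≤ R} := by
    simpa [badVertices] using hv
  exact norm_greenColumn_sub_treeGreen_le d t hz Γ (fun v => (hΓ v).le) g (coveringMap Γ v) hR
    (coveringMap_bijOn Γ hΓ v) hinj fun x hx => if_pos hx

theorem measurable_localGreen (Γ : SimpleGraph V) (v : V) :
    Measurable (localGreen d t hz R Γ v) := by
  simp_rw [funext fun g => localGreen_eq d t hz R Γ v g]
  exact (measurable_ballGreen d t hz R).comp (by fun_prop)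

/-- Where a finite graph looks like the Bethe lattice, the local resolvent has the right mean. -/
theorem integral_localGreen {Γ : SimpleGraph V} {v : V} (hv : v ∉ badVertices d Γ R) :
    ∫ g, localGreen d t hz R Γ v g ∂vertexField V = meanGreen d t hz R := by
  simp_rw [localGreen_eq, meanGreen, treeGreen_truncate]
  have hinj : Function.Injective fun x : {x : BetheVertex d // depth x ≤ R} =>
      coveringMap Γ v (x : BetheVertex d) := by
    have : Set.InjOn (coveringMap Γ v : BetheVertex d → V) {x | depth x ≤ R} := by
      simpa [badVertices] using hv
    exact fun x y hxy => Subtype.ext (this x.2 y.2 hxy)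
  have h1 := Measure.map_infinitePi_infinitePi_of_inj (P := fun _ : V => gaussianReal 0 1) hinj
  have h2 := Measure.map_infinitePi_infinitePi_of_inj
    (P := fun _ : BetheVertex d => gaussianReal 0 1)
    (Subtype.val_injective (p := fun x : BetheVertex d => depth x ≤ R))
  have h3 := integral_map (μ := vertexField V)
    (φ := fun g (x : {x : BetheVertex d // depth x ≤ R}) => g (coveringMap Γ v (x : BetheVertex d))) (Measurable.aemeasurable (by fun_prop))
    (measurable_ballGreen d t hz R).aestronglyMeasurable
  have h4 := integral_map (μ := gaussianField d)
    (φ := fun g (x : {x : BetheVertex d // depth x ≤ R}) => g (x : BetheVertex d)) (Measurable.aemeasurable (by fun_prop))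
    (measurable_ballGreen d t hz R).aestronglyMeasurable
  rw [← h3, ← h4, vertexField, gaussianField, h1, h2]

/-- The local resolvents around two vertices that are far apart are independent. -/
theorem indepFun_localGreen {Γ : SimpleGraph V} {v w : V}
    (hvw : ∀ x y : BetheVertex d, depth x ≤ R → depth y ≤ R →
      coveringMap Γ v x ≠ coveringMap Γ w y) :
    IndepFun (localGreen d t hz R Γ v) (localGreen d t hz R Γ w) (vertexField V) := by
  let S : V → Finset V := fun v => (treeBall d R).image (coveringMap Γ v)
  have hS : ∀ (v : V) (x : {x : BetheVertex d // depth x ≤ R}),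
      coveringMap Γ v (x : BetheVertex d) ∈ S v :=
    fun v x => Finset.mem_image_of_mem _ (mem_treeBall.2 x.2)
  have hdisj : Disjoint (S v) (S w) := by
    rw [Finset.disjoint_left]
    intro a ha hb
    obtain ⟨x, hx, rfl⟩ := Finset.mem_image.1 ha
    obtain ⟨y, hy, hxy⟩ := Finset.mem_image.1 hb
    exact hvw x y (mem_treeBall.1 hx) (mem_treeBall.1 hy) hxy.symm
  have h1 : iIndepFun (fun (a : V) (g : V → ℝ) => g a) (vertexField V) :=
    iIndepFun_infinitePi (X := fun _ x => x) fun _ => measurable_id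
  have h2 := h1.indepFun_finset (S v) (S w) hdisj fun a => measurable_pi_apply a
  let Ψ : ∀ v : V, (S v → ℝ) → ℂ := fun v u =>
    ballGreen d t hz R fun x => u ⟨coveringMap Γ v (x : BetheVertex d), hS v x⟩
  have hΨ : ∀ v, Measurable (Ψ v) := fun v =>
    (measurable_ballGreen d t hz R).comp (measurable_pi_iff.2 fun x => measurable_pi_apply _)
  have h3 := h2.comp (hΨ v) (hΨ w)
  have h4 : ∀ v, localGreen d t hz R Γ v = Ψ v ∘ fun g (a : S v) => g a := fun v => by
    ext g
    exact localGreen_eq d t hz R Γ v g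
  rw [h4, h4]
  exact h3

/-- The deviation of the local resolvent from its mean, set to zero at the bad vertices. -/
def localDeviation (Γ : SimpleGraph V) (v : V) (g : V → ℝ) : ℂ :=
  if v ∈ badVertices d Γ R then 0 else localGreen d t hz R Γ v g - meanGreen d t hz R

theorem measurable_localDeviation (Γ : SimpleGraph V) (v : V) :
    Measurable (localDeviation d t hz R Γ v) := by
  unfold localDeviation
  split_ifs
  · exact measurable_const
  · exact (measurable_localGreen d t hz R Γ v).sub_const _

theorem norm_localDeviation_le (Γ : SimpleGraph V) (v : V) (g : V → ℝ) :
    ‖localDeviation d t hz R Γ v g‖ ≤ 2 / |z.im| := by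
  have h2 : 2 / |z.im| = 1 / |z.im| + 1 / |z.im| := by ring
  rw [localDeviation, h2]
  split_ifs
  · rw [norm_zero]
    positivity
  · exact (norm_sub_le _ _).trans (add_le_add (norm_treeGreen_le d t hz _)
      (norm_meanGreen_le d t hz R))

theorem integral_localDeviation_mul_conj {Γ : SimpleGraph V} (hΓ : Γ.IsRegularOfDegree d) {v w : V}
    (hw : w ∉ walkBall Γ (2 * R) v) :
    ∫ g, localDeviation d t hz R Γ v g * conj (localDeviation d t hz R Γ w g) ∂vertexField V = 0 := by
  by_cases hv' : v ∈ badVertices d Γ R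
  · simp [localDeviation, hv']
  by_cases hw' : w ∈ badVertices d Γ R
  · simp [localDeviation, hw']
  have hind : IndepFun (localGreen d t hz R Γ v) (localGreen d t hz R Γ w) (vertexField V) := by
    refine indepFun_localGreen d t hz R fun x y hx hy hxy => hw ?_
    change coveringMap Γ w (none : BetheVertex d) ∈
      walkBall Γ (2 * R) (coveringMap Γ v (none : BetheVertex d))
    obtain ⟨p, hp, -⟩ := exists_walk_of_depth (coveringMap_bijOn Γ hΓ v) x
    obtain ⟨q, hq, -⟩ := exists_walk_of_depth (coveringMap_bijOn Γ hΓ w) y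
    refine mem_walkBall.2 ⟨p.append (q.reverse.copy hxy.symm rfl), ?_⟩
    rw [SimpleGraph.Walk.length_append, SimpleGraph.Walk.length_copy,
      SimpleGraph.Walk.length_reverse, hp, hq]
    omega
  have hi : ∀ u, Integrable (localGreen d t hz R Γ u) (vertexField V) := fun u =>
    Integrable.of_bound (measurable_localGreen d t hz R Γ u).aestronglyMeasurable _
      (ae_of_all _ fun g => norm_treeGreen_le d t hz _)
  have h1 : ∫ g, (localGreen d t hz R Γ v g - meanGreen d t hz R) ∂vertexField V = 0 := by
    rw [integral_sub (hi v) (integrable_const _), integral_localGreen d t hz R hv']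
    simp
  simp only [localDeviation, if_neg hv', if_neg hw']
  have h2 := hind.integral_fun_comp_mul_comp (f := fun a => a - meanGreen d t hz R)
    (g := fun a => conj (a - meanGreen d t hz R))
    (measurable_localGreen d t hz R Γ v).aemeasurable
    (measurable_localGreen d t hz R Γ w).aemeasurable
    (Continuous.aestronglyMeasurable (by fun_prop))
    (Continuous.aestronglyMeasurable (Complex.continuous_conj.comp (by fun_prop)))
  rw [h2, h1, zero_mul]

/-- Law of large numbers for the local resolvents, with a bound that is uniform in the graph. -/
theorem measureReal_sum_localDeviation_le {Γ : SimpleGraph V} (hΓ : Γ.IsRegularOfDegree d) {δ : ℝ}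
    (hδ : 0 < δ) [Nonempty V] :
    (vertexField V).real {g | δ ≤ ‖(Fintype.card V : ℂ)⁻¹ * ∑ v, localDeviation d t hz R Γ v g‖} ≤
      (d + 1) ^ (2 * R) * (2 / |z.im|) ^ 2 / δ ^ 2 / Fintype.card V := by
  have hN : (0 : ℝ) < Fintype.card V := by exact_mod_cast Fintype.card_pos
  have h1 := integral_norm_sq_sum_le (vertexField V) (measurable_localDeviation d t hz R Γ)
    (norm_localDeviation_le d t hz R Γ) (walkBall Γ (2 * R))
    (card_walkBall_le (fun v => (hΓ v).le) (2 * R))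
    (fun v w hw => integral_localDeviation_mul_conj d t hz R hΓ hw)
  have hi : Integrable (fun g => ‖∑ v, localDeviation d t hz R Γ v g‖ ^ 2) (vertexField V) := by
    refine Integrable.of_bound (C := (Fintype.card V * (2 / |z.im|)) ^ 2) ?_ (ae_of_all _ fun g => ?_)
    · exact ((Finset.measurable_fun_sum _ fun v _ =>
        measurable_localDeviation d t hz R Γ v).norm.pow_const 2).aestronglyMeasurable
    · rw [Real.norm_of_nonneg (by positivity)]
      gcongr
      refine (norm_sum_le_of_le _ fun v _ => norm_localDeviation_le d t hz R Γ v g).trans ?_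
      simp
  have h2 := mul_meas_ge_le_integral_of_nonneg (ae_of_all _ fun g => by positivity) hi
    ((Fintype.card V * δ) ^ 2)
  have h3 : {g : V → ℝ | δ ≤ ‖(Fintype.card V : ℂ)⁻¹ * ∑ v, localDeviation d t hz R Γ v g‖} =
      {g | (Fintype.card V * δ) ^ 2 ≤ ‖∑ v, localDeviation d t hz R Γ v g‖ ^ 2} := by
    ext g
    rw [Set.mem_ofPred_eq, Set.mem_ofPred_eq, sq_le_sq₀ (by positivity) (norm_nonneg _), norm_mul,
      norm_inv, Complex.norm_natCast, inv_mul_eq_div, le_div_iff₀ hN, mul_comm]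
  rw [h3]
  have h4 := h2.trans h1
  push_cast at h4
  rw [le_div_iff₀ hN, le_div_iff₀ (by positivity)]
  refine le_of_mul_le_mul_left ?_ hN
  calc _ = ((Fintype.card V : ℝ) * δ) ^ 2 * (vertexField V).real
        {g | ((Fintype.card V : ℝ) * δ) ^ 2 ≤ ‖∑ v, localDeviation d t hz R Γ v g‖ ^ 2} := by ring
    _ ≤ _ := h4

end Finite
end
end BetheAnderson

namespace BetheAnderson

noncomputable section

/-! ### The normalized trace of the resolvent of a finite graph -/

section Trace

open Classical

variable {N : ℕ} (d : ℕ) (t : ℝ) {z : ℂ} (hz : z.im ≠ 0)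

/-- The resolvent columns on `ℓ²` are the columns of the inverse matrix. -/
theorem normalizedTrace_andersonMatrix (Γ : SimpleGraph (Fin N)) (hΓ : ∀ v, Γ.degree v ≤ d)
    (g : Fin N → ℝ) : normalizedTrace (andersonMatrix t Γ g) z =
      (N : ℂ)⁻¹ * ∑ v, (greenColumn Γ hΓ t g hz v : lp (fun _ : Fin N => ℂ) 2) v := by
  have h1 : matrixResolvent (andersonMatrix t Γ g) z =
      Matrix.of fun w v => (greenColumn Γ hΓ t g hz v : lp (fun _ : Fin N => ℂ) 2) w := by
    refine Matrix.inv_eq_right_inv ?_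
    ext w v
    rw [Matrix.one_apply, ← greenColumn_eq Γ hΓ t g hz v w, Matrix.mul_apply]
    have h2 : ∀ y, ((andersonMatrix t Γ g).map (fun x : ℝ => (x : ℂ)) -
        z • (1 : Matrix (Fin N) (Fin N) ℂ)) w y =
        -(t : ℂ) * (if Γ.Adj w y then 1 else 0) + if w = y then (g w - z : ℂ) else 0 := by
      intro y
      rw [andersonMatrix, Matrix.sub_apply, Matrix.map_apply, Matrix.add_apply, Matrix.smul_apply,
        SimpleGraph.adjMatrix_apply, Matrix.diagonal_apply, Matrix.smul_apply, Matrix.one_apply]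
      split_ifs <;> simp
      ring
    simp_rw [h2, Matrix.of_apply, add_mul, Finset.sum_add_distrib, mul_assoc, ← Finset.mul_sum,
      ite_mul, one_mul, zero_mul, Finset.sum_ite_eq, Finset.mem_univ, if_true]
    congr 2
    rw [← Finset.sum_filter]
    refine Finset.sum_congr ?_ fun _ _ => rfl
    ext y
    simp
  rw [normalizedTrace, h1]
  rfl

/-- The normalized trace of the resolvent is the mean over the vertices of the local resolvents, up
to a small error and the contribution of the bad vertices. -/
theorem norm_normalizedTrace_sub_le (hN : 0 < N) {R : ℕ} (hR : 0 < R) {Γ : SimpleGraph (Fin N)}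
    (hΓ : Γ.IsRegularOfDegree d) (g : Fin N → ℝ) :
    ‖normalizedTrace (andersonMatrix t Γ g) z - stieltjesTransform (densityOfStates d t) z‖ ≤
      2 * (|t| * d * (1 / |z.im|) / (R * |z.im|)) +
        2 / |z.im| * (badVertices d Γ R).card / N +
        ‖(Fintype.card (Fin N) : ℂ)⁻¹ * ∑ v, localDeviation d t hz R Γ v g‖ := by
  set C := |t| * d * (1 / |z.im|) / (R * |z.im|) with hC
  set m := meanGreen d t hz R with hm
  set D := fun v => localDeviation d t hz R Γ v g with hD
  set φ := fun v => (greenColumn Γ (fun v => (hΓ v).le) t g hz v : lp (fun _ : Fin N => ℂ) 2) v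
    with hφ
  have hC0 : 0 ≤ C := by positivity
  have hN' : (N : ℂ) ≠ 0 := by exact_mod_cast hN.ne'
  have hN0 : (0 : ℝ) < N := by exact_mod_cast hN
  have h1 : ∀ v, ‖φ v - m - D v‖ ≤ C + if v ∈ badVertices d Γ R then 2 / |z.im| else 0 := by
    intro v
    by_cases hv : v ∈ badVertices d Γ R
    · simp only [hD, localDeviation, if_pos hv, sub_zero]
      have h2 : ‖φ v‖ ≤ 1 / |z.im| :=
        (lp.norm_apply_le_norm (by simp) _ _).trans (norm_greenColumn_le _ _ _ _ hz _)
      have h3 := norm_meanGreen_le d t hz R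
      have h4 := norm_sub_le (φ v) m
      have h5 : 2 / |z.im| = 1 / |z.im| + 1 / |z.im| := by ring
      rw [h5]
      linarith
    · simp only [hD, localDeviation, if_neg hv, add_zero]
      rw [← hm, sub_sub_sub_cancel_right]
      exact norm_greenColumn_sub_localGreen_le d t hz R hΓ hR hv g
  have h2 : normalizedTrace (andersonMatrix t Γ g) z - m =
      (N : ℂ)⁻¹ * ∑ v, (φ v - m - D v) + (N : ℂ)⁻¹ * ∑ v, D v := by
    rw [normalizedTrace_andersonMatrix d t hz Γ (fun v => (hΓ v).le) g, ← mul_add,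
      ← Finset.sum_add_distrib]
    simp only [sub_add_cancel]
    rw [Finset.sum_sub_distrib, Finset.sum_const, Finset.card_univ, Fintype.card_fin, nsmul_eq_mul,
      mul_sub, inv_mul_cancel_left₀ hN']
  have h3 : ‖(N : ℂ)⁻¹ * ∑ v, (φ v - m - D v)‖ ≤ C + 2 / |z.im| * (badVertices d Γ R).card / N := by
    rw [norm_mul, norm_inv, Complex.norm_natCast, inv_mul_le_iff₀ hN0]
    refine (norm_sum_le_of_le _ fun v _ => h1 v).trans (le_of_eq ?_)
    rw [Finset.sum_add_distrib, Finset.sum_const, Finset.card_univ, Fintype.card_fin, nsmul_eq_mul,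
      Finset.sum_ite_mem, Finset.univ_inter, Finset.sum_const, nsmul_eq_mul]
    field_simp
  have h4 := norm_meanGreen_sub_le d t hz R hR
  rw [← hC, ← hm] at h4
  rw [Fintype.card_fin]
  calc _ = ‖(normalizedTrace (andersonMatrix t Γ g) z - m) +
        (m - stieltjesTransform (densityOfStates d t) z)‖ := by rw [sub_add_sub_cancel]
    _ ≤ ‖normalizedTrace (andersonMatrix t Γ g) z - m‖ + C :=
        (norm_add_le _ _).trans (add_le_add_right h4 _)
    _ ≤ ‖(N : ℂ)⁻¹ * ∑ v, (φ v - m - D v)‖ + ‖(N : ℂ)⁻¹ * ∑ v, D v‖ + C := by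
        rw [h2]
        gcongr
        exact norm_add_le _ _
    _ ≤ _ := by linarith

end Trace

/-! ### Convergence in probability -/

section Probability

open Classical

instance {V : Type*} [Countable V] : MeasurableSingletonClass (SimpleGraph V) := by
  constructor
  intro Γ
  have h1 : ({Γ} : Set (SimpleGraph V)) = ⋂ u, ⋂ v, {Γ' | Γ'.Adj u v ↔ Γ.Adj u v} := by
    ext Γ'
    simp only [Set.mem_singleton_iff, Set.mem_iInter, Set.mem_ofPred_eq]
    constructor
    · rintro rfl
      exact fun _ _ => Iff.rfl
    · intro h
      ext u v
      exact h u v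
  rw [h1]
  refine MeasurableSet.iInter fun u => MeasurableSet.iInter fun v => ?_
  have h2 : Measurable fun Γ' : SimpleGraph V => Γ'.Adj u v :=
    SimpleGraph.measurable_iff_adj.1 measurable_id u v
  exact (h2.iff measurable_const).setOf

/-- Markov's inequality for the number of bad vertices of a uniformly random regular graph. -/
theorem uniformOn_real_badVertices_le {N d : ℕ} (hd : 0 < d) {R : ℕ} (hR : 0 < R)
    (hN : 2 * (d + 1) ^ (2 * R + 2) ≤ N) {c : ℝ} (hc : 0 < c) :
    (uniformOn (regularGraphs d N)).real {Γ | c ≤ (badVertices d Γ R).card} ≤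
      2 * ((d + 1) ^ (2 * R) * d * (d + 1) ^ R) / c := by
  set 𝒢 := (Set.toFinite (regularGraphs d N)).toFinset with h𝒢
  have hmem : ∀ Γ, Γ ∈ 𝒢 ↔ Γ.IsRegularOfDegree d := fun Γ => by
    rw [h𝒢, Set.Finite.mem_toFinset]
    rfl
  set 𝓑 := (Set.toFinite {Γ : SimpleGraph (Fin N) | c ≤ (badVertices d Γ R).card}).toFinset with h𝓑
  have hmem' : ∀ Γ, Γ ∈ 𝓑 ↔ c ≤ (badVertices d Γ R).card := fun Γ => by
    rw [h𝓑, Set.Finite.mem_toFinset]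
    rfl
  have e1 : regularGraphs d N = (𝒢 : Set (SimpleGraph (Fin N))) := by rw [h𝒢, Set.Finite.coe_toFinset]
  have e2 : {Γ : SimpleGraph (Fin N) | c ≤ (badVertices d Γ R).card} =
      (𝓑 : Set (SimpleGraph (Fin N))) := by rw [h𝓑, Set.Finite.coe_toFinset]
  have h1 := sum_card_badVertices_le 𝒢 hd hmem hR
  rw [Fintype.card_fin] at h1
  set K := (d + 1) ^ (2 * R) * d * (d + 1) ^ R with hK
  have hN0 : 0 < N := lt_of_lt_of_le (by positivity) hN
  have h2 : ∑ Γ ∈ 𝒢, (badVertices d Γ R).card ≤ 𝒢.card * (2 * K) := by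
    refine Nat.le_of_mul_le_mul_right (c := N) ?_ hN0
    have h3 : N ≤ 2 * (N - (d + 1) ^ (2 * R + 2)) := by omega
    calc _ ≤ (∑ Γ ∈ 𝒢, (badVertices d Γ R).card) * (2 * (N - (d + 1) ^ (2 * R + 2))) := by gcongr
      _ = 2 * ((∑ Γ ∈ 𝒢, (badVertices d Γ R).card) * (N - (d + 1) ^ (2 * R + 2))) := by ring
      _ ≤ 2 * (𝒢.card * (N * K)) := by gcongr
      _ = _ := by ring
  have h3 : ((𝒢 ∩ 𝓑).card : ℝ) * c ≤ 𝒢.card * (2 * K) := by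
    calc ((𝒢 ∩ 𝓑).card : ℝ) * c = ∑ _Γ ∈ 𝒢 ∩ 𝓑, c := by rw [Finset.sum_const, nsmul_eq_mul]
      _ ≤ ∑ Γ ∈ 𝒢 ∩ 𝓑, ((badVertices d Γ R).card : ℝ) :=
        Finset.sum_le_sum fun Γ hΓ => (hmem' Γ).1 (Finset.mem_inter.1 hΓ).2
      _ ≤ ∑ Γ ∈ 𝒢, ((badVertices d Γ R).card : ℝ) :=
        Finset.sum_le_sum_of_subset_of_nonneg Finset.inter_subset_left fun _ _ _ => Nat.cast_nonneg _
      _ ≤ _ := by exact_mod_cast h2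
  have hK' : (2 * ((d + 1) ^ (2 * R) * d * (d + 1) ^ R) : ℝ) = 2 * K := by
    rw [hK]; push_cast; ring
  rw [hK', measureReal_def, e1, e2, uniformOn_apply_finset, ENNReal.toReal_div, ENNReal.toReal_natCast,
    ENNReal.toReal_natCast]
  refine div_le_of_le_mul₀ (Nat.cast_nonneg _) (by positivity) ?_
  rw [div_mul_eq_mul_div, le_div_iff₀ hc]
  linarith

variable {Ω : Type*} [MeasurableSpace Ω] {P : Measure Ω} [IsProbabilityMeasure P]

/-- The law of large numbers for the local resolvents passes to a random graph by conditioning on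
the graph. -/
theorem measureReal_localDeviation_random_le {N d : ℕ} (hN : 0 < N) (t : ℝ) {z : ℂ} (hz : z.im ≠ 0)
    (R : ℕ) {G : Ω → SimpleGraph (Fin N)} (hG : HasLaw G (uniformOn (regularGraphs d N)) P)
    {γ : Ω → Fin N → ℝ} (hγ : HasLaw γ (vertexField (Fin N)) P) (hind : IndepFun G γ P) {δ : ℝ}
    (hδ : 0 < δ) :
    P.real {ω | G ω ∈ regularGraphs d N ∧
      δ ≤ ‖(Fintype.card (Fin N) : ℂ)⁻¹ * ∑ v, localDeviation d t hz R (G ω) v (γ ω)‖} ≤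
      (d + 1) ^ (2 * R) * (2 / |z.im|) ^ 2 / δ ^ 2 / N := by
  set 𝒢 := (Set.toFinite (regularGraphs d N)).toFinset with h𝒢
  have hmem : ∀ Γ, Γ ∈ 𝒢 ↔ Γ ∈ regularGraphs d N := fun Γ => by
    rw [h𝒢, Set.Finite.mem_toFinset]
  have : Nonempty (Fin N) := ⟨⟨0, hN⟩⟩
  let B : SimpleGraph (Fin N) → Set (Fin N → ℝ) := fun Γ =>
    {g | δ ≤ ‖(Fintype.card (Fin N) : ℂ)⁻¹ * ∑ v, localDeviation d t hz R Γ v g‖}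
  have hB : ∀ Γ, MeasurableSet (B Γ) := fun Γ => by
    refine measurableSet_le measurable_const (Measurable.norm ?_)
    exact (Finset.measurable_fun_sum _ fun v _ =>
      measurable_localDeviation d t hz R Γ v).const_mul _
  set c := (d + 1) ^ (2 * R) * (2 / |z.im|) ^ 2 / δ ^ 2 / (N : ℝ) with hc
  have hc0 : 0 ≤ c := by positivity
  have hB' : ∀ Γ ∈ 𝒢, (vertexField (Fin N)).real (B Γ) ≤ c := fun Γ hΓ => by
    have := measureReal_sum_localDeviation_le d t hz R (Γ := Γ) ((hmem Γ).1 hΓ) hδ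
    refine this.trans_eq ?_
    rw [hc, Fintype.card_fin]
  have h1 : {ω | G ω ∈ regularGraphs d N ∧
      δ ≤ ‖(Fintype.card (Fin N) : ℂ)⁻¹ * ∑ v, localDeviation d t hz R (G ω) v (γ ω)‖} ⊆
      ⋃ Γ ∈ 𝒢, G ⁻¹' {Γ} ∩ γ ⁻¹' (B Γ) := by
    intro ω hω
    exact Set.mem_biUnion (x := G ω) ((hmem _).2 hω.1) ⟨rfl, hω.2⟩
  have h2 : ∀ Γ ∈ 𝒢, P.real (G ⁻¹' {Γ} ∩ γ ⁻¹' (B Γ)) ≤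
      (uniformOn (regularGraphs d N)).real {Γ} * c := fun Γ hΓ => by
    have h3 := hind.measure_inter_preimage_eq_mul {Γ} (B Γ) (measurableSet_singleton _) (hB Γ)
    have h4 : P.real (G ⁻¹' {Γ}) = (uniformOn (regularGraphs d N)).real {Γ} :=
      hG.measureReal_eq (p := fun Γ' => Γ' ∈ ({Γ} : Set (SimpleGraph (Fin N))))
        (measurableSet_singleton _)
    have h5 : P.real (γ ⁻¹' (B Γ)) = (vertexField (Fin N)).real (B Γ) :=
      hγ.measureReal_eq (p := fun g => g ∈ B Γ) (hB Γ)
    rw [measureReal_def, h3, ENNReal.toReal_mul, ← measureReal_def, ← measureReal_def, h4, h5]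
    gcongr
    exact hB' Γ hΓ
  calc _ ≤ P.real (⋃ Γ ∈ 𝒢, G ⁻¹' {Γ} ∩ γ ⁻¹' (B Γ)) := measureReal_mono h1 (measure_ne_top _ _)
    _ ≤ ∑ Γ ∈ 𝒢, P.real (G ⁻¹' {Γ} ∩ γ ⁻¹' (B Γ)) := measureReal_biUnion_finset_le _ _
    _ ≤ ∑ Γ ∈ 𝒢, (uniformOn (regularGraphs d N)).real {Γ} * c := Finset.sum_le_sum h2
    _ = (uniformOn (regularGraphs d N)).real 𝒢 * c := by
      rw [← Finset.sum_mul, sum_measureReal_singleton]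
    _ ≤ 1 * c := by
      gcongr
      exact measureReal_le_one
    _ = c := one_mul c

/-- A quantitative form of the convergence in probability. -/
theorem measureReal_normalizedTrace_sub_le {N d : ℕ} (hd : 0 < d) (t : ℝ) {z : ℂ} (hz : z.im ≠ 0)
    {R : ℕ} (hR : 0 < R) (hN : 2 * (d + 1) ^ (2 * R + 2) ≤ N) {G : Ω → SimpleGraph (Fin N)}
    (hG : HasLaw G (uniformOn (regularGraphs d N)) P)
    {γ : Ω → Fin N → ℝ} (hγ : HasLaw γ (vertexField (Fin N)) P) (hind : IndepFun G γ P) {δ : ℝ}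
    (hδ : 0 < δ) (hRδ : 2 * (|t| * d * (1 / |z.im|) / (R * |z.im|)) ≤ δ) :
    P.real {ω | 4 * δ ≤ ‖normalizedTrace (andersonMatrix t (G ω) (γ ω)) z -
        stieltjesTransform (densityOfStates d t) z‖} ≤
      (2 * ((d + 1) ^ (2 * R) * d * (d + 1) ^ R) / (δ * |z.im| / 2) +
        (d + 1) ^ (2 * R) * (2 / |z.im|) ^ 2 / δ ^ 2) / N := by
  have hN0 : 0 < N := lt_of_lt_of_le (by positivity) hN
  have hN0' : (0 : ℝ) < N := by exact_mod_cast hN0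
  have hz' : 0 < |z.im| := abs_pos.2 hz
  set S₁ : Set Ω := {ω | G ω ∈ (regularGraphs d N)ᶜ} with hS₁
  set S₂ : Set Ω := {ω | δ * |z.im| / 2 * N ≤ (badVertices d (G ω) R).card} with hS₂
  set S₃ : Set Ω := {ω | G ω ∈ regularGraphs d N ∧
      δ ≤ ‖(Fintype.card (Fin N) : ℂ)⁻¹ * ∑ v, localDeviation d t hz R (G ω) v (γ ω)‖} with hS₃
  -- Apart from a null set, a deviation of `4 δ` needs many bad vertices or a deviation of the mean
  -- of the local functionals; the tree approximation takes at most `δ` of the budget.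
  have hsub : {ω | 4 * δ ≤ ‖normalizedTrace (andersonMatrix t (G ω) (γ ω)) z -
        stieltjesTransform (densityOfStates d t) z‖} ⊆ S₁ ∪ (S₂ ∪ S₃) := by
    intro ω hω
    by_contra hcon
    simp only [hS₁, hS₂, hS₃, Set.mem_union, Set.mem_ofPred_eq, Set.mem_compl_iff, not_or, not_not,
      not_and, not_le] at hcon
    obtain ⟨h1, h2, h3⟩ := hcon
    have h4 := norm_normalizedTrace_sub_le d t hz hN0 hR (Γ := G ω) h1 (γ ω)
    have h5 : 2 / |z.im| * (badVertices d (G ω) R).card / N < δ := by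
      rw [div_mul_eq_mul_div, div_div, div_lt_iff₀ (by positivity)]
      linarith
    have h6 := h3 h1
    rw [Set.mem_ofPred_eq] at hω
    linarith
  have hp₁ : P.real S₁ = 0 := by
    rw [hS₁, hG.measureReal_eq (p := fun Γ => Γ ∈ (regularGraphs d N)ᶜ)
      (Set.toFinite _).measurableSet, measureReal_def]
    have : uniformOn (regularGraphs d N) {Γ | Γ ∈ (regularGraphs d N)ᶜ} = 0 := by
      rw [uniformOn_eq_zero_iff (Set.toFinite _)]
      exact Set.inter_compl_self _
    rw [this, ENNReal.toReal_zero]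
  have hp₂ : P.real S₂ ≤
      2 * ((d + 1) ^ (2 * R) * d * (d + 1) ^ R) / (δ * |z.im| / 2 * N) := by
    rw [hS₂, hG.measureReal_eq (p := fun Γ => δ * |z.im| / 2 * N ≤ (badVertices d Γ R).card)
      (Set.toFinite _).measurableSet]
    exact uniformOn_real_badVertices_le hd hR hN (by positivity)
  have hp₃ : P.real S₃ ≤ _ := measureReal_localDeviation_random_le hN0 t hz R hG hγ hind hδ
  have h1 := measureReal_mono (μ := P) hsub
  have h2 := measureReal_union_le (μ := P) S₁ (S₂ ∪ S₃)
  have h3 := measureReal_union_le (μ := P) S₂ S₃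
  rw [add_div, div_div]
  linarith

end Probability
end
end BetheAnderson

theorem proposition6p3 {Ω : Type*} [MeasurableSpace Ω] (P : Measure Ω) [IsProbabilityMeasure P]
    (d : ℕ) (hd : 3 ≤ d) (t : ℝ) (ht : 0 < t)
    (G : ∀ N : ℕ, Ω → SimpleGraph (Fin N)) (g : ℕ → Ω → ℝ)
    (hG : ∀ N ∈ BetheAnderson.admissibleSizes d,
      HasLaw (G N) (uniformOn (BetheAnderson.regularGraphs d N)) P)
    (hg : ∀ i, HasLaw (g i) (gaussianReal 0 1) P)
    (hg_indep : iIndepFun g P)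
    (hG_indep : ∀ N ∈ BetheAnderson.admissibleSizes d, IndepFun (G N) (fun ω i => g i ω) P)
    (z : ℂ) (hz : 0 < z.im) :
    TendstoInMeasure P
      (fun N ω => BetheAnderson.normalizedTrace
        (BetheAnderson.andersonMatrix t (G N ω) (fun i => g i ω)) z)
      (atTop ⊓ 𝓟 (BetheAnderson.admissibleSizes d))
      (fun _ => BetheAnderson.stieltjesTransform (BetheAnderson.densityOfStates d t) z) := by
  rw [tendstoInMeasure_iff_measureReal_norm]
  intro ε hε
  -- The radius is chosen so that the error of the tree approximation is at most `ε / 4`.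
  have hR : ∃ R : ℕ, 0 < R ∧ 2 * (|t| * d * (1 / |z.im|) / (R * |z.im|)) ≤ ε / 4 := by
    have h1 : Tendsto (fun R : ℕ => 2 * (|t| * d * (1 / |z.im|) / (R * |z.im|))) atTop (𝓝 0) := by
      have h2 := Tendsto.const_div_atTop (tendsto_natCast_atTop_atTop.atTop_mul_const
        (abs_pos.2 hz.ne')) (|t| * d * (1 / |z.im|))
      simpa using h2.const_mul 2
    obtain ⟨R, h2, h3⟩ :=
      ((eventually_gt_atTop 0).and (h1.eventually (eventually_le_nhds (show (0 : ℝ) < ε / 4 by positivity)))).exists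
    exact ⟨R, h2, h3⟩
  obtain ⟨R, hR, hRε⟩ := hR
  refine squeeze_zero' (.of_forall fun _ => measureReal_nonneg) ?_
    ((tendsto_const_div_atTop_nhds_zero_nat
      (2 * ((d + 1) ^ (2 * R) * d * (d + 1) ^ R) / (ε / 4 * |z.im| / 2) +
        (d + 1) ^ (2 * R) * (2 / |z.im|) ^ 2 / (ε / 4) ^ 2)).mono_left inf_le_left)
  filter_upwards [mem_inf_of_left (eventually_ge_atTop (2 * (d + 1) ^ (2 * R + 2))),
    mem_inf_of_right (mem_principal_self _)] with N hN hNd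
  have hγ : HasLaw (fun ω (i : Fin N) => g i ω) (BetheAnderson.vertexField (Fin N)) P :=
    (hg_indep.precomp Fin.val_injective).hasLaw_infinitePi (fun i => hg i)
      (aemeasurable_pi_iff.2 fun i => (hg i).aemeasurable)
  have hind : IndepFun (G N) (fun ω (i : Fin N) => g i ω) P :=
    (hG_indep N hNd).comp (φ := id) (ψ := fun (x : ℕ → ℝ) (i : Fin N) => x i) measurable_id
      (measurable_pi_iff.2 fun i => measurable_pi_apply _)
  have := BetheAnderson.measureReal_normalizedTrace_sub_le (by omega) t hz.ne' hR hN (hG N hNd) hγ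
    hind (δ := ε / 4) (by positivity) hRε
  rwa [mul_div_cancel₀ ε (by norm_num : (4 : ℝ) ≠ 0)] at this
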